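/- Let $n, T \ge 0$ be integers, let $M \in \mathbb{R}^{n\times T}$ be a deterministic matrix of rank $r$, and let $E$ be a random $n\times T$ matrix whose entries $E_{i,t}$ are independent with law $\mathcal{N}(0,s^2)$, where $s \ge 0$. Put $X = M + E$. Fix a (deterministic) set $J \subseteq \{1,\dots,n\}$ of $n_A$ row indices, let $A$ and $S$ be the $n_A \times T$ sub-matrices of $X$ and $M$, respectively, formed by the rows with index in $J$, and let $r_S = \operatorname{rank}(S)$. Write $\sigma_1(B) \ge \sigma_2(B) \ge \cdots$ for the singular values of a matrix $B$ (repeated by multiplicity, and continued by zeros), and put $\sigma_X^* = \sigma_{r+1}(X)$ and $\sigma_A^* = \sigma_{r_S+1}(A)$. If $r < T$ and $n_A < n + 4T - 4\sqrt{nT}$, then $\sigma_X^*$ and $\sigma_A^*$ are integrable and $$\mathbb{E}\big[\sigma_X^* - \sigma_A^*\big] \;\ge\; s\big(\sqrt{n} - \sqrt{n_A} - 2\sqrt{T}\big).$$ -/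

import Mathlib

open MeasureTheory ProbabilityTheory
open scoped NNReal

/-- The `(r + 1)`-th largest singular value of a real matrix `B`, viewed as a linear map between
Euclidean spaces. Singular values are counted with multiplicity, and the sequence is continued by
zeros; Mathlib's `LinearMap.singularValues` is indexed from `0`, so index `r` is the
`(r + 1)`-th one. -/
noncomputable def sigmaSucc {m k : Type*} [Fintype m] [Fintype k] [DecidableEq m] [DecidableEq k]
    (B : Matrix m k ℝ) (r : ℕ) : ℝ :=
  (Matrix.toEuclideanLin B).singularValues r

/-- The sub-matrix of `B` formed by the rows whose index lies in `J`. -/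
def rowSubmatrix {n T : ℕ} (B : Matrix (Fin n) (Fin T) ℝ) (J : Finset (Fin n)) :
    Matrix J (Fin T) ℝ :=
  B.submatrix (fun i => (i : Fin n)) id

/-- The noise matrix `E` has independent entries, each with law `N(0, s²)`. -/
def IsGaussianNoise {Ω : Type*} [MeasurableSpace Ω] {n T : ℕ}
    (E : Ω → Matrix (Fin n) (Fin T) ℝ) (s : ℝ≥0) (P : Measure Ω) : Prop :=
  (∀ i t, HasLaw (fun ω => E ω i t) (gaussianReal 0 (s ^ 2)) P) ∧
    iIndepFun (fun (p : Fin n × Fin T) ω => E ω p.1 p.2) P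

/-! Since r < T, σ_X* is at least the minimal gain min ‖X v‖ over unit vectors v. By Weyl's
inequality σ_A* is at most the operator norm of the noise in the rows J, because the singular value
of S with the same index vanishes. Two Gaussian comparisons bound these quantities in mean. Write
χ_k for the mean norm of a standard Gaussian vector in dimension k. Gordon's inequality bounds the
mean minimal gain of a standard Gaussian matrix below by χ_n - χ_T (`integral_minGain_ge`), and
Chevet's bounds the mean operator norm of the rows J above by χ_{n_A} + χ_T (`integral_maxGain_le`).
Both are instances of `integral_nestedLogSumExp_le`: an interpolation between two Gaussian families,
applied to a smooth min-max on finite nets of the spheres.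

The delicate point is the signal M inside X. For T ≤ n a deterministic shift does not decrease the
mean minimal gain (`integral_minGain_le_add`). By orthogonal invariance the shift may be taken
diagonal and nonnegative. The minimum is replaced by a soft minimum of ‖x V e‖ over V in the
orthogonal group, and its mean is differentiated along the shift. The Cameron–Martin formula turns
the shift into an exponential weight. Averaging over independent Haar rotations P, Q on the two
sides leaves, for each V, the integral of the exponential of a positive kernel times a bilinear form
in the entries of P and Q. Its off-diagonal terms cancel under reflections and its diagonal terms
are nonnegative (`integral_orthHaar_nonneg`).

It remains to compare χ_n - 2χ_T with √n - 2√T when T ≤ n (`sqrt_sub_two_sqrt_le_chiMean`), which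
rests on χ_n χ_{n+1} = n and n - 1/2 ≤ χ_n². When n < T the trivial bound σ_X* ≥ 0 is enough. -/

/-! ### Singular values: Weyl's inequality. -/

section SingularValues

open Module

variable {E F : Type*} [NormedAddCommGroup E] [InnerProductSpace ℝ E] [FiniteDimensional ℝ E]
  [NormedAddCommGroup F] [InnerProductSpace ℝ F] [FiniteDimensional ℝ F]

/-- The squared norm of `A v` expanded in an orthonormal basis of right singular vectors. -/
lemma LinearMap.norm_apply_sq_eq_sum_singularValues (A : E →ₗ[ℝ] F) (v : E) :
    ‖A v‖ ^ 2 = ∑ i : Fin (finrank ℝ E), A.singularValues i ^ 2 *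
      inner ℝ (A.isSymmetric_adjoint_comp_self.eigenvectorBasis rfl i) v ^ 2 := by
  set b := A.isSymmetric_adjoint_comp_self.eigenvectorBasis rfl
  have h1 : ‖A v‖ ^ 2 = inner ℝ ((LinearMap.adjoint A ∘ₗ A) v) v := by
    rw [LinearMap.comp_apply, LinearMap.adjoint_inner_left, real_inner_self_eq_norm_sq]
  rw [h1, ← b.sum_inner_mul_inner]
  refine Finset.sum_congr rfl fun i _ => ?_
  have h2 : inner ℝ ((LinearMap.adjoint A ∘ₗ A) v) (b i) =
      A.singularValues i ^ 2 * inner ℝ (b i) v := by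
    rw [A.isSymmetric_adjoint_comp_self v (b i),
      A.isSymmetric_adjoint_comp_self.apply_eigenvectorBasis rfl i, inner_smul_right,
      A.sq_singularValues_fin rfl, real_inner_comm]
    rfl
  rw [h2]
  ring

/-- Weyl's perturbation inequality for singular values. -/
theorem LinearMap.singularValues_le_add (A B : E →ₗ[ℝ] F) {c : ℝ} (hc : 0 ≤ c)
    (h : ∀ v, ‖A v‖ ≤ ‖B v‖ + c * ‖v‖) (k : ℕ) :
    A.singularValues k ≤ B.singularValues k + c := by
  rcases le_or_gt (finrank ℝ E) k with hk | hk
  · rw [A.singularValues_of_finrank_le hk, B.singularValues_of_finrank_le hk]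
    simpa using hc
  let a := A.isSymmetric_adjoint_comp_self.eigenvectorBasis rfl
  let b := B.isSymmetric_adjoint_comp_self.eigenvectorBasis rfl
  let k' : Fin (finrank ℝ E) := ⟨k, hk⟩
  -- One linear condition for each index other than k, hence one fewer than the dimension. A nonzero
  -- solution v lies both in the span of the a i with i ≤ k, where A stretches by at least its k-th
  -- singular value, and in the span of the b i with i ≥ k, where B stretches by at most its own.
  let φ : E →ₗ[ℝ] ({i : Fin (finrank ℝ E) // i ≠ k'} → ℝ) :=
    LinearMap.pi fun i => if i.1 < k' then (innerSL ℝ (b i.1)).toLinearMap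
      else (innerSL ℝ (a i.1)).toLinearMap
  have hφ : LinearMap.ker φ ≠ ⊥ := by
    apply LinearMap.ker_ne_bot_of_finrank_lt
    simp
    omega
  obtain ⟨v, hv, hv0⟩ := Submodule.exists_mem_ne_zero_of_ne_bot hφ
  have hv' : ∀ i : {i : Fin (finrank ℝ E) // i ≠ k'}, φ v i = 0 := by
    intro i; rw [LinearMap.mem_ker.1 hv]; rfl
  have hb : ∀ i : Fin (finrank ℝ E), i < k' → inner ℝ (b i) v = 0 := by
    intro i hi
    simpa [φ, hi] using hv' ⟨i, hi.ne⟩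
  have ha : ∀ i : Fin (finrank ℝ E), k' < i → inner ℝ (a i) v = 0 := by
    intro i hi
    simpa [φ, hi.not_gt] using hv' ⟨i, hi.ne'⟩
  have hA : (A.singularValues k * ‖v‖) ^ 2 ≤ ‖A v‖ ^ 2 := by
    rw [A.norm_apply_sq_eq_sum_singularValues, mul_pow, ← a.sum_sq_norm_inner_right v,
      Finset.mul_sum]
    refine Finset.sum_le_sum fun i _ => ?_
    rw [Real.norm_eq_abs, sq_abs]
    rcases lt_or_ge k' i with hi | hi
    · rw [ha i hi]; simp
    · have := A.singularValues_antitone (show (i : ℕ) ≤ k from hi)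
      have h0 := A.singularValues_nonneg k
      gcongr
  have hB : ‖B v‖ ^ 2 ≤ (B.singularValues k * ‖v‖) ^ 2 := by
    rw [B.norm_apply_sq_eq_sum_singularValues, mul_pow, ← b.sum_sq_norm_inner_right v,
      Finset.mul_sum]
    refine Finset.sum_le_sum fun i _ => ?_
    rw [Real.norm_eq_abs, sq_abs]
    rcases lt_or_ge i k' with hi | hi
    · rw [show inner ℝ (B.isSymmetric_adjoint_comp_self.eigenvectorBasis rfl i) v = 0 from hb i hi]
      simp
    · have := B.singularValues_antitone (show k ≤ (i : ℕ) from hi)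
      have h0 := B.singularValues_nonneg i
      gcongr
  have hpos : 0 < ‖v‖ := norm_pos_iff.2 hv0
  have hA' := (pow_le_pow_iff_left₀ (mul_nonneg (A.singularValues_nonneg k) hpos.le)
    (norm_nonneg _) two_ne_zero).1 hA
  have hB' := (pow_le_pow_iff_left₀ (norm_nonneg _)
    (mul_nonneg (B.singularValues_nonneg k) hpos.le) two_ne_zero).1 hB
  have := (hA'.trans (h v)).trans (add_le_add_left hB' _)
  rw [← add_mul] at this
  exact le_of_mul_le_mul_right this hpos

lemma LinearMap.exists_norm_eq_singularValues (A : E →ₗ[ℝ] F) {k : ℕ} (hk : k < finrank ℝ E) :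
    ∃ v : E, ‖v‖ = 1 ∧ ‖A v‖ = A.singularValues k := by
  let a := A.isSymmetric_adjoint_comp_self.eigenvectorBasis rfl
  refine ⟨a ⟨k, hk⟩, a.norm_eq_one _, ?_⟩
  rw [← pow_left_inj₀ (norm_nonneg _) (A.singularValues_nonneg k) two_ne_zero,
    A.norm_apply_sq_eq_sum_singularValues, Finset.sum_eq_single ⟨k, hk⟩]
  · change _ * inner ℝ (a _) (a _) ^ 2 = _
    simp [a.norm_eq_one]
  · intro i _ hi
    change _ * inner ℝ (a _) (a _) ^ 2 = _
    rw [a.inner_eq_zero hi]; simp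
  · simp

end SingularValues

/-! ### The minimal gain of a matrix and its stability under perturbation. -/

section MinimalGain

variable {ι τ : Type*} [Fintype ι] [Fintype τ] [DecidableEq τ]

/-- The infimum of `‖B v‖` over the Euclidean unit sphere. -/
noncomputable def minGain (B : Matrix ι τ ℝ) : ℝ :=
  ⨅ v : Metric.sphere (0 : EuclideanSpace ℝ τ) 1, ‖Matrix.toEuclideanLin B v‖

lemma minGain_le (B : Matrix ι τ ℝ) {v : EuclideanSpace ℝ τ} (hv : ‖v‖ = 1) :
    minGain B ≤ ‖Matrix.toEuclideanLin B v‖ :=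
  ciInf_le (f := fun v : Metric.sphere (0 : EuclideanSpace ℝ τ) 1 => ‖Matrix.toEuclideanLin B v‖)
    ⟨0, by rintro _ ⟨w, rfl⟩; positivity⟩ ⟨v, by simpa using hv⟩

lemma minGain_nonneg (B : Matrix ι τ ℝ) : 0 ≤ minGain B :=
  Real.iInf_nonneg fun _ => norm_nonneg _

lemma le_minGain [Nonempty τ] (B : Matrix ι τ ℝ) {c : ℝ}
    (h : ∀ v : EuclideanSpace ℝ τ, ‖v‖ = 1 → c ≤ ‖Matrix.toEuclideanLin B v‖) : c ≤ minGain B := by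
  have : Nonempty (Metric.sphere (0 : EuclideanSpace ℝ τ) 1) :=
    (NormedSpace.sphere_nonempty.2 zero_le_one).to_subtype
  exact le_ciInf fun v => h v (by simp)

lemma exists_lt_minGain_add [Nonempty τ] (B : Matrix ι τ ℝ) {δ : ℝ} (hδ : 0 < δ) :
    ∃ v : EuclideanSpace ℝ τ, ‖v‖ = 1 ∧ ‖Matrix.toEuclideanLin B v‖ < minGain B + δ := by
  have : Nonempty (Metric.sphere (0 : EuclideanSpace ℝ τ) 1) :=
    (NormedSpace.sphere_nonempty.2 zero_le_one).to_subtype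
  obtain ⟨v, hv⟩ := exists_lt_of_ciInf_lt (lt_add_of_pos_right (minGain B) hδ)
  exact ⟨v, by simp, hv⟩

/-- Each of these singular values is the gain at a unit right singular vector, so the minimal gain
need not be identified with the last one. This is where r < T enters. -/
lemma minGain_le_sigmaSucc [DecidableEq ι] (B : Matrix ι τ ℝ) {k : ℕ} (hk : k < Fintype.card τ) :
    minGain B ≤ sigmaSucc B k := by
  obtain ⟨v, hv, h⟩ := (Matrix.toEuclideanLin B).exists_norm_eq_singularValues (k := k) (by simpa)
  exact (minGain_le B hv).trans h.le

lemma minGain_le_add [Nonempty τ] (A B : Matrix ι τ ℝ) {c : ℝ}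
    (h : ∀ v, ‖Matrix.toEuclideanLin (A - B) v‖ ≤ c * ‖v‖) : minGain A ≤ minGain B + c := by
  rw [← sub_le_iff_le_add]
  refine le_minGain B fun v hv => ?_
  have h1 := minGain_le A hv
  have h2 := h v
  have h3 := norm_sub_norm_le (Matrix.toEuclideanLin A v) (Matrix.toEuclideanLin B v)
  rw [← LinearMap.sub_apply, ← map_sub] at h3
  rw [hv] at h2
  linarith

lemma sigmaSucc_le_add [DecidableEq ι] (A B : Matrix ι τ ℝ) {c : ℝ} (hc : 0 ≤ c)
    (h : ∀ v, ‖Matrix.toEuclideanLin (A - B) v‖ ≤ c * ‖v‖) (k : ℕ) :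
    sigmaSucc A k ≤ sigmaSucc B k + c := by
  refine LinearMap.singularValues_le_add _ _ hc (fun v => ?_) k
  have h3 := norm_sub_norm_le (Matrix.toEuclideanLin A v) (Matrix.toEuclideanLin B v)
  rw [← LinearMap.sub_apply, ← map_sub] at h3
  linarith [h v]

lemma sigmaSucc_nonneg [DecidableEq ι] (A : Matrix ι τ ℝ) (k : ℕ) : 0 ≤ sigmaSucc A k :=
  LinearMap.singularValues_nonneg _ _

/-- With indices starting at 0, the rank is the first index past the nonzero singular values. Weyl's
inequality then bounds the same singular value of a perturbed matrix by the perturbation alone. -/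
lemma sigmaSucc_rank [DecidableEq ι] (A : Matrix ι τ ℝ) : sigmaSucc A A.rank = 0 := by
  rw [sigmaSucc, Matrix.rank_eq_finrank_range_toLin A (EuclideanSpace.basisFun ι ℝ).toBasis
    (EuclideanSpace.basisFun τ ℝ).toBasis, ← Matrix.toEuclideanLin_eq_toLin_orthonormal]
  exact LinearMap.singularValues_finrank_range_self _

end MinimalGain

/-! ### Standard Gaussian measure: density, Cameron–Martin, integration by parts. -/

section StdGaussian

open Module

variable {E : Type*} [NormedAddCommGroup E] [InnerProductSpace ℝ E] [FiniteDimensional ℝ E]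
  [MeasurableSpace E] [BorelSpace E]

/-- The density of the standard Gaussian measure with respect to Lebesgue measure. -/
noncomputable def stdGaussianDensity (x : E) : ℝ :=
  (2 * Real.pi) ^ (-(finrank ℝ E : ℝ) / 2) * Real.exp (-‖x‖ ^ 2 / 2)

omit [FiniteDimensional ℝ E] [MeasurableSpace E] [BorelSpace E] in
lemma stdGaussianDensity_pos (x : E) : 0 < stdGaussianDensity x := by
  unfold stdGaussianDensity; positivity

omit [FiniteDimensional ℝ E] [MeasurableSpace E] [BorelSpace E] in
lemma continuous_stdGaussianDensity : Continuous (stdGaussianDensity : E → ℝ) := by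
  unfold stdGaussianDensity; fun_prop

/-- Serves twice: at t = 0 it forces the density to be integrable, and for general t it identifies
the measure through its characteristic function. -/
lemma integral_cexp_inner_mul_stdGaussianDensity (t : E) :
    ∫ x : E, (stdGaussianDensity x : ℂ) * Complex.exp (inner ℝ x t * Complex.I) =
      Complex.exp (-‖t‖ ^ 2 / 2) := by
  have h := GaussianFourier.integral_cexp_neg_mul_sq_norm_add (V := E) (b := 1 / 2) (by norm_num)
    Complex.I t
  have h2 : ∀ x : E, (stdGaussianDensity x : ℂ) * Complex.exp (inner ℝ x t * Complex.I) =
      (((2 * Real.pi) ^ (-(finrank ℝ E : ℝ) / 2) : ℝ) : ℂ) *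
      Complex.exp (-(1 / 2) * ‖x‖ ^ 2 + Complex.I * inner ℝ t x) := by
    intro x
    rw [stdGaussianDensity, Complex.exp_add, real_inner_comm]
    push_cast
    ring_nf
  simp_rw [h2]
  rw [integral_const_mul, h, ← mul_assoc]
  have h3 : (((2 * Real.pi) ^ (-(finrank ℝ E : ℝ) / 2) : ℝ) : ℂ) *
      (↑Real.pi / (1 / 2)) ^ ((finrank ℝ E : ℂ) / 2) = 1 := by
    have : ((Real.pi : ℂ) / (1 / 2)) = ((2 * Real.pi : ℝ) : ℂ) := by push_cast; ring
    rw [this, show ((finrank ℝ E : ℂ) / 2) = (((finrank ℝ E : ℝ) / 2 : ℝ) : ℂ) by push_cast; ring,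
      ← Complex.ofReal_cpow (by positivity), ← Complex.ofReal_mul, neg_div, Real.rpow_neg
      (by positivity), inv_mul_cancel₀ (by positivity), Complex.ofReal_one]
  rw [h3, Complex.I_sq]
  ring_nf

lemma integrable_stdGaussianDensity : Integrable (stdGaussianDensity : E → ℝ) := by
  have h : Integrable fun x : E => (stdGaussianDensity x : ℂ) := by
    -- A non-integrable function has integral 0 by convention, whereas the Fourier formula at t = 0
    -- gives 1.
    by_contra hc
    have h0 := integral_cexp_inner_mul_stdGaussianDensity (0 : E)
    simp [integral_undef hc] at h0
  simpa using h.re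

theorem stdGaussian_eq_withDensity :
    stdGaussian E = volume.withDensity fun x => ENNReal.ofReal (stdGaussianDensity x) := by
  have hm : Measurable (stdGaussianDensity : E → ℝ) := continuous_stdGaussianDensity.measurable
  have : IsFiniteMeasure (volume.withDensity fun x : E => ENNReal.ofReal (stdGaussianDensity x)) :=
    isFiniteMeasure_withDensity_ofReal integrable_stdGaussianDensity.2
  refine Measure.ext_of_charFun ?_
  ext t
  rw [charFun_stdGaussian, charFun_apply, integral_withDensity_eq_integral_toReal_smul
    (by fun_prop) (by simp), ← integral_cexp_inner_mul_stdGaussianDensity]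
  refine integral_congr_ae (Filter.Eventually.of_forall fun x => ?_)
  simp [ENNReal.toReal_ofReal (stdGaussianDensity_pos x).le]

lemma integral_stdGaussian {F : Type*} [NormedAddCommGroup F] [NormedSpace ℝ F] (f : E → F) :
    ∫ x, f x ∂(stdGaussian E) = ∫ x, stdGaussianDensity x • f x := by
  have hm : Measurable (stdGaussianDensity : E → ℝ) := continuous_stdGaussianDensity.measurable
  rw [stdGaussian_eq_withDensity, integral_withDensity_eq_integral_toReal_smul
    (by fun_prop) (by simp)]
  simp [ENNReal.toReal_ofReal (stdGaussianDensity_pos _).le]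

lemma integrable_stdGaussian_iff {f : E → ℝ} :
    Integrable f (stdGaussian E) ↔ Integrable fun x => stdGaussianDensity x * f x := by
  have hm : Measurable (stdGaussianDensity : E → ℝ) := continuous_stdGaussianDensity.measurable
  rw [stdGaussian_eq_withDensity, integrable_withDensity_iff_integrable_smul' (by fun_prop)
    (by simp)]
  simp [ENNReal.toReal_ofReal (stdGaussianDensity_pos _).le]

/-- The Cameron–Martin formula for the standard Gaussian measure. -/
theorem integral_add_stdGaussian (m : E) (f : E → ℝ) :
    ∫ x, f (m + x) ∂(stdGaussian E) =
      ∫ x, Real.exp (inner ℝ m x - ‖m‖ ^ 2 / 2) * f x ∂(stdGaussian E) := by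
  rw [integral_stdGaussian, integral_stdGaussian,
    ← integral_add_left_eq_self (fun x => stdGaussianDensity x • (_ * f x)) m]
  congr 1
  ext x
  simp only [stdGaussianDensity, smul_eq_mul]
  rw [← mul_assoc, mul_assoc _ (Real.exp _) (Real.exp _), ← Real.exp_add, norm_add_sq_real,
    inner_add_right, real_inner_self_eq_norm_sq]
  ring_nf

omit [FiniteDimensional ℝ E] [MeasurableSpace E] [BorelSpace E] in
lemma hasFDerivAt_stdGaussianDensity (x : E) :
    HasFDerivAt (stdGaussianDensity : E → ℝ) (-(stdGaussianDensity x) • innerSL ℝ x) x := by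
  have h := (((hasStrictFDerivAt_norm_sq x).hasFDerivAt.const_mul (-(1 / 2) : ℝ)).exp).const_mul
    ((2 * Real.pi) ^ (-(finrank ℝ E : ℝ) / 2))
  refine (h.congr_of_eventuallyEq (Filter.Eventually.of_forall fun y => ?_)).congr_fderiv ?_
  · simp only [stdGaussianDensity]; ring_nf
  · ext v
    simp [stdGaussianDensity]
    ring_nf

/-- Gaussian integration by parts. -/
theorem integral_fderiv_stdGaussian {f : E → ℝ} (hf : Differentiable ℝ f) (v : E)
    (h1 : Integrable f (stdGaussian E))
    (h2 : Integrable (fun x => fderiv ℝ f x v) (stdGaussian E))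
    (h3 : Integrable (fun x => f x * inner ℝ x v) (stdGaussian E)) :
    ∫ x, fderiv ℝ f x v ∂(stdGaussian E) = ∫ x, f x * inner ℝ x v ∂(stdGaussian E) := by
  have hρ : ∀ x : E, fderiv ℝ (stdGaussianDensity : E → ℝ) x v =
      -(stdGaussianDensity x * inner ℝ x v) := by
    intro x; rw [(hasFDerivAt_stdGaussianDensity x).fderiv]; simp
  have h := integral_mul_fderiv_eq_neg_fderiv_mul_of_integrable (μ := (volume : Measure E))
    (f := f) (g := stdGaussianDensity) (v := v)
    ((integrable_stdGaussian_iff.1 h2).congr (.of_forall fun x => by ring))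
    ((integrable_stdGaussian_iff.1 h3).neg.congr (.of_forall fun x => by
      simp only [hρ, Pi.neg_apply]; ring))
    ((integrable_stdGaussian_iff.1 h1).congr (.of_forall fun x => by ring))
    (fun x _ => hf x) (fun x _ => (hasFDerivAt_stdGaussianDensity x).differentiableAt)
  rw [integral_stdGaussian, integral_stdGaussian]
  simp_rw [hρ] at h
  simp only [smul_eq_mul]
  simp_rw [mul_comm (stdGaussianDensity _) (fderiv ℝ f _ v)]
  rw [← neg_eq_iff_eq_neg.2 h, ← integral_neg]
  congr 1; ext x; ring

/-- By Fernique some exp(C‖x‖²) is integrable; completing the square shows that it dominates the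
linear exponent up to a constant. This provides the domination needed once the Cameron–Martin weight
is present. -/
lemma integrable_exp_mul_norm_stdGaussian (c : ℝ) :
    Integrable (fun x => Real.exp (c * ‖x‖)) (stdGaussian E) := by
  obtain ⟨C, hC, h⟩ := IsGaussian.exists_integrable_exp_sq (stdGaussian E)
  refine (h.const_mul (Real.exp (c ^ 2 / (4 * C)))).mono' (by fun_prop) (.of_forall fun x => ?_)
  rw [Real.norm_of_nonneg (Real.exp_pos _).le, ← Real.exp_add, Real.exp_le_exp]
  have : c ^ 2 / (4 * C) + C * ‖x‖ ^ 2 - c * ‖x‖ = C * (‖x‖ - c / (2 * C)) ^ 2 := by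
    field_simp; ring
  nlinarith [mul_nonneg hC.le (sq_nonneg (‖x‖ - c / (2 * C)))]

lemma integrable_norm_stdGaussian : Integrable (fun x : E => ‖x‖) (stdGaussian E) :=
  (IsGaussian.integrable_id (μ := stdGaussian E)).norm

lemma integrable_inner_stdGaussian (v : E) :
    Integrable (fun x : E => inner ℝ x v) (stdGaussian E) :=
  (integrable_norm_stdGaussian.mul_const ‖v‖).mono' (by fun_prop)
    (.of_forall fun x => norm_inner_le_norm x v)

lemma integral_inner_stdGaussian (v : E) : ∫ x, inner ℝ x v ∂(stdGaussian E) = 0 := by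
  have := integral_strongDual_stdGaussian (innerSL ℝ v)
  simpa [real_inner_comm] using this

lemma Continuous.integrable_stdGaussian {F : Type*} [NormedAddCommGroup F]
    [SecondCountableTopologyEither E F] {f : E → F} (hf : Continuous f) {a b : ℝ}
    (h : ∀ x, ‖f x‖ ≤ a + b * ‖x‖) : Integrable f (stdGaussian E) :=
  ((integrable_const a).add (integrable_norm_stdGaussian.const_mul b)).mono'
    hf.aestronglyMeasurable (.of_forall h)

/-- The image of a standard Gaussian measure under a co-isometry is standard Gaussian. -/
lemma stdGaussian_map_of_norm_adjoint {F : Type*} [NormedAddCommGroup F] [InnerProductSpace ℝ F]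
    [FiniteDimensional ℝ F] [MeasurableSpace F] [BorelSpace F] (L : E →L[ℝ] F)
    (hL : ∀ y, ‖ContinuousLinearMap.adjoint L y‖ = ‖y‖) :
    (stdGaussian E).map L = stdGaussian F := by
  have : IsProbabilityMeasure ((stdGaussian E).map L) :=
    Measure.isProbabilityMeasure_map (by fun_prop)
  refine Measure.ext_of_charFun ?_
  ext t
  rw [charFun_apply, integral_map (by fun_prop) (by fun_prop)]
  simp_rw [← ContinuousLinearMap.adjoint_inner_right]
  rw [← charFun_apply, charFun_stdGaussian, charFun_stdGaussian, hL]

end StdGaussian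

/-! ### Smooth min-max functionals and their Gibbs weights. -/

section NestedLogSumExp

variable {V U : Type*} [Fintype V] [Fintype U]

/-- The soft maximum over the second index, scaled by `N`. -/
noncomputable def innerLogSumExp (N : ℝ) (v : V) (s : V → U → ℝ) : ℝ :=
  Real.log (∑ u, Real.exp (N * s v u))

/-- A nested soft extremum: for `θ = 1` a soft maximum over both indices, for `θ = -1` minus a soft
minimum over the first index of the soft maximum over the second one. -/
noncomputable def nestedLogSumExp (N θ : ℝ) (s : V → U → ℝ) : ℝ :=
  Real.log (∑ v, Real.exp (θ * innerLogSumExp N v s))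

/-- The Gibbs weights of `nestedLogSumExp`. -/
noncomputable def gibbsWeight (N θ : ℝ) (v : V) (u : U) (s : V → U → ℝ) : ℝ :=
  Real.exp (N * s v u + (θ - 1) * innerLogSumExp N v s - nestedLogSumExp N θ s)

lemma gibbsWeight_pos (N θ : ℝ) (v : V) (u : U) (s : V → U → ℝ) : 0 < gibbsWeight N θ v u s :=
  Real.exp_pos _

/-- Evaluation at a pair of indices. -/
noncomputable def evalPair (v : V) (u : U) : (V → U → ℝ) →L[ℝ] ℝ :=
  (ContinuousLinearMap.proj (R := ℝ) (φ := fun _ : U => ℝ) u).comp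
    (ContinuousLinearMap.proj (R := ℝ) (φ := fun _ : V => U → ℝ) v)

omit [Fintype V] [Fintype U] in
@[simp] lemma evalPair_apply (v : V) (u : U) (s : V → U → ℝ) : evalPair v u s = s v u := rfl

variable [Nonempty U]

omit [Fintype V] in
lemma exp_innerLogSumExp (N : ℝ) (v : V) (s : V → U → ℝ) :
    Real.exp (innerLogSumExp N v s) = ∑ u, Real.exp (N * s v u) :=
  Real.exp_log (Finset.sum_pos (fun _ _ => Real.exp_pos _) Finset.univ_nonempty)

lemma hasFDerivAt_innerLogSumExp (N : ℝ) (v : V) (s : V → U → ℝ) :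
    HasFDerivAt (innerLogSumExp N v)
      (∑ u, (N * Real.exp (N * s v u - innerLogSumExp N v s)) • evalPair v u) s := by
  have hpos : 0 < ∑ u, Real.exp (N * s v u) :=
    Finset.sum_pos (fun _ _ => Real.exp_pos _) Finset.univ_nonempty
  have h := (HasFDerivAt.fun_sum (u := Finset.univ) fun u _ =>
    (((evalPair v u).hasFDerivAt (x := s)).const_mul N).exp).log hpos.ne'
  refine h.congr_fderiv ?_
  rw [Finset.smul_sum]
  refine Finset.sum_congr rfl fun u _ => ?_
  rw [Real.exp_sub, exp_innerLogSumExp, smul_smul, smul_smul]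
  congr 1
  simp only [evalPair_apply]
  field_simp

variable [Nonempty V]

omit [Nonempty U] in
lemma exp_nestedLogSumExp (N θ : ℝ) (s : V → U → ℝ) :
    Real.exp (nestedLogSumExp N θ s) = ∑ v, Real.exp (θ * innerLogSumExp N v s) :=
  Real.exp_log (Finset.sum_pos (fun _ _ => Real.exp_pos _) Finset.univ_nonempty)

lemma hasFDerivAt_nestedLogSumExp (N θ : ℝ) (s : V → U → ℝ) :
    HasFDerivAt (nestedLogSumExp N θ)
      (∑ v, ∑ u, (θ * N * gibbsWeight N θ v u s) • evalPair v u) s := by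
  have hpos : 0 < ∑ v, Real.exp (θ * innerLogSumExp N v s) :=
    Finset.sum_pos (fun _ _ => Real.exp_pos _) Finset.univ_nonempty
  have h := (HasFDerivAt.fun_sum (u := Finset.univ) fun v _ =>
    ((hasFDerivAt_innerLogSumExp N v s).const_mul θ).exp).log hpos.ne'
  refine h.congr_fderiv ?_
  rw [Finset.smul_sum]
  refine Finset.sum_congr rfl fun v _ => ?_
  rw [Finset.smul_sum, Finset.smul_sum, Finset.smul_sum]
  refine Finset.sum_congr rfl fun u _ => ?_
  rw [smul_smul, smul_smul, smul_smul, ← exp_nestedLogSumExp, ← Real.exp_neg, gibbsWeight]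
  congr 1
  -- The weight factors as the Gibbs weight of v times the conditional weight of u given v.
  rw [show N * s v u + (θ - 1) * innerLogSumExp N v s - nestedLogSumExp N θ s =
    -nestedLogSumExp N θ s + θ * innerLogSumExp N v s + (N * s v u - innerLogSumExp N v s) by ring,
    Real.exp_add, Real.exp_add]
  ring

/-- The logarithmic derivative has three terms. The first two only see row v, so they vanish in a
direction that is zero on that row. The third carries the factor θ * N, which will meet a second
such factor and produce a square, so that the sign of θ plays no role. -/
lemma hasFDerivAt_gibbsWeight (N θ : ℝ) (v : V) (u : U) (s : V → U → ℝ) :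
    HasFDerivAt (gibbsWeight N θ v u)
      (gibbsWeight N θ v u s • (N • evalPair v u +
        (θ - 1) • (∑ u', (N * Real.exp (N * s v u' - innerLogSumExp N v s)) • evalPair v u') -
        ∑ v', ∑ u', (θ * N * gibbsWeight N θ v' u' s) • evalPair v' u')) s :=
  (((((evalPair v u).hasFDerivAt (x := s)).const_mul N).add
    ((hasFDerivAt_innerLogSumExp N v s).const_mul (θ - 1))).sub
    (hasFDerivAt_nestedLogSumExp N θ s)).exp

lemma gibbsWeight_le_one (N θ : ℝ) (v : V) (u : U) (s : V → U → ℝ) :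
    gibbsWeight N θ v u s ≤ 1 := by
  rw [gibbsWeight, Real.exp_le_one_iff]
  have h1 : N * s v u ≤ innerLogSumExp N v s := by
    rw [← Real.exp_le_exp, exp_innerLogSumExp]
    exact Finset.single_le_sum (f := fun u => Real.exp (N * s v u))
      (fun _ _ => (Real.exp_pos _).le) (Finset.mem_univ u)
  have h2 : θ * innerLogSumExp N v s ≤ nestedLogSumExp N θ s := by
    rw [← Real.exp_le_exp, exp_nestedLogSumExp]
    exact Finset.single_le_sum (f := fun v => Real.exp (θ * innerLogSumExp N v s))
      (fun _ _ => (Real.exp_pos _).le) (Finset.mem_univ v)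
  linarith

lemma continuous_gibbsWeight (N θ : ℝ) (v : V) (u : U) :
    Continuous (gibbsWeight N θ v u : (V → U → ℝ) → ℝ) :=
  continuous_iff_continuousAt.2 fun s => (hasFDerivAt_gibbsWeight N θ v u s).continuousAt

lemma continuous_nestedLogSumExp (N θ : ℝ) :
    Continuous (nestedLogSumExp N θ : (V → U → ℝ) → ℝ) :=
  continuous_iff_continuousAt.2 fun s => (hasFDerivAt_nestedLogSumExp N θ s).continuousAt

/-- Only the finiteness of the Lipschitz constant matters: it gives linear growth, hence Gaussian
integrability. The cardinalities come from bounding each Gibbs weight by 1. -/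
lemma abs_nestedLogSumExp_sub_le (N θ : ℝ) (s t : V → U → ℝ) :
    |nestedLogSumExp N θ s - nestedLogSumExp N θ t| ≤
      (Fintype.card V * Fintype.card U * |θ * N|) * ‖s - t‖ := by
  refine Convex.norm_image_sub_le_of_norm_hasFDerivWithin_le (s := Set.univ)
    (fun x _ => (hasFDerivAt_nestedLogSumExp N θ x).hasFDerivWithinAt) (fun x _ => ?_)
    convex_univ (Set.mem_univ t) (Set.mem_univ s)
  refine ContinuousLinearMap.opNorm_le_bound _ (by positivity) fun h => ?_
  rw [_root_.sum_apply]
  simp_rw [_root_.sum_apply]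
  refine (norm_sum_le _ _).trans ?_
  have key : ∀ v u, ‖(((θ * N * gibbsWeight N θ v u x) • evalPair v u :
      (V → U → ℝ) →L[ℝ] ℝ)) h‖ ≤ |θ * N| * ‖h‖ := by
    intro v u
    rw [_root_.smul_apply, evalPair_apply, smul_eq_mul, norm_mul, norm_mul,
      Real.norm_eq_abs, Real.norm_of_nonneg (gibbsWeight_pos N θ v u x).le]
    have h1 : ‖h v u‖ ≤ ‖h‖ := (norm_le_pi_norm (h v) u).trans (norm_le_pi_norm h v)
    have h2 := gibbsWeight_le_one N θ v u x
    calc |θ * N| * gibbsWeight N θ v u x * ‖h v u‖ ≤ |θ * N| * 1 * ‖h‖ := by gcongr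
      _ = _ := by ring
  calc ∑ v, ‖∑ u, (((θ * N * gibbsWeight N θ v u x) • evalPair v u :
      (V → U → ℝ) →L[ℝ] ℝ)) h‖ ≤ ∑ v : V, ∑ u : U, |θ * N| * ‖h‖ :=
        Finset.sum_le_sum fun v _ => (norm_sum_le _ _).trans (Finset.sum_le_sum fun u _ => key v u)
    _ = _ := by simp; ring

end NestedLogSumExp

/-! ### Gordon's comparison by Gaussian interpolation. -/

section GaussianComparison

variable {E : Type*} [NormedAddCommGroup E] [InnerProductSpace ℝ E] [FiniteDimensional ℝ E]
  [MeasurableSpace E] [BorelSpace E] {V U : Type*} [Fintype V] [Fintype U] [Nonempty V] [Nonempty U]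

/-- The Gaussian process indexed by a family of vectors. -/
noncomputable def innerFamily (z : V → U → E) : E →L[ℝ] (V → U → ℝ) :=
  ContinuousLinearMap.pi fun v => ContinuousLinearMap.pi fun u => innerSL ℝ (z v u)

omit [FiniteDimensional ℝ E] [MeasurableSpace E] [BorelSpace E] [Fintype V] [Fintype U]
  [Nonempty V] [Nonempty U] in
@[simp] lemma innerFamily_apply (z : V → U → E) (w : E) (v : V) (u : U) :
    innerFamily z w v u = inner ℝ (z v u) w := rfl

lemma integrable_nestedLogSumExp (N θ : ℝ) (z : V → U → E) :
    Integrable (fun w => nestedLogSumExp N θ (innerFamily z w)) (stdGaussian E) := by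
  refine Continuous.integrable_stdGaussian
    ((continuous_nestedLogSumExp N θ).comp (innerFamily z).continuous)
    (a := |nestedLogSumExp N θ (0 : V → U → ℝ)|)
    (b := (Fintype.card V * Fintype.card U * |θ * N|) * ‖innerFamily z‖) fun w => ?_
  have h := abs_nestedLogSumExp_sub_le N θ (innerFamily z w) 0
  rw [sub_zero] at h
  have h2 : (Fintype.card V * Fintype.card U * |θ * N|) * ‖innerFamily z w‖ ≤
      (Fintype.card V * Fintype.card U * |θ * N|) * (‖innerFamily z‖ * ‖w‖) := by
    gcongr
    exact (innerFamily z).le_opNorm w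
  have h3 := abs_sub_abs_le_abs_sub (nestedLogSumExp N θ (innerFamily z w))
    (nestedLogSumExp N θ (0 : V → U → ℝ))
  rw [Real.norm_eq_abs, mul_assoc _ ‖innerFamily z‖]
  linarith

/-- Integration by parts for the Gibbs weights, in a direction uncorrelated with the row of the
weight. -/
lemma integral_gibbsWeight_mul_inner (N θ : ℝ) (z : V → U → E) (v : V) (u : U) (e : E)
    (he : ∀ u', inner ℝ (z v u') e = 0) :
    ∫ w, gibbsWeight N θ v u (innerFamily z w) * inner ℝ w e ∂(stdGaussian E) =
      ∫ w, -(θ * N) * ∑ v', ∑ u', inner ℝ (z v' u') e *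
        (gibbsWeight N θ v u (innerFamily z w) * gibbsWeight N θ v' u' (innerFamily z w))
        ∂(stdGaussian E) := by
  have hd : ∀ w, HasFDerivAt (fun w => gibbsWeight N θ v u (innerFamily z w)) _ w := fun w =>
    (hasFDerivAt_gibbsWeight N θ v u (innerFamily z w)).comp w (innerFamily z).hasFDerivAt
  have hc : ∀ v u, Continuous fun w => gibbsWeight N θ v u (innerFamily z w) := fun v u =>
    (continuous_gibbsWeight N θ v u).comp (innerFamily z).continuous
  have hb : ∀ v u w, ‖gibbsWeight N θ v u (innerFamily z w)‖ ≤ 1 := fun v u w => by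
    rw [Real.norm_of_nonneg (gibbsWeight_pos _ _ _ _ _).le]; exact gibbsWeight_le_one _ _ _ _ _
  have hfd : ∀ w, fderiv ℝ (fun w => gibbsWeight N θ v u (innerFamily z w)) w e =
      -(θ * N) * ∑ v', ∑ u', inner ℝ (z v' u') e *
        (gibbsWeight N θ v u (innerFamily z w) * gibbsWeight N θ v' u' (innerFamily z w)) := by
    intro w
    rw [(hd w).fderiv]
    simp only [ContinuousLinearMap.comp_apply, _root_.smul_apply,
      _root_.sub_apply, _root_.add_apply, _root_.sum_apply,
      evalPair_apply, innerFamily_apply, he, smul_eq_mul, mul_zero, Finset.sum_const_zero,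
      add_zero, zero_sub, Finset.mul_sum, mul_neg, neg_mul]
    rw [← Finset.sum_neg_distrib]
    refine Finset.sum_congr rfl fun v' _ => ?_
    rw [← Finset.sum_neg_distrib]
    exact Finset.sum_congr rfl fun u' _ => by ring
  rw [← integral_fderiv_stdGaussian (f := fun w => gibbsWeight N θ v u (innerFamily z w))
    (fun w => (hd w).differentiableAt) e]
  · simp_rw [hfd]
  · exact (hc v u).integrable_stdGaussian (a := 1) (b := 0) fun w => by simpa using hb v u w
  · simp_rw [hfd]
    refine Integrable.const_mul (integrable_finsetSum _ fun v' _ => integrable_finsetSum _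
      fun u' _ => Integrable.const_mul ?_ _) _
    refine ((hc v u).mul (hc v' u')).integrable_stdGaussian (a := 1) (b := 0) fun w => ?_
    rw [Pi.mul_apply, norm_mul]
    simpa using mul_le_one₀ (hb v u w) (norm_nonneg _) (hb v' u' w)
  · exact (integrable_inner_stdGaussian e).bdd_mul (hc v u).aestronglyMeasurable
      (.of_forall fun w => hb v u w)

/-- Gordon's comparison inequality, in soft form. -/
theorem integral_nestedLogSumExp_le (N θ : ℝ) (x y : V → U → E)
    (hxy : ∀ v u v' u', inner ℝ (x v u) (y v' u') = 0)
    (hdiag : ∀ v u u', inner ℝ (x v u) (x v u') = inner ℝ (y v u) (y v u'))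
    (hoff : ∀ v u v' u', inner ℝ (y v u) (y v' u') ≤ inner ℝ (x v u) (x v' u')) :
    ∫ w, nestedLogSumExp N θ (innerFamily x w) ∂(stdGaussian E) ≤
      ∫ w, nestedLogSumExp N θ (innerFamily y w) ∂(stdGaussian E) := by
  -- Rotation from `y` at angle 0 to `x` at angle π/2, with derivative `z'`. Since the two families
  -- are orthogonal, the inner products of `z` with `z'` are sin φ cos φ times the difference of the
  -- two covariances, which is nonnegative, and zero within a row.
  let z : ℝ → V → U → E := fun φ v u => Real.cos φ • y v u + Real.sin φ • x v u
  let z' : ℝ → V → U → E := fun φ v u => -Real.sin φ • y v u + Real.cos φ • x v u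
  let H : ℝ → ℝ := fun φ => ∫ w, nestedLogSumExp N θ (innerFamily (z φ) w) ∂(stdGaussian E)
  let D : ℝ → E → ℝ := fun φ w =>
    ∑ v, ∑ u, (θ * N * gibbsWeight N θ v u (innerFamily (z φ) w)) * inner ℝ w (z' φ v u)
  have hz' : ∀ φ v u w, HasDerivAt (fun φ => inner ℝ (z φ v u) w) (inner ℝ w (z' φ v u)) φ := by
    intro φ v u w
    have h := (((Real.hasDerivAt_cos φ).smul_const (y v u)).add
      ((Real.hasDerivAt_sin φ).smul_const (x v u))).inner ℝ (hasDerivAt_const φ w)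
    simpa [z, z', real_inner_comm] using h
  have hpt : ∀ φ w, HasDerivAt (fun φ => nestedLogSumExp N θ (innerFamily (z φ) w)) (D φ w) φ := by
    intro φ w
    have h1 : HasDerivAt (fun φ => innerFamily (z φ) w)
        (fun v u => inner ℝ w (z' φ v u)) φ :=
      hasDerivAt_pi.2 fun v => hasDerivAt_pi.2 fun u => hz' φ v u w
    have h2 := (hasFDerivAt_nestedLogSumExp N θ (innerFamily (z φ) w)).comp_hasDerivAt φ h1
    refine h2.congr_deriv ?_
    simp [D]
  have hDb : ∀ φ w, ‖D φ w‖ ≤ (∑ v, ∑ u, |θ * N| * (‖y v u‖ + ‖x v u‖)) * ‖w‖ := by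
    intro φ w
    rw [Finset.sum_mul]
    refine (norm_sum_le _ _).trans (Finset.sum_le_sum fun v _ => ?_)
    rw [Finset.sum_mul]
    refine (norm_sum_le _ _).trans (Finset.sum_le_sum fun u _ => ?_)
    rw [norm_mul, norm_mul, Real.norm_eq_abs, Real.norm_of_nonneg (gibbsWeight_pos _ _ _ _ _).le]
    have h1 := gibbsWeight_le_one N θ v u (innerFamily (z φ) w)
    have h0 := (gibbsWeight_pos N θ v u (innerFamily (z φ) w)).le
    have h2 : ‖inner ℝ w (z' φ v u)‖ ≤ ‖w‖ * (‖y v u‖ + ‖x v u‖) := by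
      refine (norm_inner_le_norm _ _).trans ?_
      gcongr
      refine (norm_add_le _ _).trans ?_
      rw [norm_smul, norm_smul, norm_neg, Real.norm_eq_abs, Real.norm_eq_abs]
      have := Real.abs_sin_le_one φ
      have := Real.abs_cos_le_one φ
      have := norm_nonneg (y v u)
      have := norm_nonneg (x v u)
      nlinarith
    calc |θ * N| * gibbsWeight N θ v u (innerFamily (z φ) w) * ‖inner ℝ w (z' φ v u)‖
        ≤ |θ * N| * 1 * (‖w‖ * (‖y v u‖ + ‖x v u‖)) := by gcongr
      _ = _ := by ring
  have hcont : ∀ φ v u, Continuous fun w => gibbsWeight N θ v u (innerFamily (z φ) w) :=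
    fun φ v u => (continuous_gibbsWeight N θ v u).comp (innerFamily (z φ)).continuous
  have hDc : ∀ φ, Continuous (D φ) := fun φ => by
    refine continuous_finsetSum _ fun v _ => continuous_finsetSum _ fun u _ => ?_
    exact (continuous_const.mul (hcont φ v u)).mul (by fun_prop)
  have hH : ∀ φ, HasDerivAt H (∫ w, D φ w ∂(stdGaussian E)) φ := by
    intro φ
    refine (hasDerivAt_integral_of_dominated_loc_of_deriv_le (s := Set.univ) (F := fun φ w =>
      nestedLogSumExp N θ (innerFamily (z φ) w)) (F' := D)
      (bound := fun w => (∑ v, ∑ u, |θ * N| * (‖y v u‖ + ‖x v u‖)) * ‖w‖) Filter.univ_mem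
      (.of_forall fun φ => (integrable_nestedLogSumExp N θ (z φ)).aestronglyMeasurable)
      (integrable_nestedLogSumExp N θ (z φ)) (hDc φ).aestronglyMeasurable
      (.of_forall fun w φ _ => hDb φ w) (integrable_norm_stdGaussian.const_mul _)
      (.of_forall fun w φ _ => hpt φ w)).2
  have hzz' : ∀ φ v u v' u', inner ℝ (z φ v' u') (z' φ v u) = Real.sin φ * Real.cos φ *
      (inner ℝ (x v' u') (x v u) - inner ℝ (y v' u') (y v u)) := by
    intro φ v u v' u'
    simp only [z, z', inner_add_left, inner_add_right, real_inner_smul_left, real_inner_smul_right,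
      hxy, real_inner_comm (x v u) (y v' u')]
    ring
  have hD : ∀ φ ∈ Set.Icc 0 (Real.pi / 2), ∫ w, D φ w ∂(stdGaussian E) ≤ 0 := by
    intro φ hφ
    have hs : 0 ≤ Real.sin φ * Real.cos φ :=
      mul_nonneg (Real.sin_nonneg_of_nonneg_of_le_pi hφ.1 (by linarith [hφ.2, Real.pi_pos]))
        (Real.cos_nonneg_of_neg_pi_div_two_le_of_le (by linarith [hφ.1, Real.pi_pos]) hφ.2)
    have hint : ∀ v u, Integrable (fun w => θ * N * gibbsWeight N θ v u (innerFamily (z φ) w) *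
        inner ℝ w (z' φ v u)) (stdGaussian E) := by
      intro v u
      simp_rw [mul_assoc (θ * N)]
      refine Integrable.const_mul ?_ _
      refine (integrable_inner_stdGaussian _).bdd_mul (c := 1) (hcont φ v u).aestronglyMeasurable
        (.of_forall fun w => ?_)
      rw [Real.norm_of_nonneg (gibbsWeight_pos _ _ _ _ _).le]
      exact gibbsWeight_le_one _ _ _ _ _
    rw [integral_finsetSum _ fun v _ => integrable_finsetSum _ fun u _ => hint v u]
    refine Finset.sum_nonpos fun v _ => ?_
    rw [integral_finsetSum _ fun u _ => hint v u]
    refine Finset.sum_nonpos fun u _ => ?_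
    simp_rw [mul_assoc (θ * N)]
    -- Equality of the covariances within a row makes the integration by parts applicable. The
    -- factor θ * N of the gradient meets the factor -(θ * N) of the differentiated weight, so the
    -- sign is the same for a soft maximum and for a soft min-max.
    rw [integral_const_mul, integral_gibbsWeight_mul_inner N θ (z φ) v u (z' φ v u)
      (fun u' => by rw [hzz', hdiag, sub_self, mul_zero]), integral_const_mul, ← mul_assoc,
      show θ * N * -(θ * N) = -(θ * N) ^ 2 by ring, neg_mul, neg_nonpos]
    refine mul_nonneg (sq_nonneg _) (integral_nonneg fun w => ?_)
    refine Finset.sum_nonneg fun v' _ => Finset.sum_nonneg fun u' _ => ?_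
    rw [hzz']
    exact mul_nonneg (mul_nonneg hs (sub_nonneg.2 (hoff _ _ _ _)))
      (mul_nonneg (gibbsWeight_pos _ _ _ _ _).le (gibbsWeight_pos _ _ _ _ _).le)
  have hanti : AntitoneOn H (Set.Icc 0 (Real.pi / 2)) := by
    refine antitoneOn_of_hasDerivWithinAt_nonpos (convex_Icc _ _)
      (fun φ _ => (hH φ).continuousAt.continuousWithinAt)
      (fun φ _ => (hH φ).hasDerivWithinAt) fun φ hφ => hD φ (interior_subset hφ)
  have hle := hanti (Set.left_mem_Icc.2 (by positivity)) (Set.right_mem_Icc.2 (by positivity))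
    (by positivity)
  simpa [H, z] using hle

end GaussianComparison

/-! ### Matrices as vectors with the Frobenius norm; the operator norm. -/

section VecMatrix

variable {ι τ : Type*} [Fintype ι] [Fintype τ] [DecidableEq τ]

/-- The matrix with the given entries. -/
def matOfVec (w : EuclideanSpace ℝ (ι × τ)) : Matrix ι τ ℝ := Matrix.of fun i j => w (i, j)

omit [Fintype ι] [Fintype τ] [DecidableEq τ] in
lemma matOfVec_sub (w w' : EuclideanSpace ℝ (ι × τ)) :
    matOfVec (w - w') = matOfVec w - matOfVec w' := rfl

omit [Fintype ι] [Fintype τ] [DecidableEq τ] in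
lemma matOfVec_add (w w' : EuclideanSpace ℝ (ι × τ)) :
    matOfVec (w + w') = matOfVec w + matOfVec w' := rfl

omit [Fintype ι] [Fintype τ] [DecidableEq τ] in
lemma matOfVec_smul (c : ℝ) (w : EuclideanSpace ℝ (ι × τ)) :
    matOfVec (c • w) = c • matOfVec w := rfl

omit [Fintype ι] in
lemma toEuclideanLin_matOfVec_apply (w : EuclideanSpace ℝ (ι × τ)) (v : EuclideanSpace ℝ τ)
    (i : ι) : Matrix.toEuclideanLin (matOfVec w) v i = ∑ j, w (i, j) * v j := by
  simp [matOfVec, Matrix.mulVec, dotProduct]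

/-- Cauchy–Schwarz in each row. The norm of the vector of entries is the Frobenius norm, which makes
gains and singular values 1-Lipschitz in the Gaussian vector. -/
lemma norm_toEuclideanLin_matOfVec_le (w : EuclideanSpace ℝ (ι × τ)) (v : EuclideanSpace ℝ τ) :
    ‖Matrix.toEuclideanLin (matOfVec w) v‖ ≤ ‖w‖ * ‖v‖ := by
  rw [← pow_le_pow_iff_left₀ (norm_nonneg _) (by positivity) two_ne_zero, mul_pow,
    EuclideanSpace.real_norm_sq_eq, EuclideanSpace.real_norm_sq_eq, EuclideanSpace.real_norm_sq_eq,
    Fintype.sum_prod_type, Finset.sum_mul]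
  refine Finset.sum_le_sum fun i _ => ?_
  rw [toEuclideanLin_matOfVec_apply]
  exact Finset.sum_mul_sq_le_sq_mul_sq _ _ _

lemma continuous_minGain_matOfVec [Nonempty τ] :
    Continuous fun w : EuclideanSpace ℝ (ι × τ) => minGain (matOfVec w) := by
  refine (LipschitzWith.of_le_add_mul 1 fun w w' => ?_).continuous
  refine minGain_le_add _ _ fun v => ?_
  rw [← matOfVec_sub, NNReal.coe_one, one_mul, dist_eq_norm]
  exact norm_toEuclideanLin_matOfVec_le _ _

/-- The operator norm of a matrix between Euclidean spaces. -/
noncomputable def maxGain (B : Matrix ι τ ℝ) : ℝ :=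
  ‖LinearMap.toContinuousLinearMap (Matrix.toEuclideanLin B)‖

lemma norm_toEuclideanLin_le_maxGain (B : Matrix ι τ ℝ) (v : EuclideanSpace ℝ τ) :
    ‖Matrix.toEuclideanLin B v‖ ≤ maxGain B * ‖v‖ :=
  (LinearMap.toContinuousLinearMap (Matrix.toEuclideanLin B)).le_opNorm v

lemma maxGain_nonneg (B : Matrix ι τ ℝ) : 0 ≤ maxGain B := norm_nonneg _

lemma maxGain_le (B : Matrix ι τ ℝ) {c : ℝ} (hc : 0 ≤ c)
    (h : ∀ v : EuclideanSpace ℝ τ, ‖v‖ = 1 → ‖Matrix.toEuclideanLin B v‖ ≤ c) : maxGain B ≤ c :=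
  ContinuousLinearMap.opNorm_le_of_unit_norm hc fun v hv => h v hv

lemma maxGain_matOfVec_le (w : EuclideanSpace ℝ (ι × τ)) : maxGain (matOfVec w) ≤ ‖w‖ :=
  maxGain_le _ (norm_nonneg w) fun v hv => by
    simpa [hv] using norm_toEuclideanLin_matOfVec_le w v

lemma continuous_maxGain_matOfVec :
    Continuous fun w : EuclideanSpace ℝ (ι × τ) => maxGain (matOfVec w) := by
  let L : EuclideanSpace ℝ (ι × τ) →ₗ[ℝ] (EuclideanSpace ℝ τ →L[ℝ] EuclideanSpace ℝ ι) :=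
    { toFun := fun w => LinearMap.toContinuousLinearMap (Matrix.toEuclideanLin (matOfVec w))
      map_add' := fun w w' => by rw [matOfVec_add, map_add, map_add]
      map_smul' := fun c w => by rw [matOfVec_smul, map_smul, map_smul]; rfl }
  exact L.continuous_of_finiteDimensional.norm

end VecMatrix

/-! ### Coordinate marginals of a standard Gaussian vector. -/

section Restriction

variable {α β : Type*} [Fintype α] [Fintype β]

/-- Restriction of a vector to the coordinates in the range of a map. -/
noncomputable def restrictCoord (f : α → β) : EuclideanSpace ℝ β →L[ℝ] EuclideanSpace ℝ α :=
  LinearMap.toContinuousLinearMap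
    { toFun := fun w => WithLp.toLp 2 fun a => w (f a)
      map_add' := fun _ _ => rfl
      map_smul' := fun _ _ => rfl }

@[simp] lemma restrictCoord_apply (f : α → β) (w : EuclideanSpace ℝ β) (a : α) :
    restrictCoord f w a = w (f a) := rfl

/-- The adjoint of a restriction is extension by zero, which preserves norms. -/
lemma stdGaussian_map_restrictCoord {f : α → β} (hf : Function.Injective f) :
    (stdGaussian (EuclideanSpace ℝ β)).map (restrictCoord f) =
      stdGaussian (EuclideanSpace ℝ α) := by
  classical
  refine stdGaussian_map_of_norm_adjoint _ fun y => ?_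
  have h : ContinuousLinearMap.adjoint (restrictCoord f) y =
      WithLp.toLp 2 (Function.extend f y.ofLp 0) := by
    refine ext_inner_right ℝ fun w => ?_
    rw [ContinuousLinearMap.adjoint_inner_left]
    simp only [PiLp.inner_apply, restrictCoord_apply]
    rw [← Finset.sum_subset (Finset.subset_univ (Finset.univ.image f)),
      Finset.sum_image (fun a _ b _ h => hf h)]
    · simp [hf.extend_apply]
    · intro b _ hb
      rw [Function.extend_apply' _ _ _ (by simpa using hb)]
      simp
  rw [h, ← pow_left_inj₀ (norm_nonneg _) (norm_nonneg _) two_ne_zero,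
    EuclideanSpace.real_norm_sq_eq, EuclideanSpace.real_norm_sq_eq,
    ← Finset.sum_subset (Finset.subset_univ (Finset.univ.image f)),
      Finset.sum_image (fun a _ b _ h => hf h)]
  · simp [hf.extend_apply]
  · intro b _ hb
    change (Function.extend f y.ofLp 0 b) ^ 2 = 0
    rw [Function.extend_apply' _ _ _ (by simpa using hb)]
    simp

lemma integral_restrictCoord {f : α → β} (hf : Function.Injective f)
    {F : EuclideanSpace ℝ α → ℝ} (hF : Continuous F) :
    ∫ w, F (restrictCoord f w) ∂(stdGaussian (EuclideanSpace ℝ β)) =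
      ∫ w, F w ∂(stdGaussian (EuclideanSpace ℝ α)) := by
  rw [← stdGaussian_map_restrictCoord hf, integral_map (by fun_prop) hF.aestronglyMeasurable]

lemma norm_restrictCoord_le {f : α → β} (hf : Function.Injective f) (w : EuclideanSpace ℝ β) :
    ‖restrictCoord f w‖ ≤ ‖w‖ := by
  classical
  rw [← pow_le_pow_iff_left₀ (norm_nonneg _) (norm_nonneg _) two_ne_zero,
    EuclideanSpace.real_norm_sq_eq, EuclideanSpace.real_norm_sq_eq]
  simp only [restrictCoord_apply]
  rw [← Finset.sum_image (f := fun b => w b ^ 2) (fun a _ b _ h => hf h)]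
  exact Finset.sum_le_sum_of_subset_of_nonneg (Finset.subset_univ _) fun _ _ _ => sq_nonneg _

lemma integrable_norm_restrictCoord {f : α → β} (hf : Function.Injective f) :
    Integrable (fun w => ‖restrictCoord f w‖) (stdGaussian (EuclideanSpace ℝ β)) :=
  Continuous.integrable_stdGaussian (a := 0) (b := 1) (by fun_prop) fun w => by
    simpa using norm_restrictCoord_le hf w

end Restriction

/-! ### Soft extrema against true extrema, and nets of the sphere. -/

section SoftBounds

variable {V U : Type*} [Fintype V] [Fintype U] [Nonempty V] [Nonempty U] {N : ℝ} {s : V → U → ℝ}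
  {c : ℝ}

omit [Fintype V] [Nonempty V] in
lemma innerLogSumExp_le (hN : 0 ≤ N) {v : V} (h : ∀ u, s v u ≤ c) :
    innerLogSumExp N v s ≤ N * c + Real.log (Fintype.card U) := by
  rw [← Real.exp_le_exp, exp_innerLogSumExp, Real.exp_add, Real.exp_log (by positivity)]
  calc ∑ u, Real.exp (N * s v u) ≤ ∑ _u : U, Real.exp (N * c) :=
        Finset.sum_le_sum fun u _ => Real.exp_le_exp.2 (mul_le_mul_of_nonneg_left (h u) hN)
    _ = _ := by simp [mul_comm]

omit [Fintype V] [Nonempty V] in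
lemma le_innerLogSumExp (hN : 0 ≤ N) {v : V} {u : U} (h : c ≤ s v u) :
    N * c ≤ innerLogSumExp N v s := by
  rw [← Real.exp_le_exp, exp_innerLogSumExp]
  exact (Real.exp_le_exp.2 (mul_le_mul_of_nonneg_left h hN)).trans
    (Finset.single_le_sum (f := fun u => Real.exp (N * s v u))
      (fun _ _ => (Real.exp_pos _).le) (Finset.mem_univ u))

omit [Nonempty U] in
lemma nestedLogSumExp_le {θ : ℝ} (h : ∀ v, θ * innerLogSumExp N v s ≤ c) :
    nestedLogSumExp N θ s ≤ Real.log (Fintype.card V) + c := by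
  rw [← Real.exp_le_exp, exp_nestedLogSumExp, Real.exp_add, Real.exp_log (by positivity)]
  calc ∑ v, Real.exp (θ * innerLogSumExp N v s) ≤ ∑ _v : V, Real.exp c :=
        Finset.sum_le_sum fun v _ => Real.exp_le_exp.2 (h v)
    _ = _ := by simp

omit [Nonempty U] in
lemma le_nestedLogSumExp {θ : ℝ} (v : V) : θ * innerLogSumExp N v s ≤ nestedLogSumExp N θ s := by
  rw [← Real.exp_le_exp, exp_nestedLogSumExp]
  exact Finset.single_le_sum (f := fun v => Real.exp (θ * innerLogSumExp N v s))
      (fun _ _ => (Real.exp_pos _).le) (Finset.mem_univ v)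

end SoftBounds

lemma exists_sphere_net {E : Type*} [NormedAddCommGroup E] [NormedSpace ℝ E]
    [FiniteDimensional ℝ E] {δ : ℝ} (hδ : 0 < δ) :
    ∃ t : Finset E, (∀ x ∈ t, ‖x‖ = 1) ∧ ∀ x, ‖x‖ = 1 → ∃ y ∈ t, ‖x - y‖ ≤ δ := by
  have := FiniteDimensional.proper_real E
  obtain ⟨t, ht, hfin, hcov⟩ := (isCompact_sphere (0 : E) 1).finite_cover_balls hδ
  refine ⟨hfin.toFinset, fun x hx => by simpa using ht (hfin.mem_toFinset.1 hx), fun x hx => ?_⟩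
  obtain ⟨y, hy, hxy⟩ := Set.mem_iUnion₂.1 (hcov (show x ∈ Metric.sphere 0 1 by simpa using hx))
  exact ⟨y, hfin.mem_toFinset.2 hy, by rw [← dist_eq_norm]; exact (Metric.mem_ball.1 hxy).le⟩

/-- A net of the unit sphere almost attains the norm of every vector. -/
lemma exists_mem_net_inner_ge {E : Type*} [NormedAddCommGroup E] [InnerProductSpace ℝ E]
    [Nontrivial E] {δ : ℝ} {t : Finset E}
    (ht : ∀ x, ‖x‖ = 1 → ∃ y ∈ t, ‖x - y‖ ≤ δ) (g : E) :
    ∃ u ∈ t, ‖g‖ - δ * ‖g‖ ≤ inner ℝ u g := by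
  rcases eq_or_ne g 0 with rfl | hg
  · obtain ⟨x, hx⟩ := exists_norm_eq E zero_le_one
    obtain ⟨y, hy, -⟩ := ht x hx
    exact ⟨y, hy, by simp⟩
  · have hg' : ‖g‖ ≠ 0 := norm_ne_zero_iff.2 hg
    obtain ⟨y, hy, hxy⟩ := ht (‖g‖⁻¹ • g) (by rw [norm_smul, norm_inv, norm_norm,
      inv_mul_cancel₀ hg'])
    refine ⟨y, hy, ?_⟩
    have h1 : inner ℝ (‖g‖⁻¹ • g) g = ‖g‖ := by
      rw [real_inner_smul_left, real_inner_self_eq_norm_sq]; field_simp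
    have h2 := real_inner_le_norm (‖g‖⁻¹ • g - y) g
    rw [inner_sub_left, h1] at h2
    nlinarith [norm_nonneg g]

/-! ### Gordon's and Chevet's bounds for Gaussian matrices. -/

section MatrixComparison

variable {ι τ : Type*} [Fintype ι] [Fintype τ] [DecidableEq τ]

/-- The coordinates of a Gaussian matrix, an extra scalar and two vectors. -/
abbrev CoupledIndex (ι τ : Type*) := (ι × τ) ⊕ (Unit ⊕ (ι ⊕ τ))

/-- Covariance vector of the bilinear Gaussian process `⟪u, G v⟫ + z`. -/
noncomputable def bilinearVec (v : EuclideanSpace ℝ τ) (u : EuclideanSpace ℝ ι) :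
    EuclideanSpace ℝ (CoupledIndex ι τ) :=
  WithLp.toLp 2 (Sum.elim (fun p => u p.1 * v p.2) (Sum.elim (fun _ => 1) 0))

/-- Covariance vector of the decoupled Gaussian process `⟪u, g⟫ + ⟪v, h⟫`. -/
noncomputable def decoupledVec (v : EuclideanSpace ℝ τ) (u : EuclideanSpace ℝ ι) :
    EuclideanSpace ℝ (CoupledIndex ι τ) :=
  WithLp.toLp 2 (Sum.elim 0 (Sum.elim 0 (Sum.elim u v)))

/-- The matrix part. -/
noncomputable abbrev matPart : EuclideanSpace ℝ (CoupledIndex ι τ) →L[ℝ] EuclideanSpace ℝ (ι × τ) :=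
  restrictCoord Sum.inl

/-- The row vector part. -/
noncomputable abbrev leftPart : EuclideanSpace ℝ (CoupledIndex ι τ) →L[ℝ] EuclideanSpace ℝ ι :=
  restrictCoord fun i => Sum.inr (Sum.inr (Sum.inl i))

/-- The column vector part. -/
noncomputable abbrev rightPart : EuclideanSpace ℝ (CoupledIndex ι τ) →L[ℝ] EuclideanSpace ℝ τ :=
  restrictCoord fun j => Sum.inr (Sum.inr (Sum.inr j))

omit [Fintype ι] [Fintype τ] [DecidableEq τ] in
lemma leftPart_index_injective :
    Function.Injective fun i : ι => (Sum.inr (Sum.inr (Sum.inl i)) : CoupledIndex ι τ) :=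
  fun _ _ h => by simpa using h

omit [Fintype ι] [Fintype τ] [DecidableEq τ] in
lemma rightPart_index_injective :
    Function.Injective fun j : τ => (Sum.inr (Sum.inr (Sum.inr j)) : CoupledIndex ι τ) :=
  fun _ _ h => by simpa using h

lemma inner_bilinearVec (v : EuclideanSpace ℝ τ) (u : EuclideanSpace ℝ ι)
    (w : EuclideanSpace ℝ (CoupledIndex ι τ)) :
    inner ℝ (bilinearVec v u) w =
      inner ℝ u (Matrix.toEuclideanLin (matOfVec (matPart w)) v) + w (Sum.inr (Sum.inl ())) := by
  simp only [PiLp.inner_apply, bilinearVec, Fintype.sum_sum_type, Fintype.sum_prod_type,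
    toEuclideanLin_matOfVec_apply]
  simp only [Sum.elim_inl, Sum.elim_inr, restrictCoord_apply, RCLike.inner_apply, conj_trivial,
    Finset.sum_mul]
  simp only [Finset.univ_unique, Pi.zero_apply, mul_one, mul_zero, Finset.sum_const_zero,
    Finset.sum_singleton, add_zero]
  congr 1
  exact Finset.sum_congr rfl fun _ _ => Finset.sum_congr rfl fun _ _ => by ring

omit [DecidableEq τ] in
lemma inner_decoupledVec (v : EuclideanSpace ℝ τ) (u : EuclideanSpace ℝ ι)
    (w : EuclideanSpace ℝ (CoupledIndex ι τ)) :
    inner ℝ (decoupledVec v u) w = inner ℝ u (leftPart w) + inner ℝ v (rightPart w) := by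
  simp [PiLp.inner_apply, decoupledVec, Fintype.sum_sum_type]

omit [DecidableEq τ] in
lemma inner_bilinearVec_bilinearVec (v v' : EuclideanSpace ℝ τ) (u u' : EuclideanSpace ℝ ι) :
    inner ℝ (bilinearVec v u) (bilinearVec v' u') = inner ℝ u u' * inner ℝ v v' + 1 := by
  simp only [PiLp.inner_apply, bilinearVec, Fintype.sum_sum_type, Fintype.sum_prod_type,
    Finset.sum_mul_sum]
  simp [mul_mul_mul_comm]

omit [DecidableEq τ] in
lemma inner_decoupledVec_decoupledVec (v v' : EuclideanSpace ℝ τ) (u u' : EuclideanSpace ℝ ι) :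
    inner ℝ (decoupledVec v u) (decoupledVec v' u') = inner ℝ u u' + inner ℝ v v' := by
  simp [PiLp.inner_apply, decoupledVec, Fintype.sum_sum_type]

omit [DecidableEq τ] in
lemma inner_bilinearVec_decoupledVec (v v' : EuclideanSpace ℝ τ) (u u' : EuclideanSpace ℝ ι) :
    inner ℝ (bilinearVec v u) (decoupledVec v' u') = 0 := by
  simp [PiLp.inner_apply, bilinearVec, decoupledVec, Fintype.sum_sum_type]

omit [DecidableEq τ] in
-- The extra scalar coordinate makes the gap between the two covariances equal to (1 - ⟪u, u'⟫)(1 -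
-- ⟪v, v'⟫): nonnegative on unit vectors and zero when v = v', as the comparison demands.
lemma integral_nestedLogSumExp_bilinear_le (N θ : ℝ) (V : Finset (EuclideanSpace ℝ τ))
    (U : Finset (EuclideanSpace ℝ ι)) [Nonempty V] [Nonempty U] (hV : ∀ v ∈ V, ‖v‖ = 1)
    (hU : ∀ u ∈ U, ‖u‖ = 1) :
    ∫ w, nestedLogSumExp N θ (innerFamily (fun (v : V) (u : U) => bilinearVec v.1 u.1) w)
        ∂(stdGaussian (EuclideanSpace ℝ (CoupledIndex ι τ))) ≤
      ∫ w, nestedLogSumExp N θ (innerFamily (fun (v : V) (u : U) => decoupledVec v.1 u.1) w)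
        ∂(stdGaussian (EuclideanSpace ℝ (CoupledIndex ι τ))) := by
  refine integral_nestedLogSumExp_le N θ _ _ (fun _ _ _ _ => inner_bilinearVec_decoupledVec _ _ _ _)
    (fun v u u' => ?_) fun v u v' u' => ?_
  · rw [inner_bilinearVec_bilinearVec, inner_decoupledVec_decoupledVec, real_inner_self_eq_norm_sq,
      hV v v.2]
    ring
  · rw [inner_bilinearVec_bilinearVec, inner_decoupledVec_decoupledVec]
    have h1 := real_inner_le_norm u.1 u'.1
    have h2 := real_inner_le_norm v.1 v'.1
    rw [hU u u.2, hU u' u'.2, one_mul] at h1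
    rw [hV v v.2, hV v' v'.2, one_mul] at h2
    nlinarith [mul_nonneg (sub_nonneg.2 h1) (sub_nonneg.2 h2)]

omit [DecidableEq τ] in
lemma integral_coord_stdGaussian {β : Type*} [Fintype β] (b : β) :
    Integrable (fun w : EuclideanSpace ℝ β => w b) (stdGaussian (EuclideanSpace ℝ β)) ∧
      ∫ w, w b ∂(stdGaussian (EuclideanSpace ℝ β)) = 0 := by
  classical
  have h1 := integrable_inner_stdGaussian (EuclideanSpace.single b (1 : ℝ))
  have h2 := integral_inner_stdGaussian (EuclideanSpace.single b (1 : ℝ))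
  simp only [EuclideanSpace.inner_single_right, one_mul, conj_trivial] at h1 h2
  exact ⟨h1, h2⟩

variable [Nonempty ι] [Nonempty τ]

/-- Gordon's lower bound for the smallest singular value of a Gaussian matrix. -/
theorem integral_minGain_ge :
    ∫ g, ‖g‖ ∂(stdGaussian (EuclideanSpace ℝ ι)) - ∫ h, ‖h‖ ∂(stdGaussian (EuclideanSpace ℝ τ)) ≤
      ∫ w, minGain (matOfVec w) ∂(stdGaussian (EuclideanSpace ℝ (ι × τ))) := by
  set aι := ∫ g, ‖g‖ ∂(stdGaussian (EuclideanSpace ℝ ι)) with haι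
  set aτ := ∫ g, ‖g‖ ∂(stdGaussian (EuclideanSpace ℝ τ)) with haτ
  set aw := ∫ g, ‖g‖ ∂(stdGaussian (EuclideanSpace ℝ (ι × τ))) with haw
  have haι0 : 0 ≤ aι := integral_nonneg fun _ => norm_nonneg _
  have haw0 : 0 ≤ aw := integral_nonneg fun _ => norm_nonneg _
  -- The slack η absorbs every error: half of it pays for the mesh δ of the nets, the other half for
  -- the logarithms of their cardinalities after division by N.
  refine le_of_forall_pos_le_add fun η hη => ?_
  obtain ⟨δ, hδ, hδη⟩ : ∃ δ : ℝ, 0 < δ ∧ δ * (aι + aw + 1) ≤ η / 2 :=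
    ⟨η / 2 / (aι + aw + 1), by positivity, by rw [div_mul_cancel₀ _ (by positivity)]⟩
  obtain ⟨V, hV1, hV2⟩ := exists_sphere_net (E := EuclideanSpace ℝ τ) hδ
  obtain ⟨U, hU1, hU2⟩ := exists_sphere_net (E := EuclideanSpace ℝ ι) hδ
  obtain ⟨v₀, hv₀, -⟩ := exists_mem_net_inner_ge hV2 0
  obtain ⟨u₀, hu₀, -⟩ := exists_mem_net_inner_ge hU2 0
  have : Nonempty V := ⟨v₀, hv₀⟩
  have : Nonempty U := ⟨u₀, hu₀⟩
  set lU := Real.log (Fintype.card U)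
  set lV := Real.log (Fintype.card V)
  have hlU : 0 ≤ lU := Real.log_natCast_nonneg _
  have hlV : 0 ≤ lV := Real.log_natCast_nonneg _
  obtain ⟨N, hN, hNη⟩ : ∃ N : ℝ, 0 < N ∧ lU + lV ≤ N * (η / 2) := by
    refine ⟨(lU + lV) / (η / 2) + 1, by positivity, ?_⟩
    rw [add_mul, div_mul_cancel₀ _ (by positivity)]
    linarith
  -- With θ = -1 the functional is minus a soft minimum over v of a soft maximum over u, so the
  -- upper bound becomes a lower bound for the minimal gain. The extra scalar has mean zero and
  -- disappears on integration.
  have hcomp := integral_nestedLogSumExp_bilinear_le N (-1) V U hV1 hU1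
  have hlow : ∀ w : EuclideanSpace ℝ (CoupledIndex ι τ),
      -(N * (minGain (matOfVec (matPart w)) + δ + δ * ‖matPart w‖ + w (Sum.inr (Sum.inl ()))) + lU)
        ≤ nestedLogSumExp N (-1)
          (innerFamily (fun (v : V) (u : U) => bilinearVec v.1 u.1) w) := by
    intro w
    obtain ⟨v, hv, hvlt⟩ := exists_lt_minGain_add (matOfVec (matPart w)) hδ
    obtain ⟨v', hv', hvv'⟩ := hV2 v hv
    refine le_trans ?_ (le_nestedLogSumExp (⟨v', hv'⟩ : V))
    rw [neg_one_mul, neg_le_neg_iff]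
    refine innerLogSumExp_le hN.le fun u => ?_
    rw [innerFamily_apply, inner_bilinearVec]
    have h1 := real_inner_le_norm u.1 (Matrix.toEuclideanLin (matOfVec (matPart w)) v')
    rw [hU1 u u.2, one_mul] at h1
    have h2 := norm_toEuclideanLin_matOfVec_le (matPart w) (v' - v)
    rw [map_sub] at h2
    have h3 := norm_sub_norm_le (Matrix.toEuclideanLin (matOfVec (matPart w)) v')
      (Matrix.toEuclideanLin (matOfVec (matPart w)) v)
    rw [norm_sub_rev] at hvv'
    have h4 := mul_le_mul_of_nonneg_left hvv' (norm_nonneg (matPart w))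
    linarith
  have hupp : ∀ w : EuclideanSpace ℝ (CoupledIndex ι τ), nestedLogSumExp N (-1)
      (innerFamily (fun (v : V) (u : U) => decoupledVec v.1 u.1) w) ≤
        lV + -(N * (‖leftPart w‖ - δ * ‖leftPart w‖ - ‖rightPart w‖)) := by
    intro w
    refine nestedLogSumExp_le fun v => ?_
    rw [neg_one_mul, neg_le_neg_iff]
    obtain ⟨u, hu, hu'⟩ := exists_mem_net_inner_ge hU2 (leftPart w)
    refine le_innerLogSumExp (u := ⟨u, hu⟩) hN.le ?_
    rw [innerFamily_apply, inner_decoupledVec]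
    have h1 := neg_le_of_abs_le (abs_real_inner_le_norm v.1 (rightPart w))
    rw [hV1 v v.2, one_mul] at h1
    linarith
  have i1 : Integrable (fun w : EuclideanSpace ℝ (CoupledIndex ι τ) =>
      minGain (matOfVec (matPart w))) (stdGaussian _) := by
    refine Continuous.integrable_stdGaussian (a := 0) (b := 1)
      (continuous_minGain_matOfVec.comp (matPart (ι := ι) (τ := τ)).continuous) fun w => ?_
    rw [Real.norm_of_nonneg (minGain_nonneg _), zero_add, one_mul]
    obtain ⟨v, hv⟩ := exists_norm_eq (EuclideanSpace ℝ τ) zero_le_one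
    refine (minGain_le _ hv).trans ((norm_toEuclideanLin_matOfVec_le _ _).trans ?_)
    rw [hv, mul_one]
    exact norm_restrictCoord_le Sum.inl_injective w
  have i2 := integrable_norm_restrictCoord (Sum.inl_injective (α := ι × τ) (β := Unit ⊕ (ι ⊕ τ)))
  have i3 := integrable_norm_restrictCoord (leftPart_index_injective (ι := ι) (τ := τ))
  have i4 := integrable_norm_restrictCoord (rightPart_index_injective (ι := ι) (τ := τ))
  obtain ⟨i5, e5⟩ := integral_coord_stdGaussian
    (Sum.inr (Sum.inl ()) : CoupledIndex ι τ)
  have i6a : Integrable (fun w : EuclideanSpace ℝ (CoupledIndex ι τ) =>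
      minGain (matOfVec (matPart w)) + δ) (stdGaussian _) := i1.add (integrable_const δ)
  have i6b : Integrable (fun w : EuclideanSpace ℝ (CoupledIndex ι τ) =>
      minGain (matOfVec (matPart w)) + δ + δ * ‖matPart w‖) (stdGaussian _) :=
    i6a.add (i2.const_mul δ)
  have i6 : Integrable (fun w : EuclideanSpace ℝ (CoupledIndex ι τ) =>
      minGain (matOfVec (matPart w)) + δ + δ * ‖matPart w‖ + w (Sum.inr (Sum.inl ())))
      (stdGaussian _) := i6b.add i5
  have i7a : Integrable (fun w : EuclideanSpace ℝ (CoupledIndex ι τ) =>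
      ‖leftPart w‖ - δ * ‖leftPart w‖) (stdGaussian _) := i3.sub (i3.const_mul δ)
  have i7 : Integrable (fun w : EuclideanSpace ℝ (CoupledIndex ι τ) =>
      ‖leftPart w‖ - δ * ‖leftPart w‖ - ‖rightPart w‖) (stdGaussian _) := i7a.sub i4
  have i8 : Integrable (fun w : EuclideanSpace ℝ (CoupledIndex ι τ) =>
      -(N * (‖leftPart w‖ - δ * ‖leftPart w‖ - ‖rightPart w‖))) (stdGaussian _) :=
    (i7.const_mul N).neg
  have h1 := integral_mono (((i6.const_mul N).add (integrable_const lU)).neg)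
    (integrable_nestedLogSumExp N (-1) fun (v : V) (u : U) => bilinearVec v.1 u.1) hlow
  have h2 := integral_mono
    (integrable_nestedLogSumExp N (-1) fun (v : V) (u : U) => decoupledVec v.1 u.1)
    ((integrable_const lV).add i8) hupp
  have h3 := (h1.trans hcomp).trans h2
  simp only [Pi.neg_apply, Pi.add_apply] at h3
  rw [integral_neg, integral_add (i6.const_mul N) (integrable_const lU), integral_const_mul,
    integral_add i6b i5, integral_add i6a (i2.const_mul δ), integral_add i1 (integrable_const δ),
    e5, integral_const_mul, integral_add (integrable_const lV) i8, integral_neg,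
    integral_const_mul, integral_sub i7a i4, integral_sub i3 (i3.const_mul δ), integral_const_mul,
    integral_restrictCoord Sum.inl_injective continuous_minGain_matOfVec,
    integral_restrictCoord Sum.inl_injective continuous_norm,
    integral_restrictCoord leftPart_index_injective continuous_norm,
    integral_restrictCoord rightPart_index_injective continuous_norm] at h3
  simp only [integral_const, probReal_univ, smul_eq_mul, one_mul] at h3
  have h4 : N * (aι - δ * aι - aτ) ≤ N * (∫ w, minGain (matOfVec w)
      ∂(stdGaussian (EuclideanSpace ℝ (ι × τ))) + δ + δ * aw + η / 2) := by
    linarith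
  have h5 := le_of_mul_le_mul_left h4 hN
  linarith

/-- Chevet's upper bound for the operator norm of a Gaussian matrix. -/
theorem integral_maxGain_le :
    ∫ w, maxGain (matOfVec w) ∂(stdGaussian (EuclideanSpace ℝ (ι × τ))) ≤
      ∫ g, ‖g‖ ∂(stdGaussian (EuclideanSpace ℝ ι)) +
        ∫ h, ‖h‖ ∂(stdGaussian (EuclideanSpace ℝ τ)) := by
  set aι := ∫ g, ‖g‖ ∂(stdGaussian (EuclideanSpace ℝ ι)) with haι
  set aτ := ∫ g, ‖g‖ ∂(stdGaussian (EuclideanSpace ℝ τ)) with haτ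
  set aw := ∫ g, ‖g‖ ∂(stdGaussian (EuclideanSpace ℝ (ι × τ))) with haw
  have haw0 : 0 ≤ aw := integral_nonneg fun _ => norm_nonneg _
  refine le_of_forall_pos_le_add fun η hη => ?_
  obtain ⟨δ, hδ, hδη⟩ : ∃ δ : ℝ, 0 < δ ∧ δ * (2 * aw + 1) ≤ η / 2 :=
    ⟨η / 2 / (2 * aw + 1), by positivity, by rw [div_mul_cancel₀ _ (by positivity)]⟩
  obtain ⟨V, hV1, hV2⟩ := exists_sphere_net (E := EuclideanSpace ℝ τ) hδ
  obtain ⟨U, hU1, hU2⟩ := exists_sphere_net (E := EuclideanSpace ℝ ι) hδ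
  obtain ⟨v₀, hv₀, -⟩ := exists_mem_net_inner_ge hV2 0
  obtain ⟨u₀, hu₀, -⟩ := exists_mem_net_inner_ge hU2 0
  have : Nonempty V := ⟨v₀, hv₀⟩
  have : Nonempty U := ⟨u₀, hu₀⟩
  set lU := Real.log (Fintype.card U)
  set lV := Real.log (Fintype.card V)
  have hlU : 0 ≤ lU := Real.log_natCast_nonneg _
  have hlV : 0 ≤ lV := Real.log_natCast_nonneg _
  obtain ⟨N, hN, hNη⟩ : ∃ N : ℝ, 0 < N ∧ lU + lV ≤ N * (η / 2) := by
    refine ⟨(lU + lV) / (η / 2) + 1, by positivity, ?_⟩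
    rw [add_mul, div_mul_cancel₀ _ (by positivity)]
    linarith
  have hcomp := integral_nestedLogSumExp_bilinear_le N 1 V U hV1 hU1
  have hlow : ∀ w : EuclideanSpace ℝ (CoupledIndex ι τ),
      N * (maxGain (matOfVec (matPart w)) - 2 * δ * ‖matPart w‖ + w (Sum.inr (Sum.inl ())))
        ≤ nestedLogSumExp N 1 (innerFamily (fun (v : V) (u : U) => bilinearVec v.1 u.1) w) := by
    intro w
    set Φ := nestedLogSumExp N 1 (innerFamily (fun (v : V) (u : U) => bilinearVec v.1 u.1) w)
    set z := w (Sum.inr (Sum.inl ()))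
    -- The mesh is paid for twice: once for moving v to the net point v', once for testing the norm
    -- of the image of v' against the net `U` only.
    have key : ∀ v : EuclideanSpace ℝ τ, ‖v‖ = 1 →
        ‖Matrix.toEuclideanLin (matOfVec (matPart w)) v‖ ≤ Φ / N - z + 2 * δ * ‖matPart w‖ := by
      intro v hv
      obtain ⟨v', hv', hvv'⟩ := hV2 v hv
      obtain ⟨u, hu, hu'⟩ := exists_mem_net_inner_ge hU2
        (Matrix.toEuclideanLin (matOfVec (matPart w)) v')
      have h0 : N * (inner ℝ u (Matrix.toEuclideanLin (matOfVec (matPart w)) v') + z) ≤ Φ := by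
        refine le_trans ?_ (le_nestedLogSumExp (⟨v', hv'⟩ : V))
        rw [one_mul]
        refine le_innerLogSumExp (u := ⟨u, hu⟩) hN.le ?_
        rw [innerFamily_apply, inner_bilinearVec]
      rw [mul_comm, ← le_div_iff₀ hN] at h0
      have h1 := norm_toEuclideanLin_matOfVec_le (matPart w) v'
      rw [hV1 v' hv', mul_one] at h1
      have h2 := norm_toEuclideanLin_matOfVec_le (matPart w) (v - v')
      rw [map_sub] at h2
      have h3 := norm_sub_norm_le (Matrix.toEuclideanLin (matOfVec (matPart w)) v)
        (Matrix.toEuclideanLin (matOfVec (matPart w)) v')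
      have h4 := mul_le_mul_of_nonneg_left hvv' (norm_nonneg (matPart w))
      have h5 := mul_le_mul_of_nonneg_left h1 hδ.le
      linarith
    obtain ⟨v, hv⟩ := exists_norm_eq (EuclideanSpace ℝ τ) zero_le_one
    have h := maxGain_le _ ((norm_nonneg _).trans (key v hv)) key
    rw [mul_comm, ← le_div_iff₀ hN]
    linarith
  have hupp : ∀ w : EuclideanSpace ℝ (CoupledIndex ι τ), nestedLogSumExp N 1
      (innerFamily (fun (v : V) (u : U) => decoupledVec v.1 u.1) w) ≤
        lV + (N * (‖leftPart w‖ + ‖rightPart w‖) + lU) := by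
    intro w
    refine nestedLogSumExp_le fun v => ?_
    rw [one_mul]
    refine innerLogSumExp_le hN.le fun u => ?_
    rw [innerFamily_apply, inner_decoupledVec]
    have h1 := real_inner_le_norm v.1 (rightPart w)
    have h2 := real_inner_le_norm u.1 (leftPart w)
    rw [hV1 v v.2, one_mul] at h1
    rw [hU1 u u.2, one_mul] at h2
    linarith
  have i1 : Integrable (fun w : EuclideanSpace ℝ (CoupledIndex ι τ) =>
      maxGain (matOfVec (matPart w))) (stdGaussian _) := by
    refine Continuous.integrable_stdGaussian (a := 0) (b := 1)
      (continuous_maxGain_matOfVec.comp (matPart (ι := ι) (τ := τ)).continuous) fun w => ?_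
    rw [Real.norm_of_nonneg (maxGain_nonneg _), zero_add, one_mul]
    exact (maxGain_matOfVec_le _).trans (norm_restrictCoord_le Sum.inl_injective w)
  have i2 := integrable_norm_restrictCoord (Sum.inl_injective (α := ι × τ) (β := Unit ⊕ (ι ⊕ τ)))
  have i3 := integrable_norm_restrictCoord (leftPart_index_injective (ι := ι) (τ := τ))
  have i4 := integrable_norm_restrictCoord (rightPart_index_injective (ι := ι) (τ := τ))
  obtain ⟨i5, e5⟩ := integral_coord_stdGaussian
    (Sum.inr (Sum.inl ()) : CoupledIndex ι τ)
  have i6b : Integrable (fun w : EuclideanSpace ℝ (CoupledIndex ι τ) =>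
      maxGain (matOfVec (matPart w)) - 2 * δ * ‖matPart w‖) (stdGaussian _) :=
    i1.sub (i2.const_mul (2 * δ))
  have i6 : Integrable (fun w : EuclideanSpace ℝ (CoupledIndex ι τ) =>
      maxGain (matOfVec (matPart w)) - 2 * δ * ‖matPart w‖ + w (Sum.inr (Sum.inl ())))
      (stdGaussian _) := i6b.add i5
  have i7 : Integrable (fun w : EuclideanSpace ℝ (CoupledIndex ι τ) =>
      N * (‖leftPart w‖ + ‖rightPart w‖)) (stdGaussian _) := (i3.add i4).const_mul N
  have i8 : Integrable (fun w : EuclideanSpace ℝ (CoupledIndex ι τ) =>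
      N * (‖leftPart w‖ + ‖rightPart w‖) + lU) (stdGaussian _) := i7.add (integrable_const lU)
  have h1 := integral_mono (i6.const_mul N)
    (integrable_nestedLogSumExp N 1 fun (v : V) (u : U) => bilinearVec v.1 u.1) hlow
  have h2 := integral_mono
    (integrable_nestedLogSumExp N 1 fun (v : V) (u : U) => decoupledVec v.1 u.1)
    ((integrable_const lV).add i8) hupp
  have h3 := (h1.trans hcomp).trans h2
  simp only [Pi.add_apply] at h3
  rw [integral_const_mul, integral_add i6b i5, integral_sub i1 (i2.const_mul (2 * δ)),
    e5, integral_const_mul, integral_add (integrable_const lV) i8,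
    integral_add i7 (integrable_const lU), integral_const_mul, integral_add i3 i4,
    integral_restrictCoord Sum.inl_injective continuous_maxGain_matOfVec,
    integral_restrictCoord Sum.inl_injective continuous_norm,
    integral_restrictCoord leftPart_index_injective continuous_norm,
    integral_restrictCoord rightPart_index_injective continuous_norm] at h3
  simp only [integral_const, probReal_univ, smul_eq_mul, one_mul] at h3
  have h4 : N * (∫ w, maxGain (matOfVec w) ∂(stdGaussian (EuclideanSpace ℝ (ι × τ))) -
      2 * δ * aw) ≤ N * (aι + aτ + η / 2) := by
    linarith
  have h5 := le_of_mul_le_mul_left h4 hN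
  linarith

end MatrixComparison

/-! ### Means of chi distributions. -/

section ChiMean

/-- The mean of the chi distribution with `n` degrees of freedom. -/
noncomputable def chiMean (n : ℕ) : ℝ :=
  √2 * Real.Gamma ((n + 1) / 2) / Real.Gamma (n / 2)

/-- In polar coordinates the radial moments of order 0 and 1 share the same normalising and volume
constants. The moment of order 0 is 1, which eliminates them and leaves a ratio of Gamma values. -/
theorem integral_norm_stdGaussian {ι : Type*} [Fintype ι] [Nonempty ι] :
    ∫ g, ‖g‖ ∂(stdGaussian (EuclideanSpace ℝ ι)) = chiMean (Fintype.card ι) := by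
  set n := Fintype.card ι with hn
  have hn0 : 0 < n := Fintype.card_pos
  set K : ℝ := (2 * Real.pi) ^ (-(Module.finrank ℝ (EuclideanSpace ℝ ι) : ℝ) / 2)
  set vol := n * (volume : Measure (EuclideanSpace ℝ ι)).real (Metric.ball 0 1)
  have hI : ∀ k : ℕ, ∫ y in Set.Ioi (0 : ℝ), y ^ k * Real.exp (-y ^ 2 / 2) =
      (1 / 2 : ℝ) ^ (-((k : ℝ) + 1) / 2) * (1 / 2) * Real.Gamma ((k + 1) / 2) := by
    intro k
    rw [← integral_rpow_mul_exp_neg_mul_rpow (p := 2) (q := k) (b := 1 / 2) (by norm_num)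
      (by have : (0 : ℝ) ≤ k := k.cast_nonneg
          linarith) (by norm_num)]
    refine setIntegral_congr_fun measurableSet_Ioi fun y _ => ?_
    simp only [Real.rpow_natCast, Real.rpow_ofNat]
    ring_nf
  have hpolar : ∀ k : ℕ, ∫ g : EuclideanSpace ℝ ι, ‖g‖ ^ k ∂(stdGaussian (EuclideanSpace ℝ ι)) =
      K * (vol * ∫ y in Set.Ioi (0 : ℝ), y ^ (n - 1 + k) * Real.exp (-y ^ 2 / 2)) := by
    intro k
    rw [integral_stdGaussian]
    have h := integral_fun_norm_addHaar (volume : Measure (EuclideanSpace ℝ ι))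
      (fun r => K * (Real.exp (-r ^ 2 / 2) * r ^ k))
    simp only [finrank_euclideanSpace, nsmul_eq_mul, smul_eq_mul] at h
    simp only [stdGaussianDensity, smul_eq_mul]
    simp_rw [mul_assoc]
    have e : ∫ y in Set.Ioi (0 : ℝ), y ^ (n - 1) * (K * (Real.exp (-y ^ 2 / 2) * y ^ k)) =
        K * ∫ y in Set.Ioi (0 : ℝ), y ^ (n - 1 + k) * Real.exp (-y ^ 2 / 2) := by
      rw [← integral_const_mul]
      refine setIntegral_congr_fun measurableSet_Ioi fun y _ => ?_
      simp only [pow_add]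
      ring
    rw [h, e]
    ring
  have h0 := hpolar 0
  have h1 := hpolar 1
  simp only [pow_zero, integral_const, probReal_univ, smul_eq_mul, mul_one, add_zero, pow_one]
    at h0 h1
  rw [hI] at h0 h1
  rw [show n - 1 + 1 = n by omega] at h1
  rw [show ((n - 1 : ℕ) : ℝ) + 1 = n by rw [Nat.cast_sub hn0]; simp] at h0
  have hΓ : Real.Gamma ((n : ℝ) / 2) ≠ 0 := (Real.Gamma_pos_of_pos (by positivity)).ne'
  rw [h1, chiMean, eq_div_iff hΓ]
  have h2 : (1 / 2 : ℝ) ^ (-((n : ℝ) + 1) / 2) = √2 * (1 / 2 : ℝ) ^ (-(n : ℝ) / 2) := by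
    rw [show -((n : ℝ) + 1) / 2 = -(n : ℝ) / 2 + -(1 / 2) by ring, Real.rpow_add (by norm_num),
      Real.rpow_neg (by norm_num), ← Real.inv_rpow (by norm_num), Real.sqrt_eq_rpow]
    norm_num [mul_comm]
  rw [h2]
  calc _ = √2 * Real.Gamma ((n + 1) / 2) * (K * (vol * ((1 / 2 : ℝ) ^ (-(n : ℝ) / 2) * (1 / 2) *
        Real.Gamma (n / 2)))) := by ring
    _ = _ := by rw [← h0, mul_one]

lemma chiMean_pos {n : ℕ} (hn : 0 < n) : 0 < chiMean n := by
  unfold chiMean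
  have := Real.Gamma_pos_of_pos (s := (n : ℝ) / 2) (by positivity)
  have := Real.Gamma_pos_of_pos (s := ((n : ℝ) + 1) / 2) (by positivity)
  positivity

/-- The common Gamma value cancels and Γ(n/2 + 1) = (n/2) Γ(n/2). The identity converts bounds at n
+ 1 into reverse bounds at n. -/
lemma chiMean_mul_chiMean_succ {n : ℕ} (hn : 0 < n) : chiMean n * chiMean (n + 1) = n := by
  unfold chiMean
  have h1 := Real.Gamma_pos_of_pos (s := (n : ℝ) / 2) (by positivity)
  have h2 := Real.Gamma_pos_of_pos (s := ((n : ℝ) + 1) / 2) (by positivity)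
  have h3 := Real.Gamma_add_one (s := (n : ℝ) / 2) (by positivity)
  have h4 : √2 * √2 = (2 : ℝ) := Real.mul_self_sqrt (by norm_num)
  push_cast
  rw [show ((n : ℝ) + 1 + 1) / 2 = n / 2 + 1 by ring, h3]
  field_simp
  linear_combination h4

/-- Log-convexity of Γ, since (n + 1)/2 is the midpoint of n/2 and n/2 + 1. -/
lemma chiMean_le_sqrt {n : ℕ} (hn : 0 < n) : chiMean n ≤ √n := by
  have h1 := Real.Gamma_pos_of_pos (s := (n : ℝ) / 2) (by positivity)
  have h2 := Real.Gamma_pos_of_pos (s := ((n : ℝ) + 1) / 2) (by positivity)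
  have h3 := Real.Gamma_add_one (s := (n : ℝ) / 2) (by positivity)
  have h := Real.Gamma_mul_add_mul_le_rpow_Gamma_mul_rpow_Gamma (s := (n : ℝ) / 2)
    (t := (n : ℝ) / 2 + 1) (a := 1 / 2) (b := 1 / 2) (by positivity) (by positivity) (by norm_num)
    (by norm_num) (by norm_num)
  rw [show (1 / 2 : ℝ) * (n / 2) + 1 / 2 * (n / 2 + 1) = (n + 1) / 2 by ring,
    ← Real.sqrt_eq_rpow, ← Real.sqrt_eq_rpow, ← Real.sqrt_mul h1.le, h3,
    show Real.Gamma ((n : ℝ) / 2) * (n / 2 * Real.Gamma (n / 2)) =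
      (n / 2) * Real.Gamma (n / 2) ^ 2 by ring, Real.sqrt_mul (by positivity),
    Real.sqrt_sq h1.le] at h
  rw [chiMean, div_le_iff₀ h1]
  calc √2 * Real.Gamma ((n + 1) / 2) ≤ √2 * (√(n / 2) * Real.Gamma (n / 2)) := by gcongr
    _ = √n * Real.Gamma (n / 2) := by
      rw [← mul_assoc, ← Real.sqrt_mul (by norm_num)]
      congr 2
      ring

lemma chiMean_add_two {n : ℕ} (hn : 0 < n) : n * chiMean (n + 2) = (n + 1) * chiMean n := by
  have h1 := chiMean_mul_chiMean_succ hn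
  have h2 := chiMean_mul_chiMean_succ (n := n + 1) (by omega)
  have h3 := chiMean_pos (n := n + 1) (by omega)
  push_cast at h2
  linear_combination chiMean n * h2 - chiMean (n + 2) * h1

/-- The ratio of χ_n² to n - 1/2 does not increase from n to n + 2. Were it some d < 1 at n, it
would be at most d along n + 2k, contradicting χ_m² ≥ m²/(m + 1), which follows from χ_m χ_{m+1} = m
and χ_{m+1} ≤ √(m + 1). -/
theorem sub_half_le_chiMean_sq {n : ℕ} (hn : 0 < n) : (n : ℝ) - 1 / 2 ≤ chiMean n ^ 2 := by
  by_contra! hlt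
  have hn1 : (1 : ℝ) ≤ n := by exact_mod_cast hn
  set d := chiMean n ^ 2 / (n - 1 / 2) with hd
  have hd1 : d < 1 := (div_lt_one (by linarith)).2 hlt
  have hstep : ∀ k : ℕ, chiMean (n + 2 * k) ^ 2 ≤ d * ((n + 2 * k : ℕ) - 1 / 2 : ℝ) := by
    intro k
    induction k with
    | zero =>
      rw [mul_zero, add_zero, hd, div_mul_cancel₀ _ (by linarith)]
    | succ k ih =>
      set m := n + 2 * k with hm
      have hm0 : 0 < m := by omega
      have hm1 : (1 : ℝ) ≤ m := by exact_mod_cast hm0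
      have h := chiMean_add_two hm0
      rw [show n + 2 * (k + 1) = m + 2 by omega]
      have hdnn : 0 ≤ d := div_nonneg (sq_nonneg _) (by linarith)
      have h2 : (m : ℝ) ^ 2 * chiMean (m + 2) ^ 2 ≤
          (m : ℝ) ^ 2 * (d * ((m + 2 : ℕ) - 1 / 2 : ℝ)) := by
        calc (m : ℝ) ^ 2 * chiMean (m + 2) ^ 2 = (m + 1) ^ 2 * chiMean m ^ 2 := by
              rw [← mul_pow, h, mul_pow]
          _ ≤ (m + 1) ^ 2 * (d * (m - 1 / 2)) := by gcongr
          _ ≤ _ := by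
            push_cast
            nlinarith
      exact le_of_mul_le_mul_left h2 (by positivity)
  -- This size of k gives m(1 - d) > 1, which is incompatible with m² ≤ d(m - 1/2)(m + 1).
  obtain ⟨k, hk⟩ := exists_nat_gt (1 / (1 - d))
  set m := n + 2 * k with hm
  have hm0 : 0 < m := by omega
  have hm1 : (1 : ℝ) ≤ m := by exact_mod_cast hm0
  have hkm : (k : ℝ) ≤ m := by exact_mod_cast (by omega : k ≤ m)
  have h1 := hstep k
  have h2 := chiMean_mul_chiMean_succ hm0
  have h3 := chiMean_le_sqrt (n := m + 1) (by omega)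
  have h4 := chiMean_pos hm0
  have h5 : (m : ℝ) ^ 2 ≤ chiMean m ^ 2 * (m + 1) := by
    have h6 := Real.sq_sqrt (show (0 : ℝ) ≤ ((m + 1 : ℕ) : ℝ) by positivity)
    push_cast at h6 h3
    rw [← h6]
    nth_rewrite 1 [← h2]
    rw [mul_pow]
    have := chiMean_pos (n := m + 1) (by omega)
    gcongr
  rw [div_lt_iff₀ (by linarith)] at hk
  have h6 : (m : ℝ) ^ 2 ≤ d * (m - 1 / 2) * (m + 1) := h5.trans (by gcongr)
  have h7 : 1 < m * (1 - d) := hk.trans_le (mul_le_mul_of_nonneg_right hkm (by linarith))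
  nlinarith

/-- The loss √n - χ_n is at most √n - √(n - 1/2), which decreases in n and so is at most √T - √(T -
1/2). The gain 2√T - 2χ_T compensates for it, because χ_T = T/χ_{T+1} ≤ T/√(T + 1/2) and twice this
quotient is at most √T + √(T - 1/2). -/
theorem sqrt_sub_two_sqrt_le_chiMean {n T : ℕ} (hT : 0 < T) (hn : T ≤ n) :
    √n - 2 * √T ≤ chiMean n - 2 * chiMean T := by
  have hT1 : (1 : ℝ) ≤ T := by exact_mod_cast hT
  have hnT : (T : ℝ) ≤ n := by exact_mod_cast hn
  have h1 : √((n : ℝ) - 1 / 2) ≤ chiMean n :=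
    Real.sqrt_le_iff.2 ⟨(chiMean_pos (by omega)).le, sub_half_le_chiMean_sq (by omega)⟩
  have h2 : chiMean T ≤ T / √((T : ℝ) + 1 / 2) := by
    have h := chiMean_mul_chiMean_succ hT
    have h' := sub_half_le_chiMean_sq (n := T + 1) (by omega)
    have h3 : √((T : ℝ) + 1 / 2) ≤ chiMean (T + 1) := by
      refine Real.sqrt_le_iff.2 ⟨(chiMean_pos (by omega)).le, ?_⟩
      push_cast at h'
      linarith
    rw [le_div_iff₀ (by positivity)]
    refine le_of_le_of_eq ?_ h
    exact mul_le_mul_of_nonneg_left h3 (chiMean_pos hT).le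
  have h3 : √(n : ℝ) - √((n : ℝ) - 1 / 2) ≤ √(T : ℝ) - √((T : ℝ) - 1 / 2) := by
    have e1 := Real.sq_sqrt (show (0 : ℝ) ≤ n by positivity)
    have e2 := Real.sq_sqrt (show (0 : ℝ) ≤ (n : ℝ) - 1 / 2 by linarith)
    have e3 := Real.sq_sqrt (show (0 : ℝ) ≤ T by positivity)
    have e4 := Real.sq_sqrt (show (0 : ℝ) ≤ (T : ℝ) - 1 / 2 by linarith)
    have l1 := Real.sqrt_le_sqrt hnT
    have l2 := Real.sqrt_le_sqrt (show (T : ℝ) - 1 / 2 ≤ n - 1 / 2 by linarith)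
    have p1 := Real.sqrt_pos.2 (show (0 : ℝ) < T by linarith)
    have p2 := Real.sqrt_pos.2 (show (0 : ℝ) < (T : ℝ) - 1 / 2 by linarith)
    have f1 : √(n : ℝ) - √((n : ℝ) - 1 / 2) = (1 / 2) / (√(n : ℝ) + √((n : ℝ) - 1 / 2)) := by
      rw [eq_div_iff (by linarith)]; linear_combination e1 - e2
    have f2 : √(T : ℝ) - √((T : ℝ) - 1 / 2) = (1 / 2) / (√(T : ℝ) + √((T : ℝ) - 1 / 2)) := by
      rw [eq_div_iff (by linarith)]; linear_combination e3 - e4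
    rw [f1, f2]
    gcongr
  have h4 : 2 * (T / √((T : ℝ) + 1 / 2)) ≤ √(T : ℝ) + √((T : ℝ) - 1 / 2) := by
    -- 5/12 is the largest constant for which the concluding inequality still holds at T = 1, where
    -- it becomes an equality.
    have l1 : (T : ℝ) - 5 / 12 ≤ √(T : ℝ) * √((T : ℝ) - 1 / 2) := by
      rw [← Real.sqrt_mul (by positivity)]
      refine Real.le_sqrt_of_sq_le ?_
      nlinarith
    have e3 := Real.sq_sqrt (show (0 : ℝ) ≤ T by positivity)
    have e4 := Real.sq_sqrt (show (0 : ℝ) ≤ (T : ℝ) - 1 / 2 by linarith)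
    have e5 := Real.sq_sqrt (show (0 : ℝ) ≤ (T : ℝ) + 1 / 2 by linarith)
    rw [← pow_le_pow_iff_left₀ (by positivity) (by positivity) two_ne_zero, mul_pow, div_pow, e5,
      ← mul_div_assoc, div_le_iff₀ (by linarith)]
    have : (√(T : ℝ) + √((T : ℝ) - 1 / 2)) ^ 2 ≥ 4 * T - 4 / 3 := by nlinarith
    nlinarith
  linarith

end ChiMean

/-! ### Positivity of integrals against exponentials of positive kernels. -/

section PositiveKernel

variable {G : Type*} [TopologicalSpace G] [CompactSpace G] [SecondCountableTopology G]
  [MeasurableSpace G] [BorelSpace G]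

omit [SecondCountableTopology G] in
lemma Continuous.integrable_of_compactSpace {μ : Measure G} [IsFiniteMeasure μ] {f : G → ℝ}
    (hf : Continuous f) : Integrable f μ :=
  hf.integrable_of_hasCompactSupport (HasCompactSupport.of_compactSpace f)

variable {J : Type*} [Fintype J] (μ : Measure G) [IsProbabilityMeasure μ] {φ : J → G → ℝ}

/-- Expanding one factor of the kernel replaces χ by the functions χ φ_j, so the induction runs over
all χ at once. Without kernel factors the integral is a square. -/
lemma integral_kernel_pow_mul_nonneg (hφ : ∀ j, Continuous (φ j)) (N : ℕ) :
    ∀ {χ : G → ℝ}, Continuous χ →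
      0 ≤ ∫ p : G × G, (∑ j, φ j p.1 * φ j p.2) ^ N * (χ p.1 * χ p.2) ∂(μ.prod μ) := by
  induction N with
  | zero =>
    intro χ _
    simp only [pow_zero, one_mul]
    rw [integral_prod_mul]
    exact mul_self_nonneg _
  | succ N ih =>
    intro χ hχ
    have h : ∀ p : G × G, (∑ j, φ j p.1 * φ j p.2) ^ (N + 1) * (χ p.1 * χ p.2) =
        ∑ j, (∑ j, φ j p.1 * φ j p.2) ^ N * ((χ p.1 * φ j p.1) * (χ p.2 * φ j p.2)) := by
      intro p
      rw [pow_succ, ← Finset.mul_sum, mul_assoc, Finset.sum_mul]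
      congr 1
      exact Finset.sum_congr rfl fun j _ => by ring
    simp_rw [h]
    rw [integral_finsetSum]
    · exact Finset.sum_nonneg fun j _ => ih (χ := fun p => χ p * φ j p) (hχ.mul (hφ j))
    · intro j _
      exact Continuous.integrable_of_compactSpace (by fun_prop)

/-- The exponential of a positive kernel times a positive kernel has nonnegative integral. -/
theorem integral_exp_kernel_mul_nonneg (hφ : ∀ j, Continuous (φ j)) {χ : G → ℝ}
    (hχ : Continuous χ) :
    0 ≤ ∫ p : G × G, Real.exp (∑ j, φ j p.1 * φ j p.2) * (χ p.1 * χ p.2) ∂(μ.prod μ) := by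
  have hK : Continuous fun p : G × G => ∑ j, φ j p.1 * φ j p.2 := by fun_prop
  have hχ2 : Continuous fun p : G × G => χ p.1 * χ p.2 := by fun_prop
  have hlim : Filter.Tendsto (fun n : ℕ => ∫ p : G × G, (∑ i ∈ Finset.range n,
      (∑ j, φ j p.1 * φ j p.2) ^ i / (i.factorial : ℝ)) * (χ p.1 * χ p.2) ∂(μ.prod μ))
      Filter.atTop (nhds (∫ p : G × G, Real.exp (∑ j, φ j p.1 * φ j p.2) * (χ p.1 * χ p.2)
        ∂(μ.prod μ))) := by
    -- Partial sums of the exponential series, dominated by the exponential of the absolute value of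
    -- the kernel.
    refine tendsto_integral_of_dominated_convergence
      (fun p => Real.exp |∑ j, φ j p.1 * φ j p.2| * |χ p.1 * χ p.2|) (fun n => ?_) ?_
      (fun n => .of_forall fun p => ?_) (.of_forall fun p => ?_)
    · exact Continuous.aestronglyMeasurable (by fun_prop)
    · exact Continuous.integrable_of_compactSpace (by fun_prop)
    · rw [norm_mul, Real.norm_eq_abs, Real.norm_eq_abs]
      gcongr
      refine (Finset.abs_sum_le_sum_abs _ _).trans ?_
      simp_rw [abs_div, abs_pow, Nat.abs_cast]
      exact Real.sum_le_exp_of_nonneg (abs_nonneg _) n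
    · refine Filter.Tendsto.mul_const _ ?_
      rw [Real.exp_eq_exp_ℝ]
      exact (NormedSpace.expSeries_div_hasSum_exp _).tendsto_sum_nat
  refine ge_of_tendsto' hlim fun n => ?_
  simp_rw [Finset.sum_mul]
  rw [integral_finsetSum]
  · refine Finset.sum_nonneg fun i _ => ?_
    simp_rw [div_mul_eq_mul_div, integral_div]
    exact div_nonneg (integral_kernel_pow_mul_nonneg μ hφ i hχ) (Nat.cast_nonneg _)
  · intro i _
    exact Continuous.integrable_of_compactSpace (by fun_prop)

end PositiveKernel

/-! ### Haar measure on the orthogonal group and the diagonal positivity statement. -/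

section OrthogonalHaar

/-- The orthogonal group. -/
abbrev OrthGroup (τ : Type*) [Fintype τ] [DecidableEq τ] := Matrix.orthogonalGroup τ ℝ

variable {τ : Type*} [Fintype τ] [DecidableEq τ]

noncomputable instance OrthGroup.measurableSpace : MeasurableSpace (OrthGroup τ) := borel _

instance OrthGroup.borelSpace : BorelSpace (OrthGroup τ) := ⟨rfl⟩

instance OrthGroup.secondCountableTopology : SecondCountableTopology (OrthGroup τ) :=
  have : SecondCountableTopology (Matrix τ τ ℝ) :=
    inferInstanceAs (SecondCountableTopology (τ → τ → ℝ))
  Topology.IsInducing.subtypeVal.secondCountableTopology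

instance OrthGroup.compactSpace : CompactSpace (OrthGroup τ) := by
  suffices h : IsCompact (Matrix.orthogonalGroup τ ℝ : Set (Matrix τ τ ℝ)) from
    isCompact_iff_compactSpace.1 h
  have hK : IsCompact (Set.pi Set.univ fun _ : τ => Set.pi Set.univ fun _ : τ =>
      Set.Icc (-1 : ℝ) 1) :=
    isCompact_univ_pi fun _ => isCompact_univ_pi fun _ => isCompact_Icc
  refine IsCompact.of_isClosed_subset (X := Matrix τ τ ℝ) hK ?_ ?_
  · have : (Matrix.orthogonalGroup τ ℝ : Set (Matrix τ τ ℝ)) = {A | A * A.transpose = 1} := by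
      ext A
      exact Matrix.mem_orthogonalGroup_iff τ ℝ
    rw [this]
    exact isClosed_eq (by fun_prop) continuous_const
  · intro A hA i _ j _
    exact abs_le.1 (entry_norm_bound_of_unitary hA i j)

/-- The normalized Haar measure on the orthogonal group. -/
noncomputable def orthHaar (τ : Type*) [Fintype τ] [DecidableEq τ] : Measure (OrthGroup τ) :=
  Measure.haarMeasure ⊤

instance : IsProbabilityMeasure (orthHaar τ) :=
  ⟨by simpa [orthHaar] using Measure.haarMeasure_self (G := OrthGroup τ) (K₀ := ⊤)⟩

instance : Measure.IsHaarMeasure (orthHaar τ) := by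
  unfold orthHaar; infer_instance

lemma OrthGroup.transpose_mul_self (P : OrthGroup τ) : P.1.transpose * P.1 = 1 :=
  (Matrix.mem_orthogonalGroup_iff' τ ℝ).1 P.2

lemma OrthGroup.mul_transpose_self (P : OrthGroup τ) : P.1 * P.1.transpose = 1 :=
  (Matrix.mem_orthogonalGroup_iff τ ℝ).1 P.2

lemma OrthGroup.continuous_entry (i j : τ) : Continuous fun P : OrthGroup τ => P.1 i j :=
  (continuous_apply_apply i j).comp continuous_subtype_val

/-- The reflection in the `k`-th coordinate hyperplane. -/
def coordReflection (k : τ) : OrthGroup τ :=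
  ⟨Matrix.diagonal fun i => if i = k then -1 else 1, by
    rw [Matrix.mem_orthogonalGroup_iff, Matrix.diagonal_transpose, Matrix.diagonal_mul_diagonal,
      ← Matrix.diagonal_one]
    congr 1
    ext i
    split_ifs <;> simp⟩

lemma coordReflection_mul_apply (k : τ) (P : OrthGroup τ) (i j : τ) :
    (coordReflection k * P).1 i j = (if i = k then -1 else 1) * P.1 i j := by
  simp [coordReflection, Matrix.diagonal_mul]

/-- Nonnegativity of d and l makes the exponent a positive kernel in the two rotations P and Q. The
other factor is a combination of products of an entry in row k of P and one in row m of Q: for k = m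
the coefficient is nonnegative and the product is of the form χ(P) χ(Q), and for k ≠ m the integral
vanishes. -/
lemma integral_orthHaar_diagonal_nonneg {d l : τ → ℝ} (hd : ∀ i, 0 ≤ d i) (hl : ∀ i, 0 ≤ l i)
    (a : τ → ℝ) :
    0 ≤ ∫ p : OrthGroup τ × OrthGroup τ,
      Real.exp (∑ i, d i * (p.1.1.transpose * Matrix.diagonal l * p.2.1) i i) *
        ∑ i, d i * ((p.1.1.transpose.mulVec ((Matrix.diagonal l).mulVec a)) i *
          (p.2.1.transpose.mulVec a) i) ∂((orthHaar τ).prod (orthHaar τ)) := by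
  have hc := OrthGroup.continuous_entry (τ := τ)
  have hK : ∀ p : OrthGroup τ × OrthGroup τ,
      ∑ i, d i * (p.1.1.transpose * Matrix.diagonal l * p.2.1) i i =
      ∑ j : τ × τ, (√(d j.1 * l j.2) * p.1.1 j.2 j.1) * (√(d j.1 * l j.2) * p.2.1 j.2 j.1) := by
    intro p
    rw [Fintype.sum_prod_type]
    refine Finset.sum_congr rfl fun i _ => ?_
    rw [Matrix.mul_apply, Finset.mul_sum]
    refine Finset.sum_congr rfl fun k _ => ?_
    rw [Matrix.mul_diagonal, Matrix.transpose_apply]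
    have := Real.mul_self_sqrt (mul_nonneg (hd i) (hl k))
    linear_combination (-p.1.1 k i * p.2.1 k i) * this
  have hB : ∀ p : OrthGroup τ × OrthGroup τ,
      ∑ i, d i * ((p.1.1.transpose.mulVec ((Matrix.diagonal l).mulVec a)) i *
          (p.2.1.transpose.mulVec a) i) =
      ∑ k, ∑ m, ∑ i, (l k * a k * a m) * ((√(d i) * p.1.1 k i) * (√(d i) * p.2.1 m i)) := by
    intro p
    have e : ∀ i, d i * ((p.1.1.transpose.mulVec ((Matrix.diagonal l).mulVec a)) i *
          (p.2.1.transpose.mulVec a) i) =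
        ∑ k, ∑ m, (l k * a k * a m) * ((√(d i) * p.1.1 k i) * (√(d i) * p.2.1 m i)) := by
      intro i
      simp only [Matrix.mulVec, dotProduct, Matrix.transpose_apply]
      rw [Finset.sum_mul_sum, Finset.mul_sum]
      refine Finset.sum_congr rfl fun k _ => ?_
      rw [Finset.mul_sum]
      refine Finset.sum_congr rfl fun m _ => ?_
      have h1 : ∑ x, Matrix.diagonal l k x * a x = l k * a k := by
        simp [Matrix.diagonal_apply]
      have := Real.mul_self_sqrt (hd i)
      rw [h1]
      linear_combination (-p.1.1 k i * (l k * a k) * (p.2.1 m i * a m)) * this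
    simp_rw [e]
    rw [Finset.sum_comm]
    exact Finset.sum_congr rfl fun k _ => Finset.sum_comm
  simp_rw [hK, hB, Finset.mul_sum]
  have hφ : ∀ j : τ × τ, Continuous fun P : OrthGroup τ => √(d j.1 * l j.2) * P.1 j.2 j.1 :=
    fun j => continuous_const.mul (hc _ _)
  have hKc : Continuous fun p : OrthGroup τ × OrthGroup τ => Real.exp (∑ j : τ × τ,
      (√(d j.1 * l j.2) * p.1.1 j.2 j.1) * (√(d j.1 * l j.2) * p.2.1 j.2 j.1)) :=
    Real.continuous_exp.comp (continuous_finsetSum _ fun j _ =>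
      ((hφ j).comp continuous_fst).mul ((hφ j).comp continuous_snd))
  have hint : ∀ k m i, Integrable (fun p : OrthGroup τ × OrthGroup τ => Real.exp (∑ j : τ × τ,
      (√(d j.1 * l j.2) * p.1.1 j.2 j.1) * (√(d j.1 * l j.2) * p.2.1 j.2 j.1)) *
      ((l k * a k * a m) * ((√(d i) * p.1.1 k i) * (√(d i) * p.2.1 m i))))
      ((orthHaar τ).prod (orthHaar τ)) := by
    intro k m i
    refine Continuous.integrable_of_compactSpace (hKc.mul (continuous_const.mul
      ((continuous_const.mul ((hc k i).comp continuous_fst)).mul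
        (continuous_const.mul ((hc m i).comp continuous_snd)))))
  rw [integral_finsetSum _ fun k _ => integrable_finsetSum _ fun m _ =>
    integrable_finsetSum _ fun i _ => hint k m i]
  refine Finset.sum_nonneg fun k _ => ?_
  rw [integral_finsetSum _ fun m _ => integrable_finsetSum _ fun i _ => hint k m i]
  refine Finset.sum_nonneg fun m _ => ?_
  rw [integral_finsetSum _ fun i _ => hint k m i]
  refine Finset.sum_nonneg fun i _ => ?_
  simp_rw [mul_left_comm (Real.exp _) (l k * a k * a m)]
  rw [integral_const_mul]
  rcases eq_or_ne k m with rfl | hkm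
  · refine mul_nonneg ?_ ?_
    · rw [mul_assoc]; exact mul_nonneg (hl k) (mul_self_nonneg _)
    · exact integral_exp_kernel_mul_nonneg (orthHaar τ) hφ (χ := fun P => √(d i) * P.1 k i)
        (continuous_const.mul (hc k i))
  · refine le_of_eq ?_
    rw [eq_comm, mul_eq_zero]
    right
    -- Flipping row k of both rotations preserves Haar measure and the exponent, but changes the
    -- sign of the product of entries because m ≠ k.
    have h := integral_mul_left_eq_self (μ := (orthHaar τ).prod (orthHaar τ))
      (fun p : OrthGroup τ × OrthGroup τ => Real.exp (∑ j : τ × τ,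
      (√(d j.1 * l j.2) * p.1.1 j.2 j.1) * (√(d j.1 * l j.2) * p.2.1 j.2 j.1)) *
      ((√(d i) * p.1.1 k i) * (√(d i) * p.2.1 m i))) (coordReflection k, coordReflection k)
    simp only [Prod.fst_mul, Prod.snd_mul, coordReflection_mul_apply, if_true, hkm.symm, if_false]
      at h
    have e : ∀ p : OrthGroup τ × OrthGroup τ, Real.exp (∑ j : τ × τ,
        (√(d j.1 * l j.2) * ((if j.2 = k then -1 else 1) * p.1.1 j.2 j.1)) *
        (√(d j.1 * l j.2) * ((if j.2 = k then -1 else 1) * p.2.1 j.2 j.1))) *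
        ((√(d i) * (-1 * p.1.1 k i)) * (√(d i) * (1 * p.2.1 m i))) =
        -(Real.exp (∑ j : τ × τ,
        (√(d j.1 * l j.2) * p.1.1 j.2 j.1) * (√(d j.1 * l j.2) * p.2.1 j.2 j.1)) *
        ((√(d i) * p.1.1 k i) * (√(d i) * p.2.1 m i))) := by
      intro p
      have : ∀ j : τ × τ, (√(d j.1 * l j.2) * ((if j.2 = k then -1 else 1) * p.1.1 j.2 j.1)) *
          (√(d j.1 * l j.2) * ((if j.2 = k then -1 else 1) * p.2.1 j.2 j.1)) =
          (√(d j.1 * l j.2) * p.1.1 j.2 j.1) * (√(d j.1 * l j.2) * p.2.1 j.2 j.1) := by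
        intro j; split_ifs <;> ring
      simp_rw [this]
      ring
    simp_rw [e] at h
    rw [integral_neg] at h
    linarith

end OrthogonalHaar

/-! ### Singular value decomposition. -/

section SingularValueDecomposition

variable {ι τ : Type*} [Fintype ι] [DecidableEq ι] [Fintype τ] [DecidableEq τ]

omit [DecidableEq ι] in
lemma norm_toEuclideanLin_sq (A : Matrix ι τ ℝ) (v : EuclideanSpace ℝ τ) :
    ‖Matrix.toEuclideanLin A v‖ ^ 2 = v.ofLp ⬝ᵥ (A.transpose * A).mulVec v.ofLp := by
  rw [EuclideanSpace.real_norm_sq_eq, ← Matrix.mulVec_mulVec, Matrix.dotProduct_mulVec,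
    Matrix.vecMul_transpose]
  simp [dotProduct, pow_two]

lemma toEuclideanLin_mul_apply {κ : Type*} [Fintype κ] (A : Matrix κ ι ℝ) (B : Matrix ι τ ℝ)
    (v : EuclideanSpace ℝ τ) :
    Matrix.toEuclideanLin (A * B) v = Matrix.toEuclideanLin A (Matrix.toEuclideanLin B v) := by
  ext i
  simp [Matrix.mulVec_mulVec]

lemma norm_toEuclideanLin_orth (U : OrthGroup ι) (v : EuclideanSpace ℝ ι) :
    ‖Matrix.toEuclideanLin U.1 v‖ = ‖v‖ := by
  rw [← pow_left_inj₀ (norm_nonneg _) (norm_nonneg _) two_ne_zero, norm_toEuclideanLin_sq,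
    OrthGroup.transpose_mul_self U, Matrix.one_mulVec, EuclideanSpace.real_norm_sq_eq]
  simp [dotProduct, pow_two]

/-- Two matrices with the same Gram matrix differ by a left orthogonal factor. -/
theorem exists_orth_mul_eq {A B : Matrix ι τ ℝ} (h : A.transpose * A = B.transpose * B) :
    ∃ U : OrthGroup ι, A = U.1 * B := by
  set a := Matrix.toEuclideanLin A
  set b := Matrix.toEuclideanLin B
  have hnorm : ∀ v, ‖a v‖ = ‖b v‖ := fun v => by
    rw [← pow_left_inj₀ (norm_nonneg _) (norm_nonneg _) two_ne_zero, norm_toEuclideanLin_sq,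
      norm_toEuclideanLin_sq, h]
  have hker : LinearMap.ker b ≤ LinearMap.ker a := fun v hv => by
    rw [LinearMap.mem_ker] at hv ⊢
    rw [← norm_eq_zero, hnorm, hv, norm_zero]
  -- Equal Gram matrices make b v ↦ a v well defined and isometric on the range of b. Any isometric
  -- extension to the whole space is the required orthogonal factor.
  let L₀ : LinearMap.range b →ₗ[ℝ] EuclideanSpace ℝ ι :=
    (LinearMap.ker b).liftQ a hker ∘ₗ b.quotKerEquivRange.symm.toLinearMap
  have hL₀ : ∀ v, L₀ ⟨b v, LinearMap.mem_range_self b v⟩ = a v := by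
    intro v
    have : b.quotKerEquivRange.symm ⟨b v, LinearMap.mem_range_self b v⟩ =
        (LinearMap.ker b).mkQ v := b.quotKerEquivRange_symm_apply_image v _
    simp only [L₀, LinearMap.comp_apply, LinearEquiv.coe_coe, this]
    exact (LinearMap.ker b).liftQ_apply a v
  let L₁ : LinearMap.range b →ₗᵢ[ℝ] EuclideanSpace ℝ ι :=
    { toLinearMap := L₀
      norm_map' := by
        rintro ⟨_, v, rfl⟩
        rw [hL₀, hnorm]
        rfl }
  let L := L₁.extend
  have hLb : ∀ v, L (b v) = a v := fun v => by
    rw [← hL₀ v]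
    exact L₁.extend_apply ⟨b v, LinearMap.mem_range_self b v⟩
  let U := Matrix.toEuclideanLin.symm L.toLinearMap
  have hU : ∀ w, Matrix.toEuclideanLin U w = L w := fun w => by
    simp only [U, LinearEquiv.apply_symm_apply]
    rfl
  have hUorth : U ∈ Matrix.orthogonalGroup ι ℝ := by
    rw [Matrix.mem_orthogonalGroup_iff']
    ext i j
    have h1 := L.inner_map_map (EuclideanSpace.single i 1) (EuclideanSpace.single j 1)
    rw [← hU, ← hU, EuclideanSpace.inner_single_left] at h1
    simp only [PiLp.inner_apply, Matrix.toLpLin_apply, PiLp.ofLp_single,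
      Matrix.mulVec_single_one, Matrix.col_apply, RCLike.inner_apply, conj_trivial, one_mul,
      Pi.single_apply] at h1
    rw [Matrix.mul_apply, Matrix.one_apply, ← h1]
    exact Finset.sum_congr rfl fun k _ => mul_comm _ _
  refine ⟨⟨U, hUorth⟩, Matrix.toEuclideanLin.injective (LinearMap.ext fun v => ?_)⟩
  rw [toEuclideanLin_mul_apply, hU, hLb]

omit [DecidableEq ι] in
lemma exists_orth_gram_diagonal (X : Matrix ι τ ℝ) :
    ∃ (R : OrthGroup τ) (l : τ → ℝ), (∀ i, 0 ≤ l i) ∧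
      (X * R.1).transpose * (X * R.1) = Matrix.diagonal fun i => l i * l i := by
  have hpsd : (X.transpose * X).PosSemidef := by
    simpa using Matrix.posSemidef_conjTranspose_mul_self X
  have hs := hpsd.isHermitian.spectral_theorem
  refine ⟨hpsd.isHermitian.eigenvectorUnitary, fun i => √(hpsd.isHermitian.eigenvalues i),
    fun i => Real.sqrt_nonneg _, ?_⟩
  set R : OrthGroup τ := hpsd.isHermitian.eigenvectorUnitary
  have hR := OrthGroup.transpose_mul_self R
  rw [Unitary.conjStarAlgAut_apply] at hs
  change X.transpose * X = R.1 * _ * R.1.transpose at hs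
  have e : (fun i => √(hpsd.isHermitian.eigenvalues i) * √(hpsd.isHermitian.eigenvalues i)) =
      hpsd.isHermitian.eigenvalues :=
    funext fun i => Real.mul_self_sqrt (hpsd.eigenvalues_nonneg i)
  rw [e]
  clear_value R
  generalize hpsd.isHermitian.eigenvalues = μ at hs
  have hs' : X.transpose * X = R.1 * Matrix.diagonal μ * R.1.transpose := hs
  calc (X * R.1).transpose * (X * R.1) = R.1.transpose * (X.transpose * X) * R.1 := by
        simp only [Matrix.transpose_mul, Matrix.mul_assoc]
    _ = (R.1.transpose * R.1) * Matrix.diagonal μ * (R.1.transpose * R.1) := by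
      rw [hs']; simp only [Matrix.mul_assoc]
    _ = _ := by
      rw [hR, Matrix.one_mul, Matrix.mul_one]

lemma exists_svd (X : Matrix τ τ ℝ) :
    ∃ (U R : OrthGroup τ) (l : τ → ℝ), (∀ i, 0 ≤ l i) ∧
      X = U.1 * Matrix.diagonal l * R.1.transpose := by
  obtain ⟨R, l, hl, h⟩ := exists_orth_gram_diagonal X
  obtain ⟨U, hU⟩ := exists_orth_mul_eq (A := X * R.1) (B := Matrix.diagonal l) (by
    rw [h, Matrix.diagonal_transpose, Matrix.diagonal_mul_diagonal])
  refine ⟨U, R, l, hl, ?_⟩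
  rw [← hU, Matrix.mul_assoc, OrthGroup.mul_transpose_self R, Matrix.mul_one]

/-- Unit vectors, viewed as one-column matrices, all have Gram matrix 1. -/
lemma exists_orth_mul_unit {v w : EuclideanSpace ℝ ι} (hv : ‖v‖ = 1) (hw : ‖w‖ = 1) :
    ∃ U : OrthGroup ι, Matrix.toEuclideanLin U.1 w = v := by
  have hgram : ∀ {u : EuclideanSpace ℝ ι}, ‖u‖ = 1 →
      (Matrix.of fun i (_ : Unit) => u i).transpose * (Matrix.of fun i (_ : Unit) => u i) = 1 := by
    intro u hu
    ext i j
    have h := EuclideanSpace.real_norm_sq_eq u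
    rw [hu, one_pow] at h
    simp [Matrix.mul_apply, ← pow_two, ← h]
  obtain ⟨U, hU⟩ := exists_orth_mul_eq ((hgram hv).trans (hgram hw).symm)
  refine ⟨U, ?_⟩
  ext i
  have h := congrFun (congrFun hU i) ()
  rw [Matrix.of_apply] at h
  rw [h]
  simp [Matrix.mul_apply, Matrix.mulVec, dotProduct]

end SingularValueDecomposition

/-! ### Orthogonal invariance of Gaussian matrices. -/

section OrthogonalAction

variable {ι τ : Type*} [Fintype ι] [DecidableEq ι] [Fintype τ] [DecidableEq τ]

omit [DecidableEq ι] [DecidableEq τ] in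
lemma norm_sq_eq_trace (x : EuclideanSpace ℝ (ι × τ)) :
    ‖x‖ ^ 2 = ((matOfVec x).transpose * matOfVec x).trace := by
  rw [EuclideanSpace.real_norm_sq_eq, Fintype.sum_prod_type_right]
  simp [Matrix.trace, Matrix.mul_apply, matOfVec, pow_two]

/-- Two-sided multiplication by orthogonal matrices, as an isometry of the space of matrices. -/
noncomputable def orthAct (R : OrthGroup ι) (Q : OrthGroup τ) :
    EuclideanSpace ℝ (ι × τ) →ₗᵢ[ℝ] EuclideanSpace ℝ (ι × τ) where
  toFun x := WithLp.toLp 2 fun p => (R.1 * matOfVec x * Q.1) p.1 p.2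
  map_add' x y := by
    ext p
    simp [matOfVec_add, Matrix.mul_add, Matrix.add_mul]
  map_smul' c x := by
    ext p
    simp [matOfVec_smul]
  norm_map' x := by
    have e : matOfVec (WithLp.toLp 2 fun p : ι × τ => (R.1 * matOfVec x * Q.1) p.1 p.2) =
      R.1 * matOfVec x * Q.1 := rfl
    rw [← pow_left_inj₀ (norm_nonneg _) (norm_nonneg _) two_ne_zero]
    change ‖(WithLp.toLp 2 fun p : ι × τ => (R.1 * matOfVec x * Q.1) p.1 p.2)‖ ^ 2 = _
    rw [norm_sq_eq_trace, norm_sq_eq_trace, e]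
    calc ((R.1 * matOfVec x * Q.1).transpose * (R.1 * matOfVec x * Q.1)).trace
        = (Q.1.transpose * ((matOfVec x).transpose * (R.1.transpose * R.1) * matOfVec x *
            Q.1)).trace := by simp only [Matrix.transpose_mul, Matrix.mul_assoc]
      _ = ((matOfVec x).transpose * (R.1.transpose * R.1) * matOfVec x *
            (Q.1 * Q.1.transpose)).trace := by rw [Matrix.trace_mul_comm, Matrix.mul_assoc]
      _ = _ := by
        rw [OrthGroup.transpose_mul_self R, OrthGroup.mul_transpose_self Q, Matrix.mul_one,
          Matrix.mul_one]

lemma matOfVec_orthAct (R : OrthGroup ι) (Q : OrthGroup τ) (x : EuclideanSpace ℝ (ι × τ)) :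
    matOfVec (orthAct R Q x) = R.1 * matOfVec x * Q.1 := rfl

lemma integral_orthAct (R : OrthGroup ι) (Q : OrthGroup τ) (F : EuclideanSpace ℝ (ι × τ) → ℝ) :
    ∫ x, F (orthAct R Q x) ∂(stdGaussian (EuclideanSpace ℝ (ι × τ))) =
      ∫ x, F x ∂(stdGaussian (EuclideanSpace ℝ (ι × τ))) := by
  let f := (orthAct R Q).toLinearIsometryEquiv rfl
  have hf : MeasurePreserving f (stdGaussian (EuclideanSpace ℝ (ι × τ)))
      (stdGaussian (EuclideanSpace ℝ (ι × τ))) := ⟨by fun_prop, stdGaussian_map f⟩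
  exact hf.integral_comp f.toHomeomorph.measurableEmbedding F

end OrthogonalAction

/-! ### Positivity of the orthogonal integral for a general matrix. -/

section OrthogonalIntegral

variable {τ : Type*} [Fintype τ] [DecidableEq τ]

/-- Left translation of the pair of rotations by the orthogonal factors of a singular value
decomposition of X reduces it to its diagonal part; the vector a is rotated accordingly. -/
lemma integral_orthHaar_nonneg {d : τ → ℝ} (hd : ∀ i, 0 ≤ d i) (X : Matrix τ τ ℝ) (a : τ → ℝ) :
    0 ≤ ∫ p : OrthGroup τ × OrthGroup τ,
      Real.exp (∑ i, d i * (p.1.1.transpose * X * p.2.1) i i) *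
        ∑ i, d i * ((p.1.1.transpose.mulVec (X.mulVec a)) i * (p.2.1.transpose.mulVec a) i)
          ∂((orthHaar τ).prod (orthHaar τ)) := by
  obtain ⟨U, R, l, hl, rfl⟩ := exists_svd X
  have h := integral_orthHaar_diagonal_nonneg hd hl (R.1.transpose.mulVec a)
  rw [← integral_mul_left_eq_self (μ := (orthHaar τ).prod (orthHaar τ)) _ (U, R)]
  refine h.trans_eq (integral_congr_ae (.of_forall fun p => ?_))
  have e1 : ((U, R) * p).1.1.transpose * (U.1 * Matrix.diagonal l * R.1.transpose) *
      ((U, R) * p).2.1 = p.1.1.transpose * Matrix.diagonal l * p.2.1 := by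
    calc _ = p.1.1.transpose * (U.1.transpose * U.1) * Matrix.diagonal l *
          (R.1.transpose * R.1) * p.2.1 := by
          simp only [Prod.fst_mul, Prod.snd_mul, Submonoid.coe_mul, Matrix.transpose_mul,
            Matrix.mul_assoc]
      _ = _ := by
        rw [OrthGroup.transpose_mul_self U, OrthGroup.transpose_mul_self R, Matrix.mul_one,
          Matrix.mul_one]
  have e2 : ((U, R) * p).1.1.transpose.mulVec
      ((U.1 * Matrix.diagonal l * R.1.transpose).mulVec a) =
      p.1.1.transpose.mulVec ((Matrix.diagonal l).mulVec (R.1.transpose.mulVec a)) := by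
    rw [Matrix.mulVec_mulVec, Matrix.mulVec_mulVec, Matrix.mulVec_mulVec]
    congr 1
    calc _ = p.1.1.transpose * (U.1.transpose * U.1) * Matrix.diagonal l * R.1.transpose := by
          simp only [Prod.fst_mul, Submonoid.coe_mul, Matrix.transpose_mul, Matrix.mul_assoc]
      _ = _ := by rw [OrthGroup.transpose_mul_self U, Matrix.mul_one]
  have e3 : ((U, R) * p).2.1.transpose.mulVec a =
      p.2.1.transpose.mulVec (R.1.transpose.mulVec a) := by
    rw [Matrix.mulVec_mulVec]
    simp only [Prod.snd_mul, Submonoid.coe_mul, Matrix.transpose_mul]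
  simp only [e1, e2, e3]

end OrthogonalIntegral

/-! ### A soft minimal gain, averaged over the orthogonal group. -/

section SoftMinGain

variable {ι τ : Type*} [Fintype ι] [Fintype τ] [DecidableEq τ]

/-- The image under the matrix `x` of the rotated vector `V e`. -/
noncomputable def rotImage (e : EuclideanSpace ℝ τ) (V : OrthGroup τ)
    (x : EuclideanSpace ℝ (ι × τ)) : EuclideanSpace ℝ ι :=
  Matrix.toEuclideanLin (matOfVec x) (Matrix.toEuclideanLin V.1 e)

omit [Fintype ι] in
lemma rotImage_add (e : EuclideanSpace ℝ τ) (V : OrthGroup τ) (x y : EuclideanSpace ℝ (ι × τ)) :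
    rotImage e V (x + y) = rotImage e V x + rotImage e V y := by
  rw [rotImage, matOfVec_add, map_add]; rfl

omit [Fintype ι] in
lemma rotImage_smul (e : EuclideanSpace ℝ τ) (V : OrthGroup τ) (c : ℝ)
    (x : EuclideanSpace ℝ (ι × τ)) : rotImage e V (c • x) = c • rotImage e V x := by
  rw [rotImage, matOfVec_smul, map_smul]; rfl

lemma norm_rotImage_le {e : EuclideanSpace ℝ τ} (he : ‖e‖ = 1) (V : OrthGroup τ)
    (x : EuclideanSpace ℝ (ι × τ)) : ‖rotImage e V x‖ ≤ ‖x‖ := by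
  have h := norm_toEuclideanLin_matOfVec_le x (Matrix.toEuclideanLin V.1 e)
  rwa [norm_toEuclideanLin_orth, he, mul_one] at h

omit [Fintype ι] in
lemma continuous_rotImage (e : EuclideanSpace ℝ τ) :
    Continuous fun p : OrthGroup τ × EuclideanSpace ℝ (ι × τ) => rotImage e p.1 p.2 := by
  have h : ∀ p : OrthGroup τ × EuclideanSpace ℝ (ι × τ), rotImage e p.1 p.2 =
      WithLp.toLp 2 fun i => ∑ j, p.2 (i, j) * ∑ k, p.1.1 j k * e k := by
    intro p
    ext i
    rw [rotImage, toEuclideanLin_matOfVec_apply]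
    simp [Matrix.mulVec, dotProduct]
  simp_rw [h]
  refine (PiLp.continuous_toLp 2 _).comp (continuous_pi fun i => continuous_finsetSum _ fun j _ =>
    Continuous.mul (by fun_prop) (continuous_finsetSum _ fun k _ =>
      ((OrthGroup.continuous_entry j k).comp continuous_fst).mul continuous_const))

/-- A smoothed version of `‖x V e‖`. -/
noncomputable def smoothGain (ε : ℝ) (e : EuclideanSpace ℝ τ) (V : OrthGroup τ)
    (x : EuclideanSpace ℝ (ι × τ)) : ℝ := √(ε + ‖rotImage e V x‖ ^ 2)

/-- The partition function of the soft minimum of the gain over the orthogonal group. -/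
noncomputable def gainPartition (β ε : ℝ) (e : EuclideanSpace ℝ τ)
    (x : EuclideanSpace ℝ (ι × τ)) : ℝ :=
  ∫ V, Real.exp (-(β * smoothGain ε e V x)) ∂(orthHaar τ)

/-- The derivative of the partition function, up to a factor. -/
noncomputable def gainPartitionDeriv (β ε : ℝ) (e : EuclideanSpace ℝ τ)
    (m x : EuclideanSpace ℝ (ι × τ)) : ℝ :=
  ∫ V, Real.exp (-(β * smoothGain ε e V x)) / smoothGain ε e V x *
    inner ℝ (rotImage e V x) (rotImage e V m) ∂(orthHaar τ)

variable {β ε : ℝ} {e : EuclideanSpace ℝ τ}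

lemma smoothGain_pos (hε : 0 < ε) (V : OrthGroup τ) (x : EuclideanSpace ℝ (ι × τ)) :
    0 < smoothGain ε e V x := by unfold smoothGain; positivity

lemma norm_rotImage_le_smoothGain (hε : 0 < ε) (V : OrthGroup τ) (x : EuclideanSpace ℝ (ι × τ)) :
    ‖rotImage e V x‖ ≤ smoothGain ε e V x :=
  Real.le_sqrt_of_sq_le (by linarith)

lemma smoothGain_le (hε : 0 < ε) (V : OrthGroup τ) (x : EuclideanSpace ℝ (ι × τ)) :
    smoothGain ε e V x ≤ √ε + ‖rotImage e V x‖ := by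
  refine Real.sqrt_le_iff.2 ⟨by positivity, ?_⟩
  have := Real.sq_sqrt hε.le
  nlinarith [mul_nonneg (Real.sqrt_nonneg ε) (norm_nonneg (rotImage e V x))]

lemma continuous_smoothGain :
    Continuous fun p : OrthGroup τ × EuclideanSpace ℝ (ι × τ) => smoothGain ε e p.1 p.2 :=
  Real.continuous_sqrt.comp (continuous_const.add ((continuous_rotImage e).norm.pow 2))

lemma continuous_gainWeight (hε : 0 < ε) :
    Continuous fun p : OrthGroup τ × EuclideanSpace ℝ (ι × τ) =>
      Real.exp (-(β * smoothGain ε e p.1 p.2)) / smoothGain ε e p.1 p.2 :=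
  (Real.continuous_exp.comp (continuous_const.mul continuous_smoothGain).neg).div
    continuous_smoothGain fun _ => (smoothGain_pos hε _ _).ne'

omit [Fintype ι] in
lemma continuous_rotImage_left (x : EuclideanSpace ℝ (ι × τ)) :
    Continuous fun V : OrthGroup τ => rotImage e V x :=
  Continuous.uncurry_right x (continuous_rotImage (ι := ι) e)

lemma continuous_smoothGain_left (x : EuclideanSpace ℝ (ι × τ)) :
    Continuous fun V : OrthGroup τ => smoothGain ε e V x :=
  Continuous.uncurry_right x (continuous_smoothGain (ι := ι) (ε := ε) (e := e))

lemma continuous_gainWeight_left (hε : 0 < ε) (x : EuclideanSpace ℝ (ι × τ)) :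
    Continuous fun V : OrthGroup τ =>
      Real.exp (-(β * smoothGain ε e V x)) / smoothGain ε e V x :=
  (Real.continuous_exp.comp (continuous_const.mul (continuous_smoothGain_left x)).neg).div
    (continuous_smoothGain_left x) fun _ => (smoothGain_pos hε _ _).ne'

lemma continuous_gainPartition : Continuous (gainPartition β ε e (ι := ι)) := by
  have h := continuous_parametric_integral_of_continuous (μ := orthHaar τ)
    (f := fun (x : EuclideanSpace ℝ (ι × τ)) V => Real.exp (-(β * smoothGain ε e V x)))
    (Real.continuous_exp.comp (continuous_const.mul
      (continuous_smoothGain.comp continuous_swap)).neg) isCompact_univ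
  simp only [Measure.restrict_univ] at h
  exact h

lemma continuous_gainPartitionDeriv (hε : 0 < ε) (m : EuclideanSpace ℝ (ι × τ)) :
    Continuous (gainPartitionDeriv β ε e m) := by
  have h := continuous_parametric_integral_of_continuous (μ := orthHaar τ)
    (f := fun (x : EuclideanSpace ℝ (ι × τ)) V =>
      Real.exp (-(β * smoothGain ε e V x)) / smoothGain ε e V x *
        inner ℝ (rotImage e V x) (rotImage e V m))
    (((continuous_gainWeight hε).comp continuous_swap).mul
      (((continuous_rotImage e).comp continuous_swap).inner
      ((continuous_rotImage_left m).comp continuous_snd))) isCompact_univ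
  simp only [Measure.restrict_univ] at h
  exact h

lemma integrable_exp_smoothGain (x : EuclideanSpace ℝ (ι × τ)) :
    Integrable (fun V => Real.exp (-(β * smoothGain ε e V x))) (orthHaar τ) :=
  Continuous.integrable_of_compactSpace
    (Real.continuous_exp.comp (continuous_const.mul (continuous_smoothGain_left x)).neg)

lemma exp_le_gainPartition (hβ : 0 ≤ β) (hε : 0 < ε) (he : ‖e‖ = 1)
    (x : EuclideanSpace ℝ (ι × τ)) : Real.exp (-(β * (√ε + ‖x‖))) ≤ gainPartition β ε e x := by
  have h := integral_mono (μ := orthHaar τ) (integrable_const (Real.exp (-(β * (√ε + ‖x‖)))))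
    (integrable_exp_smoothGain (β := β) (ε := ε) (e := e) x) fun V => by
      have h1 := (smoothGain_le (e := e) hε V x).trans
        (add_le_add_right (norm_rotImage_le he V x) (√ε))
      exact Real.exp_le_exp.2 (neg_le_neg (mul_le_mul_of_nonneg_left h1 hβ))
  simpa [gainPartition] using h

lemma gainPartition_pos (hβ : 0 ≤ β) (hε : 0 < ε) (he : ‖e‖ = 1)
    (x : EuclideanSpace ℝ (ι × τ)) : 0 < gainPartition β ε e x :=
  (Real.exp_pos _).trans_le (exp_le_gainPartition hβ hε he x)

/-- The smoothed gain dominates ‖x V e‖, so its presence in the denominator costs nothing and the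
bound does not involve ε. -/
lemma norm_gainIntegrand_le (hε : 0 < ε) (he : ‖e‖ = 1) (V : OrthGroup τ)
    (m x : EuclideanSpace ℝ (ι × τ)) :
    ‖Real.exp (-(β * smoothGain ε e V x)) / smoothGain ε e V x *
        inner ℝ (rotImage e V x) (rotImage e V m)‖ ≤
      ‖m‖ * Real.exp (-(β * smoothGain ε e V x)) := by
  have h0 := smoothGain_pos (e := e) hε V x
  have h1 : ‖inner ℝ (rotImage e V x) (rotImage e V m)‖ ≤ smoothGain ε e V x * ‖m‖ :=
    (norm_inner_le_norm _ _).trans (mul_le_mul (norm_rotImage_le_smoothGain hε V x)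
      (norm_rotImage_le he V m) (norm_nonneg _) h0.le)
  rw [norm_mul, Real.norm_of_nonneg (by positivity)]
  calc _ ≤ Real.exp (-(β * smoothGain ε e V x)) / smoothGain ε e V x *
        (smoothGain ε e V x * ‖m‖) := by gcongr
    _ = _ := by field_simp

lemma abs_gainPartitionDeriv_le (hε : 0 < ε) (he : ‖e‖ = 1) (m x : EuclideanSpace ℝ (ι × τ)) :
    |gainPartitionDeriv β ε e m x| ≤ ‖m‖ * gainPartition β ε e x := by
  rw [gainPartition, ← integral_const_mul]
  exact norm_integral_le_of_norm_le ((integrable_exp_smoothGain x).const_mul _)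
    (.of_forall fun V => norm_gainIntegrand_le hε he V m x)

lemma hasDerivAt_gainPartition (hβ : 0 ≤ β) (hε : 0 < ε) (he : ‖e‖ = 1)
    (m x : EuclideanSpace ℝ (ι × τ)) (t : ℝ) :
    HasDerivAt (fun t : ℝ => gainPartition β ε e (t • m + x))
      (-(β * gainPartitionDeriv β ε e m (t • m + x))) t := by
  have hpt : ∀ V t, HasDerivAt (fun t : ℝ => Real.exp (-(β * smoothGain ε e V (t • m + x))))
      (-(β * (Real.exp (-(β * smoothGain ε e V (t • m + x))) / smoothGain ε e V (t • m + x) *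
        inner ℝ (rotImage e V (t • m + x)) (rotImage e V m)))) t := by
    intro V t
    have h1 : HasDerivAt (fun t : ℝ => rotImage e V (t • m + x)) (rotImage e V m) t := by
      simp_rw [rotImage_add, rotImage_smul]
      simpa using ((hasDerivAt_id t).smul_const (rotImage e V m)).add_const (rotImage e V x)
    have h2 := ((((h1.norm_sq.const_add ε).sqrt (by positivity)).const_mul β).neg).exp
    refine h2.congr_deriv ?_
    change Real.exp (-(β * smoothGain ε e V (t • m + x))) * -(β * (_ / (2 * smoothGain ε e V
      (t • m + x)))) = _
    have := (smoothGain_pos (e := e) hε V (t • m + x)).ne'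
    field_simp
  rw [gainPartitionDeriv, ← integral_const_mul, ← integral_neg]
  refine (hasDerivAt_integral_of_dominated_loc_of_deriv_le (s := Set.univ)
    (F := fun (t : ℝ) V => Real.exp (-(β * smoothGain ε e V (t • m + x))))
    (bound := fun _ => β * ‖m‖) Filter.univ_mem
    (.of_forall fun t => (integrable_exp_smoothGain _).aestronglyMeasurable)
    (integrable_exp_smoothGain _) ?_ (.of_forall fun V t _ => ?_) (integrable_const _)
    (.of_forall fun V t _ => hpt V t)).2
  · refine Continuous.aestronglyMeasurable (Continuous.neg (continuous_const.mul ?_))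
    exact (continuous_gainWeight_left hε _).mul
      ((continuous_rotImage_left _).inner (continuous_rotImage_left m))
  · rw [norm_neg, norm_mul, Real.norm_of_nonneg hβ]
    refine mul_le_mul_of_nonneg_left ((norm_gainIntegrand_le hε he V m _).trans ?_) hβ
    refine mul_le_of_le_one_right (norm_nonneg _) (Real.exp_le_one_iff.2 ?_)
    have := (smoothGain_pos (e := e) hε V (t • m + x)).le
    nlinarith [mul_nonneg hβ this]

/-- The soft minimum of the gain, scaled by `β`. -/
noncomputable def softMinGain (β ε : ℝ) (e : EuclideanSpace ℝ τ)
    (x : EuclideanSpace ℝ (ι × τ)) : ℝ := -Real.log (gainPartition β ε e x)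

lemma hasDerivAt_softMinGain (hβ : 0 ≤ β) (hε : 0 < ε) (he : ‖e‖ = 1)
    (m x : EuclideanSpace ℝ (ι × τ)) (t : ℝ) :
    HasDerivAt (fun t : ℝ => softMinGain β ε e (t • m + x))
      (β * gainPartitionDeriv β ε e m (t • m + x) / gainPartition β ε e (t • m + x)) t := by
  refine ((hasDerivAt_gainPartition hβ hε he m x t).log
    (gainPartition_pos hβ hε he _).ne').neg.congr_deriv ?_
  ring

lemma continuous_softMinGain (hβ : 0 ≤ β) (hε : 0 < ε) (he : ‖e‖ = 1) :
    Continuous (softMinGain β ε e (ι := ι)) :=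
  (continuous_gainPartition.log fun x => (gainPartition_pos hβ hε he x).ne').neg

lemma continuous_softMinGain_deriv (hβ : 0 ≤ β) (hε : 0 < ε) (he : ‖e‖ = 1)
    (m : EuclideanSpace ℝ (ι × τ)) :
    Continuous fun x => β * gainPartitionDeriv β ε e m x / gainPartition β ε e x :=
  (continuous_const.mul (continuous_gainPartitionDeriv hε m)).div continuous_gainPartition
    fun x => (gainPartition_pos hβ hε he x).ne'

lemma abs_softMinGain_deriv_le (hβ : 0 ≤ β) (hε : 0 < ε) (he : ‖e‖ = 1)
    (m x : EuclideanSpace ℝ (ι × τ)) :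
    |β * gainPartitionDeriv β ε e m x / gainPartition β ε e x| ≤ β * ‖m‖ := by
  have hJ := gainPartition_pos (e := e) hβ hε he x
  rw [abs_div, abs_mul, abs_of_nonneg hβ, abs_of_pos hJ, div_le_iff₀ hJ, mul_assoc]
  exact mul_le_mul_of_nonneg_left (abs_gainPartitionDeriv_le hε he m x) hβ

lemma mul_minGain_le_softMinGain (hβ : 0 ≤ β) (hε : 0 < ε) (he : ‖e‖ = 1)
    (x : EuclideanSpace ℝ (ι × τ)) : β * minGain (matOfVec x) ≤ softMinGain β ε e x := by
  rw [softMinGain, le_neg, ← Real.log_exp (-(β * minGain (matOfVec x)))]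
  refine Real.log_le_log (gainPartition_pos hβ hε he x) ?_
  have h := integral_mono (μ := orthHaar τ)
    (integrable_exp_smoothGain (β := β) (ε := ε) (e := e) x)
    (integrable_const (Real.exp (-(β * minGain (matOfVec x))))) fun V => by
      refine Real.exp_le_exp.2 (neg_le_neg (mul_le_mul_of_nonneg_left ?_ hβ))
      refine (minGain_le (matOfVec x) (v := Matrix.toEuclideanLin V.1 e) ?_).trans
        (norm_rotImage_le_smoothGain hε V x)
      rw [norm_toEuclideanLin_orth, he]
  simpa [gainPartition] using h

lemma continuous_orth_apply (e : EuclideanSpace ℝ τ) :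
    Continuous fun V : OrthGroup τ => Matrix.toEuclideanLin V.1 e := by
  have h : ∀ V : OrthGroup τ, Matrix.toEuclideanLin V.1 e =
      WithLp.toLp 2 fun j => ∑ k, V.1 j k * e k := by
    intro V
    ext j
    simp [Matrix.mulVec, dotProduct]
  simp_rw [h]
  exact (PiLp.continuous_toLp 2 _).comp (continuous_pi fun j => continuous_finsetSum _ fun k _ =>
    (OrthGroup.continuous_entry j k).mul continuous_const)

/-- The soft minimum is at most the minimum, up to an additive error independent of `β`. -/
lemma exists_softMinGain_le [Nonempty τ] (he : ‖e‖ = 1) {δ : ℝ} (hδ : 0 < δ) :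
    ∃ C : ℝ, ∀ {β ε : ℝ}, 0 ≤ β → 0 < ε → ∀ x : EuclideanSpace ℝ (ι × τ),
      softMinGain β ε e x ≤ β * (√ε + (minGain (matOfVec x) + δ) + δ * ‖x‖) + C := by
  -- The rotations that bring e close to v. By Haar invariance their mass does not depend on the
  -- unit vector v, and it is positive because the identity lies in the open set `S e`. The constant
  -- is minus the logarithm of this mass.
  set S : EuclideanSpace ℝ τ → Set (OrthGroup τ) := fun v =>
    {V | ‖Matrix.toEuclideanLin V.1 e - v‖ < δ} with hS
  have hSopen : ∀ v, IsOpen (S v) := fun v =>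
    isOpen_lt ((continuous_orth_apply e).sub continuous_const).norm continuous_const
  have hpos : 0 < (orthHaar τ).real (S e) := by
    refine ENNReal.toReal_pos ((hSopen e).measure_pos _ ⟨1, ?_⟩).ne' (measure_ne_top _ _)
    simp [hS, hδ]
  have hSv : ∀ v, ‖v‖ = 1 → (orthHaar τ).real (S v) = (orthHaar τ).real (S e) := by
    intro v hv
    obtain ⟨U, hU⟩ := exists_orth_mul_unit hv he
    have : S e = (fun V => U * V) ⁻¹' S v := by
      ext V
      simp only [hS, Set.mem_ofPred_eq, Set.mem_preimage, Submonoid.coe_mul]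
      rw [toEuclideanLin_mul_apply, ← hU, ← map_sub, norm_toEuclideanLin_orth]
    rw [this, measureReal_def, measureReal_def, measure_preimage_mul]
  refine ⟨-Real.log ((orthHaar τ).real (S e)), fun {β ε} hβ hε x => ?_⟩
  obtain ⟨v, hv, hvlt⟩ := exists_lt_minGain_add (matOfVec x) hδ
  set c := √ε + (minGain (matOfVec x) + δ) + δ * ‖x‖ with hc
  have hlow : Real.exp (-(β * c)) * (orthHaar τ).real (S e) ≤ gainPartition β ε e x := by
    rw [← hSv v hv, gainPartition]
    calc Real.exp (-(β * c)) * (orthHaar τ).real (S v)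
        = ∫ _V in S v, Real.exp (-(β * c)) ∂(orthHaar τ) := by simp [mul_comm]
      _ ≤ ∫ V in S v, Real.exp (-(β * smoothGain ε e V x)) ∂(orthHaar τ) := by
        refine setIntegral_mono_on (integrable_const _).integrableOn
          (integrable_exp_smoothGain x).integrableOn (hSopen v).measurableSet fun V hV => ?_
        refine Real.exp_le_exp.2 (neg_le_neg (mul_le_mul_of_nonneg_left ?_ hβ))
        refine (smoothGain_le hε V x).trans ?_
        have h1 := norm_toEuclideanLin_matOfVec_le x (Matrix.toEuclideanLin V.1 e - v)
        rw [map_sub] at h1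
        have h2 := norm_sub_norm_le (rotImage e V x) (Matrix.toEuclideanLin (matOfVec x) v)
        have h3 : ‖x‖ * ‖Matrix.toEuclideanLin V.1 e - v‖ ≤ ‖x‖ * δ :=
          mul_le_mul_of_nonneg_left (le_of_lt hV) (norm_nonneg x)
        have h4 : ‖rotImage e V x - Matrix.toEuclideanLin (matOfVec x) v‖ ≤ _ := h1
        linarith
      _ ≤ ∫ V, Real.exp (-(β * smoothGain ε e V x)) ∂(orthHaar τ) :=
        setIntegral_le_integral (integrable_exp_smoothGain x)
          (.of_forall fun V => (Real.exp_pos _).le)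
  have h := Real.log_le_log (by positivity) hlow
  rw [Real.log_mul (Real.exp_pos _).ne' hpos.ne', Real.log_exp] at h
  rw [softMinGain]
  linarith

lemma integrable_softMinGain_add (hβ : 0 ≤ β) (hε : 0 < ε) (he : ‖e‖ = 1)
    (m : EuclideanSpace ℝ (ι × τ)) :
    Integrable (fun x => softMinGain β ε e (m + x)) (stdGaussian (EuclideanSpace ℝ (ι × τ))) := by
  refine Continuous.integrable_stdGaussian (a := β * (√ε + ‖m‖)) (b := β)
    ((continuous_softMinGain hβ hε he).comp (continuous_const.add continuous_id)) fun x => ?_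
  have h1 := exp_le_gainPartition (e := e) hβ hε he (m + x)
  have h2 := Real.log_le_log (Real.exp_pos _) h1
  rw [Real.log_exp] at h2
  have h3 := mul_minGain_le_softMinGain (e := e) hβ hε he (m + x)
  have h4 := mul_nonneg hβ (minGain_nonneg (matOfVec (m + x)))
  have h5 := mul_le_mul_of_nonneg_left (norm_add_le m x) hβ
  rw [Real.norm_of_nonneg (h4.trans h3), softMinGain]
  linarith

end SoftMinGain

/-! ### Monotonicity of the mean gain under a nonnegative diagonal shift. -/

section DiagonalShift

variable {κ τ : Type*} [Fintype κ] [DecidableEq κ] [Fintype τ] [DecidableEq τ]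

/-- The matrix with a diagonal block on top of a zero block, as a vector. -/
def diagVec (κ : Type*) {τ : Type*} [DecidableEq τ] (d : τ → ℝ) :
    EuclideanSpace ℝ ((τ ⊕ κ) × τ) :=
  WithLp.toLp 2 fun p => Sum.elim (fun i => Matrix.diagonal d i p.2) (fun _ => 0) p.1

omit [Fintype κ] [DecidableEq κ] [Fintype τ] in
lemma smul_diagVec (t : ℝ) (d : τ → ℝ) : t • diagVec κ d = diagVec κ fun i => t * d i := by
  ext ⟨i | i, j⟩ <;> simp [diagVec, Matrix.diagonal_apply]

/-- An orthogonal matrix extended by the identity. -/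
def blockOrth (κ : Type*) [Fintype κ] [DecidableEq κ] (P : OrthGroup τ) : OrthGroup (τ ⊕ κ) :=
  ⟨Matrix.fromBlocks P.1 0 0 1, by
    rw [Matrix.mem_orthogonalGroup_iff, Matrix.fromBlocks_transpose, Matrix.fromBlocks_multiply]
    simp [OrthGroup.mul_transpose_self P]⟩

/-- Conjugation by a pair of orthogonal matrices, the first one acting on the upper block. -/
noncomputable def pairAct (p : OrthGroup τ × OrthGroup τ) :
    EuclideanSpace ℝ ((τ ⊕ κ) × τ) →ₗᵢ[ℝ] EuclideanSpace ℝ ((τ ⊕ κ) × τ) :=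
  orthAct (blockOrth κ p.1)⁻¹ p.2

lemma pairAct_inl (p : OrthGroup τ × OrthGroup τ) (x : EuclideanSpace ℝ ((τ ⊕ κ) × τ))
    (i j : τ) : pairAct p x (Sum.inl i, j) =
      (p.1.1.transpose * (Matrix.of fun i j => x (Sum.inl i, j)) * p.2.1) i j := by
  change (((blockOrth κ p.1).1.transpose * matOfVec x) * p.2.1) (Sum.inl i) j = _
  simp [blockOrth, Matrix.mul_apply, Matrix.fromBlocks_transpose, matOfVec]

lemma continuous_pairAct : Continuous
    fun q : (OrthGroup τ × OrthGroup τ) × EuclideanSpace ℝ ((τ ⊕ κ) × τ) => pairAct q.1 q.2 := by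
  have hb : ∀ i j, Continuous fun P : OrthGroup τ => (blockOrth κ P).1.transpose i j := by
    rintro (i | i) (j | j)
    · simpa [blockOrth] using OrthGroup.continuous_entry j i
    · simpa [blockOrth] using continuous_const
    · simpa [blockOrth] using continuous_const
    · simpa [blockOrth] using continuous_const
  refine (PiLp.continuous_toLp 2 _).comp (continuous_pi fun ij => ?_)
  change Continuous fun q : (OrthGroup τ × OrthGroup τ) × EuclideanSpace ℝ ((τ ⊕ κ) × τ) =>
    ∑ k, (∑ l, (blockOrth κ q.1.1).1.transpose ij.1 l * q.2 (l, k)) * q.1.2.1 k ij.2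
  refine continuous_finsetSum _ fun k _ => Continuous.mul (continuous_finsetSum _ fun l _ =>
    ((hb ij.1 l).comp (continuous_fst.comp continuous_fst)).mul (by fun_prop))
    ((OrthGroup.continuous_entry k ij.2).comp (continuous_snd.comp continuous_fst))

omit [DecidableEq κ] in
lemma inner_diagVec (d : τ → ℝ) (x : EuclideanSpace ℝ ((τ ⊕ κ) × τ)) :
    inner ℝ (diagVec κ d) x = ∑ i, d i * x (Sum.inl i, i) := by
  simp [PiLp.inner_apply, Fintype.sum_prod_type, diagVec, Matrix.diagonal_apply, mul_comm]

lemma rotImage_orthAct {ι : Type*} [Fintype ι] [DecidableEq ι] (e : EuclideanSpace ℝ τ)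
    (V : OrthGroup τ) (R : OrthGroup ι) (Q : OrthGroup τ) (x : EuclideanSpace ℝ (ι × τ)) :
    rotImage e V (orthAct R Q x) = Matrix.toEuclideanLin R.1 (rotImage e (Q * V) x) := by
  simp only [rotImage, matOfVec_orthAct, toEuclideanLin_mul_apply, Submonoid.coe_mul]

lemma smoothGain_orthAct {ι : Type*} [Fintype ι] [DecidableEq ι] (ε : ℝ) (e : EuclideanSpace ℝ τ)
    (V : OrthGroup τ) (R : OrthGroup ι) (Q : OrthGroup τ) (x : EuclideanSpace ℝ (ι × τ)) :
    smoothGain ε e V (orthAct R Q x) = smoothGain ε e (Q * V) x := by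
  rw [smoothGain, rotImage_orthAct, norm_toEuclideanLin_orth, smoothGain]

variable {β ε : ℝ} {e : EuclideanSpace ℝ τ}

lemma gainPartition_orthAct {ι : Type*} [Fintype ι] [DecidableEq ι] (R : OrthGroup ι)
    (Q : OrthGroup τ) (x : EuclideanSpace ℝ (ι × τ)) :
    gainPartition β ε e (orthAct R Q x) = gainPartition β ε e x := by
  simp only [gainPartition, smoothGain_orthAct]
  exact integral_mul_left_eq_self (fun V => Real.exp (-(β * smoothGain ε e V x))) Q

lemma gainPartitionDeriv_smul {ι : Type*} [Fintype ι] (c : ℝ) (m x : EuclideanSpace ℝ (ι × τ)) :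
    gainPartitionDeriv β ε e (c • m) x = c * gainPartitionDeriv β ε e m x := by
  rw [gainPartitionDeriv, gainPartitionDeriv, ← integral_const_mul]
  refine integral_congr_ae (.of_forall fun V => ?_)
  simp only [rotImage_smul, inner_smul_right]
  ring

/-- Haar invariance in V transfers the right rotation from x to the shift. The weight no longer
depends on the pair p, which prepares the average over p. -/
lemma gainPartitionDeriv_pairAct (d : τ → ℝ) (p : OrthGroup τ × OrthGroup τ)
    (x : EuclideanSpace ℝ ((τ ⊕ κ) × τ)) :
    gainPartitionDeriv β ε e (diagVec κ d) (pairAct p x) =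
      ∫ V, Real.exp (-(β * smoothGain ε e V x)) / smoothGain ε e V x *
        ∑ i, d i * ((p.1.1.transpose.mulVec ((Matrix.of fun i j => x (Sum.inl i, j)).mulVec
          (Matrix.toEuclideanLin V.1 e).ofLp)) i *
          (p.2.1.transpose.mulVec (Matrix.toEuclideanLin V.1 e).ofLp) i) ∂(orthHaar τ) := by
  rw [gainPartitionDeriv]
  refine Eq.trans ?_ (integral_mul_left_eq_self _ p.2)
  simp only [pairAct, smoothGain_orthAct, rotImage_orthAct]
  refine integral_congr_ae (.of_forall fun V => ?_)
  dsimp only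
  congr 1
  have h1 : rotImage e V (diagVec κ d) = WithLp.toLp 2 (Sum.elim (fun i => d i *
      (p.2.1.transpose.mulVec (Matrix.toEuclideanLin (p.2 * V).1 e).ofLp) i) fun _ => 0) := by
    have h2 : p.2.1.transpose.mulVec (Matrix.toEuclideanLin (p.2 * V).1 e).ofLp =
        (Matrix.toEuclideanLin V.1 e).ofLp := by
      rw [Submonoid.coe_mul, toEuclideanLin_mul_apply, Matrix.toLpLin_apply, Matrix.mulVec_mulVec,
        OrthGroup.transpose_mul_self p.2, Matrix.one_mulVec]
    rw [h2]
    ext (i | i)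
    · rw [rotImage, toEuclideanLin_matOfVec_apply]
      simp [diagVec, Matrix.diagonal_apply]
    · rw [rotImage, toEuclideanLin_matOfVec_apply]
      simp [diagVec]
  rw [h1, PiLp.inner_apply, Fintype.sum_sum_type]
  have h3 : ∀ i, Matrix.toEuclideanLin (blockOrth κ p.1)⁻¹.1 (rotImage e (p.2 * V) x) (Sum.inl i) =
      (p.1.1.transpose.mulVec ((Matrix.of fun i j => x (Sum.inl i, j)).mulVec
          (Matrix.toEuclideanLin (p.2 * V).1 e).ofLp)) i := by
    intro i
    change ((blockOrth κ p.1).1.transpose.mulVec (rotImage e (p.2 * V) x).ofLp) (Sum.inl i) = _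
    rw [rotImage]
    generalize Matrix.toEuclideanLin (p.2 * V).1 e = a
    simp [blockOrth, Matrix.mulVec, dotProduct, matOfVec]
  simp only [Sum.elim_inl, Sum.elim_inr, inner_zero_right, Finset.sum_const_zero, add_zero, h3]
  refine Finset.sum_congr rfl fun i _ => ?_
  simp only [RCLike.inner_apply, conj_trivial]
  ring

/-- After exchanging integrals, each fixed V contributes a positive weight times the integral of
`integral_orthHaar_nonneg`, with X the upper block of x and a = V e. -/
lemma integral_gainPartitionDeriv_pairAct_nonneg (hε : 0 < ε) {d : τ → ℝ} (hd : ∀ i, 0 ≤ d i)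
    (x : EuclideanSpace ℝ ((τ ⊕ κ) × τ)) :
    0 ≤ ∫ p, Real.exp (inner ℝ (diagVec κ d) (pairAct p x)) *
      gainPartitionDeriv β ε e (diagVec κ d) (pairAct p x) ∂((orthHaar τ).prod (orthHaar τ)) := by
  simp_rw [gainPartitionDeriv_pairAct, ← integral_const_mul, inner_diagVec, pairAct_inl]
  rw [integral_integral_swap]
  · refine integral_nonneg fun V => ?_
    have h := integral_orthHaar_nonneg hd (Matrix.of fun i j => x (Sum.inl i, j))
      (Matrix.toEuclideanLin V.1 e).ofLp
    simp_rw [mul_left_comm (Real.exp (∑ _, _)), integral_const_mul]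
    have := smoothGain_pos (e := e) hε V x
    exact mul_nonneg (by positivity) h
  · refine Continuous.integrable_of_compactSpace ?_
    have h1 : Continuous fun V : OrthGroup τ => (Matrix.toEuclideanLin V.1 e).ofLp :=
      (PiLp.continuous_ofLp 2 _).comp (continuous_orth_apply e)
    have h2 : Continuous fun q : (OrthGroup τ × OrthGroup τ) × OrthGroup τ => q.1.1.1 :=
      continuous_subtype_val.comp (continuous_fst.comp continuous_fst)
    have h3 : Continuous fun q : (OrthGroup τ × OrthGroup τ) × OrthGroup τ => q.1.2.1 :=
      continuous_subtype_val.comp (continuous_snd.comp continuous_fst)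
    have h4 := (continuous_gainWeight_left (β := β) (e := e) hε x).comp
      (continuous_snd (X := OrthGroup τ × OrthGroup τ))
    have h5 := h1.comp (continuous_snd (X := OrthGroup τ × OrthGroup τ))
    refine Continuous.mul (Real.continuous_exp.comp (continuous_finsetSum _ fun i _ =>
      continuous_const.mul ?_)) (h4.mul (continuous_finsetSum _ fun i _ => continuous_const.mul
        (Continuous.mul ?_ ?_)))
    · exact ((h2.matrix_transpose.matrix_mul continuous_const).matrix_mul h3).matrix_elem i i
    · exact (continuous_apply i).comp (h2.matrix_transpose.matrix_mulVec
        (continuous_const.matrix_mulVec h5))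
    · exact (continuous_apply i).comp (h3.matrix_transpose.matrix_mulVec h5)

lemma norm_integrand_le (hβ : 0 ≤ β) (hε : 0 < ε) (he : ‖e‖ = 1) {ι : Type*} [Fintype ι]
    (m x : EuclideanSpace ℝ (ι × τ)) :
    ‖Real.exp (inner ℝ m x) * (gainPartitionDeriv β ε e m x / gainPartition β ε e x)‖ ≤
      ‖m‖ * Real.exp (‖m‖ * ‖x‖) := by
  have hJ := gainPartition_pos (e := e) hβ hε he x
  rw [norm_mul, Real.norm_of_nonneg (Real.exp_pos _).le, mul_comm]
  refine mul_le_mul ?_ (Real.exp_le_exp.2 (real_inner_le_norm m x)) (Real.exp_pos _).le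
    (norm_nonneg m)
  rw [Real.norm_eq_abs, abs_div, abs_of_pos hJ, div_le_iff₀ hJ]
  exact abs_gainPartitionDeriv_le hε he m x

/-- The mean directional derivative of the soft minimum along a diagonal shift is nonnegative. -/
lemma integral_softMinGain_deriv_nonneg (hβ : 0 ≤ β) (hε : 0 < ε) (he : ‖e‖ = 1) {d : τ → ℝ}
    (hd : ∀ i, 0 ≤ d i) :
    0 ≤ ∫ x, gainPartitionDeriv β ε e (diagVec κ d) (diagVec κ d + x) /
      gainPartition β ε e (diagVec κ d + x)
        ∂(stdGaussian (EuclideanSpace ℝ ((τ ⊕ κ) × τ))) := by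
  set m := diagVec κ d with hm
  -- Cameron–Martin: the shift becomes the weight exp⟪m, x⟫, up to a positive constant, and the
  -- integrand is otherwise unshifted.
  rw [integral_add_stdGaussian m fun x => gainPartitionDeriv β ε e m x / gainPartition β ε e x]
  simp_rw [sub_eq_add_neg, Real.exp_add, mul_right_comm (Real.exp _) (Real.exp _)]
  rw [integral_mul_const]
  refine mul_nonneg ?_ (Real.exp_pos _).le
  set ψ : EuclideanSpace ℝ ((τ ⊕ κ) × τ) → ℝ := fun x =>
    Real.exp (inner ℝ m x) * (gainPartitionDeriv β ε e m x / gainPartition β ε e x) with hψ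
  have hψc : Continuous ψ := (Real.continuous_exp.comp (continuous_const.inner continuous_id)).mul
    ((continuous_gainPartitionDeriv hε m).div continuous_gainPartition
      fun x => (gainPartition_pos hβ hε he x).ne')
  -- The Gaussian law is invariant under the pair action, so averaging over pairs changes nothing.
  -- The partition function is invariant too, and only the numerator gets averaged.
  have h1 : ∫ x, ψ x ∂(stdGaussian (EuclideanSpace ℝ ((τ ⊕ κ) × τ))) =
      ∫ p, ∫ x, ψ (pairAct p x) ∂(stdGaussian (EuclideanSpace ℝ ((τ ⊕ κ) × τ)))
        ∂((orthHaar τ).prod (orthHaar τ)) := by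
    have h2 : ∀ p : OrthGroup τ × OrthGroup τ,
        ∫ x, ψ (pairAct p x) ∂(stdGaussian (EuclideanSpace ℝ ((τ ⊕ κ) × τ))) =
          ∫ x, ψ x ∂(stdGaussian (EuclideanSpace ℝ ((τ ⊕ κ) × τ))) :=
      fun p => integral_orthAct _ _ ψ
    simp_rw [h2]
    simp
  rw [h1, integral_integral_swap]
  · refine integral_nonneg fun x => ?_
    have h3 : ∀ p : OrthGroup τ × OrthGroup τ, ψ (pairAct p x) =
        Real.exp (inner ℝ m (pairAct p x)) * gainPartitionDeriv β ε e m (pairAct p x) /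
          gainPartition β ε e x := by
      intro p
      have h4 : gainPartition β ε e (pairAct p x) = gainPartition β ε e x :=
        gainPartition_orthAct _ _ x
      simp only [hψ, h4, mul_div_assoc]
    simp_rw [h3, integral_div]
    exact div_nonneg (integral_gainPartitionDeriv_pairAct_nonneg hε hd x)
      (gainPartition_pos hβ hε he x).le
  · have h5 : Integrable (fun x => ‖m‖ * Real.exp (‖m‖ * ‖x‖))
        (stdGaussian (EuclideanSpace ℝ ((τ ⊕ κ) × τ))) :=
      (integrable_exp_mul_norm_stdGaussian _).const_mul _
    refine (h5.comp_snd ((orthHaar τ).prod (orthHaar τ))).mono'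
      (hψc.comp continuous_pairAct).aestronglyMeasurable (.of_forall fun q => ?_)
    have h6 := norm_integrand_le (e := e) hβ hε he m (pairAct q.1 q.2)
    rw [LinearIsometry.norm_map] at h6
    exact h6

/-- A diagonal shift does not decrease the mean soft minimum. -/
lemma integral_softMinGain_le_add (hβ : 0 ≤ β) (hε : 0 < ε) (he : ‖e‖ = 1) {d : τ → ℝ}
    (hd : ∀ i, 0 ≤ d i) :
    ∫ x, softMinGain β ε e x ∂(stdGaussian (EuclideanSpace ℝ ((τ ⊕ κ) × τ))) ≤
      ∫ x, softMinGain β ε e (diagVec κ d + x)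
        ∂(stdGaussian (EuclideanSpace ℝ ((τ ⊕ κ) × τ))) := by
  set m := diagVec κ d with hm
  set H : ℝ → ℝ := fun t => ∫ x, softMinGain β ε e (t • m + x)
    ∂(stdGaussian (EuclideanSpace ℝ ((τ ⊕ κ) × τ))) with hH
  have hderiv : ∀ t, HasDerivAt H (∫ x, β * gainPartitionDeriv β ε e m (t • m + x) /
      gainPartition β ε e (t • m + x) ∂(stdGaussian (EuclideanSpace ℝ ((τ ⊕ κ) × τ)))) t := by
    intro t
    refine (hasDerivAt_integral_of_dominated_loc_of_deriv_le (s := Set.univ)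
      (F := fun (t : ℝ) x => softMinGain β ε e (t • m + x))
      (F' := fun (t : ℝ) x => β * gainPartitionDeriv β ε e m (t • m + x) /
        gainPartition β ε e (t • m + x)) (bound := fun _ => β * ‖m‖) Filter.univ_mem
      (.of_forall fun t => (integrable_softMinGain_add hβ hε he _).aestronglyMeasurable)
      (integrable_softMinGain_add hβ hε he _) ?_
      (.of_forall fun x t _ => abs_softMinGain_deriv_le hβ hε he m _) (integrable_const _)
      (.of_forall fun x t _ => hasDerivAt_softMinGain hβ hε he m x t)).2
    exact ((continuous_softMinGain_deriv hβ hε he m).comp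
      (continuous_const.add continuous_id)).aestronglyMeasurable
  have hmono : MonotoneOn H (Set.Icc 0 1) := by
    refine monotoneOn_of_deriv_nonneg (convex_Icc 0 1)
      (fun t _ => (hderiv t).continuousAt.continuousWithinAt)
      (fun t _ => (hderiv t).differentiableAt.differentiableWithinAt) fun t ht => ?_
    rw [interior_Icc] at ht
    -- The sign is known for the derivative at the shift t • m in the direction t • m, that is, t
    -- times the derivative of H; in the interior t > 0.
    have h := integral_softMinGain_deriv_nonneg (κ := κ) (e := e) hβ hε he (d := fun i => t * d i)
      fun i => mul_nonneg ht.1.le (hd i)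
    rw [← smul_diagVec, ← hm] at h
    simp_rw [gainPartitionDeriv_smul, mul_div_assoc] at h
    rw [integral_const_mul] at h
    rw [(hderiv t).deriv]
    simp_rw [mul_div_assoc]
    rw [integral_const_mul]
    exact mul_nonneg hβ (nonneg_of_mul_nonneg_right h ht.1)
  simpa [hH] using hmono (Set.left_mem_Icc.2 zero_le_one) (Set.right_mem_Icc.2 zero_le_one)
    zero_le_one

/-- A diagonal shift does not decrease the mean gain. -/
lemma integral_minGain_le_diagVec_add [Nonempty τ] {d : τ → ℝ} (hd : ∀ i, 0 ≤ d i) :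
    ∫ x, minGain (matOfVec x) ∂(stdGaussian (EuclideanSpace ℝ ((τ ⊕ κ) × τ))) ≤
      ∫ x, minGain (matOfVec (diagVec κ d + x))
        ∂(stdGaussian (EuclideanSpace ℝ ((τ ⊕ κ) × τ))) := by
  obtain ⟨e, he⟩ := exists_norm_eq (EuclideanSpace ℝ τ) zero_le_one
  set m := diagVec κ d with hm
  set γ := stdGaussian (EuclideanSpace ℝ ((τ ⊕ κ) × τ)) with hγ
  have hgain : ∀ x : EuclideanSpace ℝ ((τ ⊕ κ) × τ), ‖minGain (matOfVec x)‖ ≤ ‖x‖ := by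
    intro x
    rw [Real.norm_of_nonneg (minGain_nonneg _)]
    refine (minGain_le _ he).trans ((norm_toEuclideanLin_matOfVec_le _ _).trans ?_)
    rw [he, mul_one]
  have i0 : Integrable (fun x => minGain (matOfVec x)) γ :=
    Continuous.integrable_stdGaussian (a := 0) (b := 1) continuous_minGain_matOfVec fun x => by
      simpa using hgain x
  have i1 : Integrable (fun x => minGain (matOfVec (m + x))) γ :=
    Continuous.integrable_stdGaussian (a := ‖m‖) (b := 1)
      (continuous_minGain_matOfVec.comp (continuous_const.add continuous_id)) fun x => by
      simpa using (hgain (m + x)).trans (norm_add_le m x)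
  have i2 : Integrable (fun x => ‖m + x‖) γ :=
    Continuous.integrable_stdGaussian (a := ‖m‖) (b := 1) (by fun_prop) fun x => by
      simpa using norm_add_le m x
  set b := ∫ x, ‖m + x‖ ∂γ with hb
  have hb0 : 0 ≤ b := integral_nonneg fun _ => norm_nonneg _
  refine le_of_forall_pos_le_add fun η hη => ?_
  set δ := η / (2 + b) with hδ
  have hδ0 : 0 < δ := by positivity
  obtain ⟨C, hC⟩ := exists_softMinGain_le (ι := τ ⊕ κ) he hδ0
  have key : ∀ β : ℝ, 0 ≤ β → β * (∫ x, minGain (matOfVec x) ∂γ) ≤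
      β * (∫ x, minGain (matOfVec (m + x)) ∂γ + η) + C := by
    intro β hβ
    -- The choice ε = δ² makes the smoothing error √ε equal to δ, for a total error δ(2 + b) = η.
    have hε : 0 < δ ^ 2 := by positivity
    have h0 := integrable_softMinGain_add (ι := τ ⊕ κ) (e := e) hβ hε he 0
    simp_rw [zero_add] at h0
    have h1 := integral_mono (i0.const_mul β) h0
      fun x => mul_minGain_le_softMinGain (e := e) hβ hε he x
    have h2 := integral_softMinGain_le_add (κ := κ) (e := e) hβ hε he hd
    have h3 : Integrable (fun x => β * (√(δ ^ 2) + (minGain (matOfVec (m + x)) + δ) +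
        δ * ‖m + x‖)) γ :=
      (((integrable_const (√(δ ^ 2))).add (i1.add (integrable_const δ))).add
        (i2.const_mul δ)).const_mul β
    have h4 := integral_mono (integrable_softMinGain_add (e := e) hβ hε he m)
      (h3.add (integrable_const C)) fun x => hC hβ hε (m + x)
    have h5 : ∫ x, (β * (√(δ ^ 2) + (minGain (matOfVec (m + x)) + δ) + δ * ‖m + x‖) + C) ∂γ =
        β * (∫ x, minGain (matOfVec (m + x)) ∂γ + δ * (2 + b)) + C := by
      rw [Real.sqrt_sq hδ0.le]
      have : ∀ x, β * (δ + (minGain (matOfVec (m + x)) + δ) + δ * ‖m + x‖) + C =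
          β * minGain (matOfVec (m + x)) + β * δ * ‖m + x‖ + (β * (2 * δ) + C) := fun x => by ring
      simp_rw [this]
      have h6 : Integrable (fun x => β * minGain (matOfVec (m + x)) + β * δ * ‖m + x‖) γ :=
        (i1.const_mul _).add (i2.const_mul _)
      rw [integral_add h6 (integrable_const _),
        integral_add (i1.const_mul _) (i2.const_mul _), integral_const_mul, integral_const_mul]
      simp only [integral_const, probReal_univ, one_smul]
      ring
    have h6 : δ * (2 + b) = η := by rw [hδ]; field_simp
    rw [integral_const_mul] at h1
    rw [h6] at h5
    exact h1.trans (h2.trans (h4.trans h5.le))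
  -- The constant C does not depend on β, so a positive gap g is refuted by taking β with β g > C.
  by_contra! hcon
  set g := ∫ x, minGain (matOfVec x) ∂γ - (∫ x, minGain (matOfVec (m + x)) ∂γ + η) with hg
  have hg0 : 0 < g := sub_pos.2 hcon
  have h := key ((|C| + 1) / g) (by positivity)
  have h7 : (|C| + 1) / g * g = |C| + 1 := by field_simp
  have h8 := le_abs_self C
  rw [hg, mul_sub, ← hg] at h7
  linarith

end DiagonalShift

/-! ### Monotonicity under an arbitrary deterministic shift. -/

section Shift

variable {ι κ τ : Type*} [Fintype ι] [Fintype κ] [Fintype τ] [DecidableEq τ] [Nonempty τ]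

lemma minGain_le_orth_mul [DecidableEq ι] (U : OrthGroup ι) (A : Matrix ι τ ℝ)
    (R : OrthGroup τ) : minGain A ≤ minGain (U.1 * A * R.1) := by
  refine le_minGain _ fun v hv => ?_
  rw [toEuclideanLin_mul_apply, toEuclideanLin_mul_apply, norm_toEuclideanLin_orth]
  exact minGain_le A ((norm_toEuclideanLin_orth R v).trans hv)

lemma minGain_orth_mul [DecidableEq ι] (U : OrthGroup ι) (A : Matrix ι τ ℝ) (R : OrthGroup τ) :
    minGain (U.1 * A * R.1) = minGain A := by
  refine le_antisymm ?_ (minGain_le_orth_mul U A R)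
  refine (minGain_le_orth_mul U⁻¹ _ R⁻¹).trans_eq ?_
  congr 1
  change U.1.transpose * (U.1 * A * R.1) * R.1.transpose = A
  calc _ = (U.1.transpose * U.1) * A * (R.1 * R.1.transpose) := by simp only [Matrix.mul_assoc]
    _ = A := by
      rw [OrthGroup.transpose_mul_self U, OrthGroup.mul_transpose_self R, Matrix.one_mul,
        Matrix.mul_one]

/-- A singular value decomposition M = U D Rᵀ makes the shift diagonal; the rotations pass to the
noise, whose law they preserve, and do not affect the minimal gain. -/
lemma integral_minGain_le_add_sum [DecidableEq κ] (M : Matrix (τ ⊕ κ) τ ℝ) :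
    ∫ x, minGain (matOfVec x) ∂(stdGaussian (EuclideanSpace ℝ ((τ ⊕ κ) × τ))) ≤
      ∫ x, minGain (M + matOfVec x) ∂(stdGaussian (EuclideanSpace ℝ ((τ ⊕ κ) × τ))) := by
  obtain ⟨R, l, hl, hgram⟩ := exists_orth_gram_diagonal M
  obtain ⟨U, hU⟩ := exists_orth_mul_eq (A := M * R.1) (B := matOfVec (diagVec κ l)) (by
    rw [hgram]
    ext i j
    rcases eq_or_ne i j with rfl | hij
    · simp [Matrix.mul_apply, matOfVec, diagVec, Matrix.diagonal_apply]
    · simp [Matrix.mul_apply, matOfVec, diagVec, Matrix.diagonal_apply, hij, hij.symm])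
  refine (integral_minGain_le_diagVec_add hl).trans_eq ?_
  rw [← integral_orthAct U⁻¹ R]
  refine integral_congr_ae (.of_forall fun x => ?_)
  dsimp only
  rw [← minGain_orth_mul U _ R⁻¹, matOfVec_add, matOfVec_orthAct, Matrix.mul_add, ← hU,
    Matrix.add_mul]
  congr 1
  change M * R.1 * R.1.transpose + U.1 * (U.1.transpose * matOfVec x * R.1) * R.1.transpose = _
  have h1 : M * R.1 * R.1.transpose = M := by
    rw [Matrix.mul_assoc, OrthGroup.mul_transpose_self R, Matrix.mul_one]
  have h2 : U.1 * (U.1.transpose * matOfVec x * R.1) * R.1.transpose = matOfVec x := by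
    calc _ = (U.1 * U.1.transpose) * matOfVec x * (R.1 * R.1.transpose) := by
          simp only [Matrix.mul_assoc]
      _ = _ := by
        rw [OrthGroup.mul_transpose_self U, OrthGroup.mul_transpose_self R, Matrix.one_mul,
          Matrix.mul_one]
  rw [h1, h2]

omit [Nonempty τ] in
lemma norm_toEuclideanLin_reindex (f : κ ≃ ι) (A : Matrix ι τ ℝ) (v : EuclideanSpace ℝ τ) :
    ‖Matrix.toEuclideanLin (A.submatrix f id) v‖ = ‖Matrix.toEuclideanLin A v‖ := by
  rw [EuclideanSpace.norm_eq, EuclideanSpace.norm_eq, ← f.sum_comp]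
  rfl

omit [Nonempty τ] in
lemma minGain_reindex (f : κ ≃ ι) (A : Matrix ι τ ℝ) :
    minGain (A.submatrix f id) = minGain A := by
  simp only [minGain, norm_toEuclideanLin_reindex]

/-- A deterministic shift of a tall Gaussian matrix does not decrease its mean minimal gain. -/
theorem integral_minGain_le_add (h : Fintype.card τ ≤ Fintype.card ι) (M : Matrix ι τ ℝ) :
    ∫ x, minGain (matOfVec x) ∂(stdGaussian (EuclideanSpace ℝ (ι × τ))) ≤
      ∫ x, minGain (M + matOfVec x) ∂(stdGaussian (EuclideanSpace ℝ (ι × τ))) := by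
  classical
  -- The matrix is tall, so its rows can be relabelled as a square block on top of the remaining
  -- ones.
  obtain ⟨f⟩ : Nonempty (τ ⊕ Fin (Fintype.card ι - Fintype.card τ) ≃ ι) := by
    refine Fintype.card_eq.1 ?_
    simp [h]
  have hinj : Function.Injective
      fun p : (τ ⊕ Fin (Fintype.card ι - Fintype.card τ)) × τ => (f p.1, p.2) :=
    f.injective.prodMap Function.injective_id
  have key := integral_minGain_le_add_sum (M.submatrix f id)
  have hc : Continuous fun x : EuclideanSpace ℝ ((τ ⊕ Fin (Fintype.card ι - Fintype.card τ)) × τ) =>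
      minGain (M.submatrix f id + matOfVec x) := by
    have := continuous_minGain_matOfVec.comp (continuous_const (y := WithLp.toLp 2
      fun p : (τ ⊕ Fin (Fintype.card ι - Fintype.card τ)) × τ => M (f p.1) p.2) |>.add
        continuous_id)
    exact this
  rw [← integral_restrictCoord hinj continuous_minGain_matOfVec,
    ← integral_restrictCoord hinj hc] at key
  have e1 : ∀ x : EuclideanSpace ℝ (ι × τ), matOfVec (restrictCoord
      (fun p : (τ ⊕ Fin (Fintype.card ι - Fintype.card τ)) × τ => (f p.1, p.2)) x) =
      (matOfVec x).submatrix f id := fun x => rfl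
  have e2 : ∀ x : EuclideanSpace ℝ (ι × τ), M.submatrix f id + (matOfVec x).submatrix f id =
      (M + matOfVec x).submatrix f id := fun x => rfl
  simp_rw [e1, e2, minGain_reindex] at key
  exact key

end Shift

/-! ### Mean bounds for singular values of signal plus noise. -/

section MeanSingularValue

variable {ι τ : Type*} [Fintype ι] [DecidableEq ι] [Fintype τ] [DecidableEq τ]

lemma sigmaSucc_add_matOfVec_le (M : Matrix ι τ ℝ) (k : ℕ) (w w' : EuclideanSpace ℝ (ι × τ)) :
    sigmaSucc (M + matOfVec w) k ≤ sigmaSucc (M + matOfVec w') k + ‖w - w'‖ := by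
  refine sigmaSucc_le_add _ _ (norm_nonneg _) (fun v => ?_) k
  rw [add_sub_add_left_eq_sub, ← matOfVec_sub]
  exact norm_toEuclideanLin_matOfVec_le _ _

lemma continuous_sigmaSucc_add_matOfVec (M : Matrix ι τ ℝ) (k : ℕ) :
    Continuous fun w : EuclideanSpace ℝ (ι × τ) => sigmaSucc (M + matOfVec w) k := by
  refine (LipschitzWith.of_le_add_mul 1 fun w w' => ?_).continuous
  rw [NNReal.coe_one, one_mul, dist_eq_norm]
  exact sigmaSucc_add_matOfVec_le M k w w'

lemma integrable_sigmaSucc_add (M : Matrix ι τ ℝ) (k : ℕ) {s : ℝ} (hs : 0 ≤ s) :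
    Integrable (fun w => sigmaSucc (M + matOfVec (s • w)) k)
      (stdGaussian (EuclideanSpace ℝ (ι × τ))) := by
  refine Continuous.integrable_stdGaussian (a := sigmaSucc (M + matOfVec 0) k) (b := s)
    ((continuous_sigmaSucc_add_matOfVec M k).comp (continuous_const_smul s)) fun w => ?_
  rw [Real.norm_of_nonneg (sigmaSucc_nonneg _ _)]
  have h := sigmaSucc_add_matOfVec_le M k (s • w) 0
  rwa [sub_zero, norm_smul, Real.norm_of_nonneg hs] at h

/-- A lower bound for the mean of any nontrivial singular value of a shifted Gaussian matrix. -/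
theorem le_integral_sigmaSucc_add [Nonempty τ] (h : Fintype.card τ ≤ Fintype.card ι)
    (M : Matrix ι τ ℝ) {k : ℕ} (hk : k < Fintype.card τ) {s : ℝ} (hs : 0 ≤ s) :
    s * (chiMean (Fintype.card ι) - chiMean (Fintype.card τ)) ≤
      ∫ w, sigmaSucc (M + matOfVec (s • w)) k ∂(stdGaussian (EuclideanSpace ℝ (ι × τ))) := by
  -- The comparison is for unit variance, with shift s⁻¹ • M, so s = 0 is treated apart.
  rcases hs.eq_or_lt with rfl | hs
  · rw [zero_mul]
    exact integral_nonneg fun w => sigmaSucc_nonneg _ _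
  have : Nonempty ι := Fintype.card_pos_iff.1 (Fintype.card_pos.trans_le h)
  have h1 := integral_minGain_ge (ι := ι) (τ := τ)
  rw [integral_norm_stdGaussian, integral_norm_stdGaussian] at h1
  have h2 := h1.trans (integral_minGain_le_add h (s⁻¹ • M))
  refine (mul_le_mul_of_nonneg_left h2 hs.le).trans ?_
  rw [← integral_const_mul]
  have hle : ∀ w : EuclideanSpace ℝ (ι × τ),
      s * minGain (s⁻¹ • M + matOfVec w) ≤ sigmaSucc (M + matOfVec (s • w)) k := by
    intro w
    refine le_trans ?_ (minGain_le_sigmaSucc _ hk)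
    refine le_minGain _ fun v hv => ?_
    have e : M + matOfVec (s • w) = s • (s⁻¹ • M + matOfVec w) := by
      rw [smul_add, smul_inv_smul₀ hs.ne', matOfVec_smul]
    rw [e, map_smul, LinearMap.smul_apply, norm_smul, Real.norm_of_nonneg hs.le]
    exact mul_le_mul_of_nonneg_left (minGain_le _ hv) hs.le
  exact integral_mono_of_nonneg
    (.of_forall fun w => mul_nonneg hs.le (minGain_nonneg _))
    (integrable_sigmaSucc_add M k hs.le) (.of_forall hle)

omit [DecidableEq ι] in
-- Chevet's bound needs a nonempty set of rows; a matrix without rows has norm 0.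
lemma integral_maxGain_matOfVec_le [Nonempty τ] :
    ∫ w, maxGain (matOfVec w) ∂(stdGaussian (EuclideanSpace ℝ (ι × τ))) ≤
      √(Fintype.card ι) + chiMean (Fintype.card τ) := by
  rcases isEmpty_or_nonempty ι with hι | hι
  · have h0 : ∀ w : EuclideanSpace ℝ (ι × τ), maxGain (matOfVec w) = 0 := fun w =>
      le_antisymm (maxGain_le _ le_rfl fun v _ => by
        rw [Subsingleton.elim (Matrix.toEuclideanLin (matOfVec w) v) 0, norm_zero])
        (maxGain_nonneg _)
    simp_rw [h0, integral_zero]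
    have := chiMean_pos (Fintype.card_pos (α := τ))
    positivity
  · have h := integral_maxGain_le (ι := ι) (τ := τ)
    rw [integral_norm_stdGaussian, integral_norm_stdGaussian] at h
    linarith [chiMean_le_sqrt (Fintype.card_pos (α := ι))]

/-- An upper bound for the mean of the first singular value of a perturbed matrix that vanishes
for the unperturbed one. -/
theorem integral_sigmaSucc_add_rank_le [Nonempty τ] (A : Matrix ι τ ℝ) {s : ℝ} (hs : 0 ≤ s) :
    ∫ w, sigmaSucc (A + matOfVec (s • w)) A.rank ∂(stdGaussian (EuclideanSpace ℝ (ι × τ))) ≤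
      s * (√(Fintype.card ι) + chiMean (Fintype.card τ)) := by
  refine le_trans ?_ (mul_le_mul_of_nonneg_left (integral_maxGain_matOfVec_le (ι := ι)) hs)
  rw [← integral_const_mul]
  have hmax : Integrable (fun w => maxGain (matOfVec w)) (stdGaussian (EuclideanSpace ℝ (ι × τ))) :=
    Continuous.integrable_stdGaussian (a := 0) (b := 1) continuous_maxGain_matOfVec fun w => by
      simpa [Real.norm_of_nonneg (maxGain_nonneg (matOfVec w))] using maxGain_matOfVec_le w
  refine integral_mono (integrable_sigmaSucc_add A _ hs) (hmax.const_mul s) fun w => ?_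
  have h := sigmaSucc_le_add (A + matOfVec (s • w)) A (c := s * maxGain (matOfVec w))
    (mul_nonneg hs (maxGain_nonneg _)) (fun v => ?_) A.rank
  · rwa [sigmaSucc_rank, zero_add] at h
  · rw [add_sub_cancel_left, matOfVec_smul, map_smul, LinearMap.smul_apply, norm_smul,
      Real.norm_of_nonneg hs, mul_assoc]
    exact mul_le_mul_of_nonneg_left (norm_toEuclideanLin_le_maxGain _ v) hs

end MeanSingularValue

/-! ### From independent Gaussian entries to a standard Gaussian vector. -/

section Noise

variable {Ω : Type*} [MeasurableSpace Ω] {P : Measure Ω} [IsProbabilityMeasure P] {n T : ℕ}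
  {E : Ω → Matrix (Fin n) (Fin T) ℝ} {s : ℝ≥0}

/-- Gaussian noise is a scaled standard Gaussian vector. -/
lemma IsGaussianNoise.hasLaw (hE : IsGaussianNoise E s P) :
    HasLaw (fun ω => (WithLp.toLp 2 fun p => E ω p.1 p.2 : EuclideanSpace ℝ (Fin n × Fin T)))
      ((stdGaussian (EuclideanSpace ℝ (Fin n × Fin T))).map fun w => (s : ℝ) • w) P := by
  have hm : ∀ p : Fin n × Fin T, AEMeasurable (fun ω => E ω p.1 p.2) P :=
    fun p => (hE.1 p.1 p.2).aemeasurable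
  have hpi : AEMeasurable (fun ω (p : Fin n × Fin T) => E ω p.1 p.2) P :=
    aemeasurable_pi_lambda _ hm
  refine ⟨(by fun_prop : Measurable (WithLp.toLp 2)).comp_aemeasurable hpi, ?_⟩
  have h1 : P.map (fun ω (p : Fin n × Fin T) => E ω p.1 p.2) =
      (Measure.pi fun _ => gaussianReal 0 1).map fun x p => (s : ℝ) * x p := by
    rw [(iIndepFun_iff_map_fun_eq_pi_map hm).1 hE.2, Measure.pi_map_pi fun p => by fun_prop]
    congr 1
    ext1 p
    rw [(hE.1 p.1 p.2).map_eq, gaussianReal_map_const_mul]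
    congr 1
    · simp
    · ext; simp
  rw [← map_pi_eq_stdGaussian, Measure.map_map (by fun_prop) (by fun_prop)]
  change P.map (WithLp.toLp 2 ∘ fun ω (p : Fin n × Fin T) => E ω p.1 p.2) = _
  rw [← AEMeasurable.map_map_of_aemeasurable (by fun_prop) hpi, h1,
    Measure.map_map (by fun_prop) (by fun_prop)]
  rfl

lemma IsGaussianNoise.integral_comp (hE : IsGaussianNoise E s P)
    {F : EuclideanSpace ℝ (Fin n × Fin T) → ℝ} (hF : Continuous F) :
    ∫ ω, F (WithLp.toLp 2 fun p => E ω p.1 p.2) ∂P =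
      ∫ w, F ((s : ℝ) • w) ∂(stdGaussian (EuclideanSpace ℝ (Fin n × Fin T))) := by
  rw [← integral_map (φ := fun w => (s : ℝ) • w) (by fun_prop) hF.aestronglyMeasurable,
    ← hE.hasLaw.map_eq, integral_map hE.hasLaw.aemeasurable hF.aestronglyMeasurable]

lemma IsGaussianNoise.integrable_comp (hE : IsGaussianNoise E s P)
    {F : EuclideanSpace ℝ (Fin n × Fin T) → ℝ} (hF : Continuous F)
    (h : Integrable (fun w => F ((s : ℝ) • w))
      (stdGaussian (EuclideanSpace ℝ (Fin n × Fin T)))) :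
    Integrable (fun ω => F (WithLp.toLp 2 fun p => E ω p.1 p.2)) P := by
  have h1 : Integrable F ((stdGaussian (EuclideanSpace ℝ (Fin n × Fin T))).map
      fun w => (s : ℝ) • w) :=
    (integrable_map_measure hF.aestronglyMeasurable (by fun_prop)).2 h
  rw [← hE.hasLaw.map_eq] at h1
  exact h1.comp_aemeasurable hE.hasLaw.aemeasurable

end Noise

/-! ### Conclusion. -/

theorem theorem4p12 {Ω : Type*} [MeasurableSpace Ω] (P : Measure Ω) [IsProbabilityMeasure P]
    {n T : ℕ} (M : Matrix (Fin n) (Fin T) ℝ) (E : Ω → Matrix (Fin n) (Fin T) ℝ) (s : ℝ≥0)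
    (hE : IsGaussianNoise E s P)
    (J : Finset (Fin n))
    (hr : M.rank < T)
    (hJ : (J.card : ℝ) < (n : ℝ) + 4 * (T : ℝ) - 4 * √((n : ℝ) * (T : ℝ))) :
    Integrable (fun ω => sigmaSucc (M + E ω) M.rank) P ∧
    Integrable (fun ω => sigmaSucc (rowSubmatrix (M + E ω) J) (rowSubmatrix M J).rank) P ∧
    (s : ℝ) * (√(n : ℝ) - √(J.card : ℝ) - 2 * √(T : ℝ)) ≤
      ∫ ω, (sigmaSucc (M + E ω) M.rank
        - sigmaSucc (rowSubmatrix (M + E ω) J) (rowSubmatrix M J).rank) ∂P := by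

  have hT : 0 < T := by omega
  have : Nonempty (Fin T) := ⟨⟨0, hT⟩⟩
  set γ := stdGaussian (EuclideanSpace ℝ (Fin n × Fin T))
  let f : J × Fin T → Fin n × Fin T := fun p => (p.1.1, p.2)
  have hf : Function.Injective f := Subtype.val_injective.prodMap Function.injective_id
  let FX : EuclideanSpace ℝ (Fin n × Fin T) → ℝ := fun w => sigmaSucc (M + matOfVec w) M.rank
  let FA : EuclideanSpace ℝ (Fin n × Fin T) → ℝ := fun w =>
    sigmaSucc (rowSubmatrix M J + matOfVec (restrictCoord f w)) (rowSubmatrix M J).rank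
  have hs : (0 : ℝ) ≤ s := s.2
  have cX : Continuous FX := continuous_sigmaSucc_add_matOfVec M _
  have cJ : Continuous fun w => sigmaSucc (rowSubmatrix M J + matOfVec ((s : ℝ) • w))
      (rowSubmatrix M J).rank :=
    (continuous_sigmaSucc_add_matOfVec _ _).comp (continuous_const_smul _)
  have cA : Continuous FA :=
    (continuous_sigmaSucc_add_matOfVec _ _).comp (restrictCoord f).continuous
  have iX : Integrable (fun ω => sigmaSucc (M + E ω) M.rank) P :=
    hE.integrable_comp cX (integrable_sigmaSucc_add M _ hs)
  have eA : ∀ w, FA ((s : ℝ) • w) = sigmaSucc (rowSubmatrix M J + matOfVec ((s : ℝ) •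
      restrictCoord f w)) (rowSubmatrix M J).rank := fun w => by simp only [FA, map_smul]
  have iA :
      Integrable (fun ω => sigmaSucc (rowSubmatrix (M + E ω) J) (rowSubmatrix M J).rank) P := by
    refine hE.integrable_comp cA ?_
    simp_rw [eA]
    have h := integrable_sigmaSucc_add (rowSubmatrix M J) (rowSubmatrix M J).rank hs
    rw [← stdGaussian_map_restrictCoord hf] at h
    exact h.comp_measurable (by fun_prop)
  refine ⟨iX, iA, ?_⟩
  rw [integral_sub iX iA]
  have hA : ∫ ω, sigmaSucc (rowSubmatrix (M + E ω) J) (rowSubmatrix M J).rank ∂P ≤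
      s * (√(J.card : ℝ) + chiMean T) := by
    refine (hE.integral_comp cA).trans_le ?_
    simp_rw [eA]
    rw [integral_restrictCoord hf cJ]
    simpa using integral_sigmaSucc_add_rank_le (rowSubmatrix M J) hs
  have hXA : ∫ ω, sigmaSucc (M + E ω) M.rank ∂P = ∫ w, FX ((s : ℝ) • w) ∂γ := hE.integral_comp cX
  rcases le_or_gt T n with hn | hn
  · have hX := le_integral_sigmaSucc_add (by simpa using hn) M (by simpa using hr) hs
    rw [Fintype.card_fin, Fintype.card_fin] at hX
    have h3 := mul_le_mul_of_nonneg_left (sqrt_sub_two_sqrt_le_chiMean hT hn) hs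
    have h4 := hX.trans_eq hXA.symm
    linarith
  -- For n < T one of the two terms √T absorbs √n and the other dominates the chi mean, so
  -- nonnegativity of σ_X* is enough.
  · have hX : 0 ≤ ∫ ω, sigmaSucc (M + E ω) M.rank ∂P :=
      integral_nonneg fun ω => sigmaSucc_nonneg _ _
    have h3 : √(n : ℝ) ≤ √(T : ℝ) := Real.sqrt_le_sqrt (by exact_mod_cast hn.le)
    have h4 := mul_le_mul_of_nonneg_left h3 hs
    have h5 := mul_le_mul_of_nonneg_left (chiMean_le_sqrt hT) hs
    linarith
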